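/- **Setting.** For $v\in\mathbf R^d$ and real $s>0$ let $\|v\|_s=(\sum_i|v_i|^s)^{1/s}$. A mechanism $\mathcal M$ on datasets of $n$ vectors is $\rho$-zCDP if $D_\alpha(\mathcal M(x)\,\|\,\mathcal M(x'))\le\rho\alpha$ for all $\alpha>1$ and all datasets $x,x'$ differing in at most one vector, where $D_\alpha$ is the Rényi divergence of order $\alpha$. *Private quantiles.* For $z\in\mathbf R^n$, $q\in\mathbf R$ and $B,\rho'>0$ let $T=\max(0,\lceil\log_2B\rceil)$. $\mathrm{PrivQuantile}^{B}_{\rho'}(z,q)$ starts with the interval $[-B,B]$ and performs $T$ times the following step: with $m$ the midpoint of the current interval, release $|\{j:z_j\le m\}|+\mathcal N(0,\tfrac{T}{2\rho'})$ (fresh noise), and keep the upper half of the interval if this is at most $qn$, the lower half otherwise. It returns the last interval. *PLAN.* Let $p\ge1$ be an integer, $M,\rho>0$, and let $\hat\sigma\in\mathbf R^d$ have positive entries, $\hat\Sigma=\mathrm{diag}(\hat\sigma^2)$. Let $\rho_1=\rho_2=\rho_3=\rho/3$ and $k=\sqrt n+\kappa\sqrt{1/\rho_2}$ for a constant $\kappa\ge0$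 ($\kappa=0$ gives $k=\sqrt n$). On input $x^{(1)},\dots,x^{(n)}\in\mathbf R^d$: (1) $\tilde\mu_i$ is the midpoint of $\mathrm{PrivQuantile}^{M}_{\rho_1/d}((x^{(j)}_i)_j,\tfrac12)$ for $i=1,\dots,d$; (2) $y^{(j)}=(x^{(j)}-\tilde\mu)\hat\Sigma^{-1/(p+2)}$; (3) $C$ is the upper end of the interval $\mathrm{PrivQuantile}^{2M\sqrt d}_{\rho_2}((\|y^{(j)}\|_2)_j,\tfrac{n-k}{n})$; (4) $\eta\sim\mathcal N(0,\tfrac{2C^2}{\rho_3}I)$, and the output is $\tilde\mu+\tfrac1n\big(\sum_j\min\{C/\|y^{(j)}\|_2,1\}\,y^{(j)}+\eta\big)\hat\Sigma^{1/(p+2)}$. *Well-concentrated distributions.* Given $\sigma\in\mathbf R^d$, call $\hat\sigma$ a good estimate of $\sigma$ if $\sigma_i\le\hat\sigma_i<\big(\sigma_i^{2p/(p+2)}+\|\sigma^{2p/(p+2)}\|_1/d\big)^{(p+2)/(2p)}$ for all $i$ (powers of vectors are coordinate-wise). Let $\mathcal D$ be a distribution on $\mathbf R^d$ with mean $\mu$.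 It is $(\sigma,p)$-well concentrated with constants $A,c>0$, $a\in\mathbf N$ if, with $r=\max(p,2)$, $\mathbf E|X_i-\mu_i|^{r}=\sigma_i^{r}$ for all $i$ (so $\sigma_i^p$ is the $p$th absolute central moment if $p\ge2$, and $\sigma_i$ is the standard deviation if $p=1$), and for all $t>1$ and all good estimates $\hat\sigma$ of $\sigma$ both $$\Pr\Big[\sum_i|X_i-\mu_i|^p>t\|\sigma\|_p^p\Big]\quad\text{and}\quad\Pr\Big[\sum_i\frac{(X_i-\mu_i)^2}{\hat\sigma_i^{4/(p+2)}}>t\,\|\sigma^{p/(p+2)}\|_2^2\Big]$$ are at most $A\exp\!\big(-ct/(1+\log(dt))^a\big)$, that is, $\exp(-\tilde\Omega(t))$. **Theorem.** Let $p\ge1$ be an integer and $\kappa\ge0$. (i) PLAN is $\rho$-zCDP, for all $d\ge1$, $n$, $M,\rho>0$ and $\hat\sigma$ with positive entries. (ii) For all $A,c>0$ and $a\in\mathbf N$ there are $K>0$ and $m\in\mathbf N$, depending only on $p,\kappa,A,c,a$, such that the following holds for all $d\ge1$, $n$, $M,\rho>0$ and $\beta\in(0,1)$. Let $\mathcal D$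 be a distribution supported on $[-M,M]^d$ that is $(\sigma,p)$-well concentrated with constants $A,c,a$, where $\sigma_i\ge1$ for all $i$; let $\hat\sigma$ be a good estimate of $\sigma$, and let $$n\ \ge\ K\log^m(2+d+M+1/\beta)\cdot\max\big(1,\sqrt{d/\rho},1/\rho\big).$$ Let $\tilde\mu^{\rm out}$ be the output of PLAN on $n$ independent samples from $\mathcal D$, and put $$R=K\log^m(2+d+n+M+1/\beta)\cdot\Big(1+\frac{\|\sigma\|_p}{\sqrt n}+\frac{\|\sigma\|_{2p/(p+2)}}{n\sqrt\rho}\Big).$$ Then with probability at least $1-\beta$ over the samples and all the randomness of PLAN, $\|\tilde\mu^{\rm out}-\mu\|_p\le R$. Moreover, with probability at least $1-\beta$ over the samples and the randomness of the quantile searches, the expectation of $\|\tilde\mu^{\rm out}-\mu\|_p$ over the Gaussian noise added in step (4) is at most $R$. -/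

import Mathlib

open MeasureTheory ProbabilityTheory

noncomputable section

namespace Plan

/-! ### Norms, means, Rényi divergence and zero-concentrated differential privacy -/

/-- `‖v‖_p = (∑ |v_i|^p)^(1/p)`, used for every real `p > 0` (a quasi-norm when `p < 1`). -/
def vecNorm {d : ℕ} (p : ℝ) (v : Fin d → ℝ) : ℝ := (∑ i, |v i| ^ p) ^ (1 / p)

/-- The coordinate-wise mean of a distribution on `ℝ^d`. -/
def mean {d : ℕ} (D : Measure (Fin d → ℝ)) (i : Fin d) : ℝ := ∫ x, x i ∂D

open Classical in
/-- The Rényi divergence `D_α(P ‖ Q) = (α - 1)⁻¹ log ∫ (dP/dQ)^α dQ` of order `α > 1`,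
infinite unless `P ≪ Q`. -/
def renyiDiv {Ω : Type*} [MeasurableSpace Ω] (α : ℝ) (P Q : Measure Ω) : EReal :=
  if P ≪ Q then (((α - 1)⁻¹ : ℝ) : EReal) * ENNReal.log (∫⁻ ω, (P.rnDeriv Q ω) ^ α ∂Q) else ⊤

/-- Two datasets of the same size are neighbouring if they differ in at most one record. -/
def Neighboring {n : ℕ} {R : Type*} (x x' : Fin n → R) : Prop :=
  ∃ j, ∀ i, i ≠ j → x i = x' i

/-- A randomized mechanism, given by its output distribution on each dataset,
is `ρ`-zero-concentrated differentially private. -/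
def IsZCDP {n : ℕ} {R Ω : Type*} [MeasurableSpace Ω] (ρ : ℝ)
    (mech : (Fin n → R) → Measure Ω) : Prop :=
  (∀ x, IsProbabilityMeasure (mech x)) ∧
    ∀ α : ℝ, 1 < α → ∀ x x' : Fin n → R, Neighboring x x' →
      renyiDiv α (mech x) (mech x') ≤ ((ρ * α : ℝ) : EReal)

/-! ### Private quantiles by noisy binary search -/

/-- The number of entries of `z` that are at most `b`. -/
def countLE {n : ℕ} (z : Fin n → ℝ) (b : ℝ) : ℕ := Nat.card {j : Fin n // z j ≤ b}

/-- Noisy binary search for a point below which about `target` entries of `z` lie.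
In each round the number of entries up to the midpoint of the current interval is released with
additive noise `s * (noise of the round)`, and the search continues in the upper half if the noisy
count is at most `target`, and in the lower half otherwise. The intervals are pairs
(left end, right end). -/
def search {n : ℕ} (z : Fin n → ℝ) (target s : ℝ) :
    (T : ℕ) → (Fin T → ℝ) → ℝ × ℝ → ℝ × ℝ
  | 0, _, I => I
  | T + 1, w, I =>
      search z target s T (Fin.tail w)
        (if (countLE z ((I.1 + I.2) / 2) : ℝ) + s * w 0 ≤ target
          then ((I.1 + I.2) / 2, I.2) else (I.1, (I.1 + I.2) / 2))

/-- Number of rounds, `log₂ B` rounded up: the intervals left after `steps B` halvings of `[-B, B]`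
have half-length at most `1`. -/
def steps (B : ℝ) : ℕ := ⌈Real.logb 2 B⌉₊

/-- The interval that the `ρ`-zCDP binary search over `[-B, B]` returns for the `q`-th quantile of
`z`. If `w` is a vector of independent standard Gaussians, each of the `T = steps B` counts
(of sensitivity `1`) is released with noise `N(0, T / (2ρ))`, that is, with budget `ρ / T`. -/
def privQuantile {n : ℕ} (ρ B q : ℝ) (z : Fin n → ℝ) (w : Fin (steps B) → ℝ) : ℝ × ℝ :=
  search z (q * n) (Real.sqrt (steps B / (2 * ρ))) (steps B) w (-B, B)

/-! ### The algorithm PLAN -/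

/-- A priori bound on the lengths of the recentred and scaled vectors: if `x` and the rough centre
lie in `[-M, M]^d` and the scaling factors are at most `1`, the lengths are at most `2 M √d`. -/
def lengthBound (d : ℕ) (M : ℝ) : ℝ := 2 * M * Real.sqrt d

/-- The randomness of the two quantile searches (`d` one-dimensional medians, one length
quantile). -/
abbrev QuantileNoise (d : ℕ) (M : ℝ) : Type :=
  (Fin d → Fin (steps M) → ℝ) × (Fin (steps (lengthBound d M)) → ℝ)

/-- All the quantile noise consists of independent standard Gaussians. -/
def quantileNoise (d : ℕ) (M : ℝ) : Measure (QuantileNoise d M) :=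
  (Measure.pi fun _ => Measure.pi fun _ => gaussianReal 0 1).prod
    (Measure.pi fun _ => gaussianReal 0 1)

/-- The standard Gaussian distribution `N(0, I)` on `ℝ^d`. -/
def stdGaussianVec (d : ℕ) : Measure (Fin d → ℝ) := Measure.pi fun _ => gaussianReal 0 1

/-- The rough private centre: the midpoints of the intervals found for the coordinate-wise medians,
the budget `ρ₁` being split evenly over the `d` coordinates. -/
def center {d n : ℕ} (M ρ₁ : ℝ) (x : Fin n → Fin d → ℝ)
    (w : Fin d → Fin (steps M) → ℝ) (i : Fin d) : ℝ :=
  ((privQuantile (ρ₁ / d) M (1 / 2) (fun j => x j i) (w i)).1 +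
    (privQuantile (ρ₁ / d) M (1 / 2) (fun j => x j i) (w i)).2) / 2

/-- The recentred and scaled vectors `y_j = (x_j - c) Σ̂^(-1/(p+2))` with `Σ̂ = diag(σ̂²)`. -/
def scaled {d n : ℕ} (p : ℕ) (σhat : Fin d → ℝ) (x : Fin n → Fin d → ℝ) (c : Fin d → ℝ)
    (j : Fin n) (i : Fin d) : ℝ :=
  (x j i - c i) * (σhat i ^ 2) ^ (-(1 / ((p : ℝ) + 2)))

/-- The clipping threshold: the upper end of the interval found for the `(n-k)/n` quantile of the
lengths of the vectors `y_j`. -/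
def radius {d n : ℕ} (M ρ₂ k : ℝ) (y : Fin n → Fin d → ℝ)
    (w : Fin (steps (lengthBound d M)) → ℝ) : ℝ :=
  (privQuantile ρ₂ (lengthBound d M) ((n - k) / n) (fun j => vecNorm 2 (y j)) w).2

/-- The final estimate `c + (1/n) (∑_j min(C/‖y_j‖₂, 1) y_j + η) Σ̂^(1/(p+2))`, in which
`η = √(2C²/ρ₃) g`, so that `η` has distribution `N(0, (2C²/ρ₃) I)` if `g` is standard Gaussian. -/
def release {d n : ℕ} (p : ℕ) (ρ₃ : ℝ) (σhat : Fin d → ℝ) (y : Fin n → Fin d → ℝ)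
    (c : Fin d → ℝ) (C : ℝ) (g : Fin d → ℝ) (i : Fin d) : ℝ :=
  c i + (1 / (n : ℝ)) *
    ((∑ j, min (C / vecNorm 2 (y j)) 1 * y j i) + Real.sqrt (2 * C ^ 2 / ρ₃) * g i) *
      (σhat i ^ 2) ^ (1 / ((p : ℝ) + 2))

/-- PLAN as a function of the dataset `x`, the quantile noise `w` and the final noise `g`. -/
def plan {d n : ℕ} (p : ℕ) (M k ρ₁ ρ₂ ρ₃ : ℝ) (σhat : Fin d → ℝ) (x : Fin n → Fin d → ℝ)
    (w : QuantileNoise d M) (g : Fin d → ℝ) : Fin d → ℝ :=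
  let c := center M ρ₁ x w.1
  let y := scaled p σhat x c
  let C := radius M ρ₂ k y w.2
  release p ρ₃ σhat y c C g

/-- The output distribution of PLAN on the dataset `x`. -/
def planLaw {d n : ℕ} (p : ℕ) (M k ρ₁ ρ₂ ρ₃ : ℝ) (σhat : Fin d → ℝ)
    (x : Fin n → Fin d → ℝ) : Measure (Fin d → ℝ) :=
  ((quantileNoise d M).prod (stdGaussianVec d)).map
    fun ω => plan p M k ρ₁ ρ₂ ρ₃ σhat x ω.1 ω.2

/-! ### Well-concentrated distributions -/

/-- The estimates `σ̂` of `σ` that are accurate enough: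
`σ_i ≤ σ̂_i < (σ_i^(2p/(p+2)) + ‖σ^(2p/(p+2))‖₁ / d)^((p+2)/(2p))`. -/
def IsGoodEstimate {d : ℕ} (p : ℕ) (σ σhat : Fin d → ℝ) : Prop :=
  ∀ i, σ i ≤ σhat i ∧
    σhat i < (σ i ^ (2 * (p : ℝ) / (p + 2)) +
      vecNorm 1 (fun l => σ l ^ (2 * (p : ℝ) / (p + 2))) / d) ^ (((p : ℝ) + 2) / (2 * p))

/-- The tail `A exp(-c t / (1 + log(d t))^a)`. With `A`, `c > 0` and `a` constant, this is
`exp(-Ω̃(t))`, with polylogarithmic factors in `t` and `d` suppressed. -/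
def tail (A c : ℝ) (a d : ℕ) (t : ℝ) : ℝ :=
  A * Real.exp (-(c * t / (1 + Real.log (d * t)) ^ a))

/-- `(σ, p)`-well concentrated distributions, with explicit constants in the tails.
The vector `σ` consists of the `p`-th roots of the `p`-th absolute central moments of the
coordinates if `p ≥ 2`, and of their standard deviations if `p = 1`. -/
structure IsWellConcentrated {d : ℕ} (A c : ℝ) (a p : ℕ) (D : Measure (Fin d → ℝ))
    (σ : Fin d → ℝ) : Prop where
  memLp : ∀ i, MemLp (fun x => x i) ((max p 2 : ℕ) : ENNReal) D
  moment : ∀ i, ∫ x, |x i - mean D i| ^ max p 2 ∂D = σ i ^ max p 2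
  tail_norm : ∀ t : ℝ, 1 < t →
    D {x | t * vecNorm p σ ^ p < ∑ i, |x i - mean D i| ^ p} ≤ ENNReal.ofReal (tail A c a d t)
  tail_scaled : ∀ σhat : Fin d → ℝ, IsGoodEstimate p σ σhat → ∀ t : ℝ, 1 < t →
    D {x | t * vecNorm 2 (fun i => σ i ^ ((p : ℝ) / (p + 2))) ^ 2 <
        ∑ i, (x i - mean D i) ^ 2 / σhat i ^ (4 / ((p : ℝ) + 2))} ≤
      ENNReal.ofReal (tail A c a d t)

/-- The error rate `1 + ‖σ‖_p / √n + ‖σ‖_{2p/(p+2)} / (n √ρ)`. -/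
def rate {d : ℕ} (p n : ℕ) (ρ : ℝ) (σ : Fin d → ℝ) : ℝ :=
  1 + vecNorm p σ / Real.sqrt n + vecNorm (2 * (p : ℝ) / (p + 2)) σ / (n * Real.sqrt ρ)

end Plan

end

noncomputable section

namespace Plan

open scoped ENNReal NNReal

/-! ### Rényi divergence of images of a tilted law -/

/-! Privacy. All randomness of PLAN is Gaussian noise, and exchanging the dataset for a neighbouring
one can be undone by moving the noise: there is a map `φ` of the noise space such that PLAN on `x`
with noise `ω` equals PLAN on `x'` with noise `φ ω`. Shifting a standard Gaussian by `δ` produces a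
density whose `α`-th moment is `exp ((α - 1) α δ² / 2)`. These exponents add up under composition,
even if a shift depends on the noise already shifted; `IsTilt` carries a parameter space for this
purpose, and `IsTilt.prod` and `IsTilt.pi_succ` are the composition rules. A count changes by at
most `1` and a clipped sum by at most `2|C|`, so with the variances of the algorithm each of the
three stages costs `αρ/3` (`exists_isTilt_plan`). Data processing (`lintegral_rnDeriv_rpow_le`)
carries the moment bound over to the output laws.

Utility. Write `S = ∑ σ_i^(2p/(p+2))`. Up to probability `β` the data are typical: in every
coordinate at most a quarter of the samples are further than `4σ_i` from the mean, and every sample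
has its `p`-norm and its scaled squared length within a polylogarithmic factor `t` of their scales.
The noisy medians are then within `5σ_i` of the mean, the threshold `C` is at most `10 t √S`, and
only `O(√n)` samples are clipped. The error splits into three parts (`vecNorm_release_sub_le`).
Clipping: `O(√n)` samples move by `O(t ‖σ‖_p)` each, which after division by `n` gives `‖σ‖_p / √n`.
Noise: its size is `C / (n √ρ)` times the `p`-norm of the scaling factors, which is at most `2
S^(1/p)` for a good estimate, and `√S · S^(1/p) = ‖σ‖_{2p/(p+2)}` (`scaledVar_rpow`). Sampling: the
expected `p`-norm of the centred sum follows from a moment bound for sums of independent variables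
(`integral_abs_sum_pow_le`), and concentration around it from bounded differences, applied to
truncated samples (`measure_vecNorm_centredSum_gt_le`). -/

/-- Data processing: if integrals against `P` are integrals against `Q` of functions pulled back
along `G` and weighted by `f`, then the power moment of `dP/d(Q.map G)` is at most that of `f`. -/
theorem lintegral_rnDeriv_rpow_le {Ω Ω' : Type*} [MeasurableSpace Ω] [MeasurableSpace Ω']
    {Q : Measure Ω} [IsProbabilityMeasure Q] {P : Measure Ω'} [IsProbabilityMeasure P]
    {G : Ω → Ω'} (hG : Measurable G) {f : Ω → ℝ≥0∞} (hf : Measurable f)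
    (hP : ∀ h : Ω' → ℝ≥0∞, Measurable h → ∫⁻ y, h y ∂P = ∫⁻ ω, h (G ω) * f ω ∂Q)
    {α : ℝ} (hα : 1 < α) :
    P ≪ Q.map G ∧ ∫⁻ y, (P.rnDeriv (Q.map G) y) ^ α ∂(Q.map G) ≤ ∫⁻ ω, f ω ^ α ∂Q := by
  have : IsProbabilityMeasure (Q.map G) := Measure.isProbabilityMeasure_map hG.aemeasurable
  have hac : P ≪ Q.map G := by
    refine Measure.AbsolutelyContinuous.mk fun s hs h0 => ?_
    rw [Measure.map_apply hG hs] at h0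
    have h1 := hP (s.indicator 1) (measurable_one.indicator hs)
    rw [lintegral_indicator_one hs] at h1
    have hm : Measurable fun ω => s.indicator (1 : Ω' → ℝ≥0∞) (G ω) * f ω :=
      ((measurable_one.indicator hs).comp hG).mul hf
    rw [h1, lintegral_eq_zero_iff hm]
    filter_upwards [compl_mem_ae_iff.mpr h0] with ω hω
    have : G ω ∉ s := hω
    simp [this]
  refine ⟨hac, ?_⟩
  have hα0 : 0 < α := by linarith
  set r := P.rnDeriv (Q.map G) with hr
  have hrm : Measurable r := Measure.measurable_rnDeriv _ _
  have hwd : (Q.map G).withDensity r = P := Measure.withDensity_rnDeriv_eq _ _ hac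
  set B := ∫⁻ ω, f ω ^ α ∂Q with hB
  -- With `I` the moment of the density, Hölder gives `I ≤ I^(1 - 1/α) B^(1/α)`. Truncating at `N`
  -- makes `I` finite, so that it can be cancelled; monotone convergence removes the truncation.
  have key : ∀ N : ℕ, ∫⁻ y, (min (r y) N) ^ α ∂(Q.map G) ≤ B := by
    intro N
    set t : Ω' → ℝ≥0∞ := fun y => min (r y) N with ht
    have htm : Measurable t := hrm.min measurable_const
    set I := ∫⁻ y, t y ^ α ∂(Q.map G) with hI
    have hIfin : I ≠ ∞ := by
      have : I ≤ ∫⁻ y, (N : ℝ≥0∞) ^ α ∂(Q.map G) :=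
        lintegral_mono fun y => ENNReal.rpow_le_rpow (min_le_right _ _) hα0.le
      refine ne_top_of_le_ne_top ?_ this
      simp only [lintegral_const, measure_univ, mul_one]
      exact ENNReal.rpow_ne_top_of_nonneg hα0.le (ENNReal.natCast_ne_top N)
    have h1 : I ≤ ∫⁻ y, t y ^ (α - 1) ∂P := by
      rw [← hwd, lintegral_withDensity_eq_lintegral_mul _ hrm (htm.pow_const _)]
      refine lintegral_mono fun y => ?_
      have htt : t y ≠ ∞ := ne_top_of_le_ne_top (ENNReal.natCast_ne_top N) (min_le_right _ _)
      have : t y ^ α = t y * t y ^ (α - 1) := by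
        conv_lhs => rw [show α = 1 + (α - 1) by ring]
        rw [ENNReal.rpow_add_of_nonneg _ _ zero_le_one (by linarith), ENNReal.rpow_one]
      simp only [Pi.mul_apply]
      rw [this]
      gcongr
      exact min_le_left _ _
    have hconj : (α / (α - 1)).HolderConjugate α := by
      rw [Real.holderConjugate_iff]
      constructor
      · rw [lt_div_iff₀ (by linarith)]; linarith
      · field_simp; ring
    have h2 : ∫⁻ y, t y ^ (α - 1) ∂P ≤ I ^ (1 / (α / (α - 1))) * B ^ (1 / α) := by
      rw [hP _ (htm.pow_const _)]
      refine (ENNReal.lintegral_mul_le_Lp_mul_Lq Q hconj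
        ((htm.comp hG).pow_const _).aemeasurable hf.aemeasurable).trans ?_
      gcongr
      · rw [hI, lintegral_map (htm.pow_const _) hG]
        refine lintegral_mono fun ω => ?_
        rw [← ENNReal.rpow_mul]
        have : (α - 1) * (α / (α - 1)) = α := by field_simp [show α - 1 ≠ 0 by linarith]
        rw [this, Function.comp_apply]
    have h3 : I ≤ I ^ (1 / (α / (α - 1))) * B ^ (1 / α) := h1.trans h2
    rcases eq_or_ne I 0 with h0 | h0
    · rw [h0]; exact zero_le
    have he : 1 / (α / (α - 1)) = 1 - 1 / α := by field_simp
    rw [he, ENNReal.rpow_sub _ _ h0 hIfin, ENNReal.rpow_one] at h3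
    have hpos : I ^ (1 / α) ≠ 0 := (ENNReal.rpow_pos (pos_iff_ne_zero.mpr h0) hIfin).ne'
    have hfin : I ^ (1 / α) ≠ ∞ := ENNReal.rpow_ne_top_of_nonneg (by positivity) hIfin
    have h4 : I ^ (1 / α) ≤ B ^ (1 / α) := by
      have h5 : I * I ^ (1 / α) ≤ I * B ^ (1 / α) := by
        calc I * I ^ (1 / α) ≤ (I / I ^ (1 / α) * B ^ (1 / α)) * I ^ (1 / α) := by gcongr
          _ = (I / I ^ (1 / α) * I ^ (1 / α)) * B ^ (1 / α) := by ring
          _ = I * B ^ (1 / α) := by rw [ENNReal.div_mul_cancel hpos hfin]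
      exact (ENNReal.mul_le_mul_iff_right h0 hIfin).mp h5
    exact (ENNReal.rpow_le_rpow_iff (by positivity)).mp h4
  have hmono : ∀ᵐ y ∂(Q.map G), r y < ∞ := Measure.rnDeriv_lt_top _ _
  have hsup : ∫⁻ y, r y ^ α ∂(Q.map G) = ⨆ N : ℕ, ∫⁻ y, (min (r y) N) ^ α ∂(Q.map G) := by
    rw [← lintegral_iSup]
    · refine lintegral_congr_ae ?_
      filter_upwards [hmono] with y hy
      refine le_antisymm ?_ (iSup_le fun N => ENNReal.rpow_le_rpow (min_le_left _ _) hα0.le)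
      obtain ⟨N, hN⟩ := ENNReal.exists_nat_gt hy.ne
      refine le_trans ?_ (le_iSup _ N)
      simp only [min_eq_left hN.le]; exact le_rfl
    · exact fun N => (hrm.min measurable_const).pow_const _
    · intro a b hab y
      refine ENNReal.rpow_le_rpow ?_ hα0.le
      exact min_le_min le_rfl (by exact_mod_cast hab)
  rw [hsup]
  exact iSup_le key

theorem renyiDiv_le_of_lintegral {Ω : Type*} [MeasurableSpace Ω] {P Q : Measure Ω} {α b : ℝ}
    (hα : 1 < α) (hac : P ≪ Q)
    (h : ∫⁻ ω, (P.rnDeriv Q ω) ^ α ∂Q ≤ ENNReal.ofReal (Real.exp ((α - 1) * b))) :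
    renyiDiv α P Q ≤ ((b : ℝ) : EReal) := by
  have h1 : ENNReal.log (∫⁻ ω, (P.rnDeriv Q ω) ^ α ∂Q) ≤ (((α - 1) * b : ℝ) : EReal) := by
    refine (ENNReal.log_monotone h).trans ?_
    rw [ENNReal.log_ofReal_of_pos (Real.exp_pos _), Real.log_exp]
  have hpos : (0 : EReal) ≤ (((α - 1)⁻¹ : ℝ) : EReal) := by
    exact_mod_cast inv_nonneg.mpr (by linarith)
  rw [renyiDiv, if_pos hac]
  refine (mul_le_mul_of_nonneg_left h1 hpos).trans ?_
  rw [← EReal.coe_mul, inv_mul_cancel_left₀ (by linarith)]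

/-! ### Families of measurable maps that tilt a law by a bounded amount -/

/-- Each map `φ θ` sends `Q` to a measure with density `f θ` whose `α`-th moment is at most
`exp ((α - 1) b θ)`. -/
def IsTilt {Θ Ω : Type*} [MeasurableSpace Θ] [MeasurableSpace Ω] (Q : Measure Ω) (α : ℝ)
    (b : Θ → ℝ) (φ : Θ → Ω → Ω) : Prop :=
  Measurable (Function.uncurry φ) ∧ ∃ f : Θ → Ω → ℝ≥0∞, Measurable (Function.uncurry f) ∧
    ∀ θ, (∀ h : Ω → ℝ≥0∞, Measurable h → ∫⁻ ω, h (φ θ ω) ∂Q = ∫⁻ ω, h ω * f θ ω ∂Q) ∧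
      ∫⁻ ω, f θ ω ^ α ∂Q ≤ ENNReal.ofReal (Real.exp ((α - 1) * b θ))

section

variable {Θ Ω Ω₁ Ω₂ : Type*} [MeasurableSpace Θ] [MeasurableSpace Ω] [MeasurableSpace Ω₁]
  [MeasurableSpace Ω₂]

theorem IsTilt.mono {Q : Measure Ω} {α : ℝ} (hα : 1 < α) {b b' : Θ → ℝ} {φ : Θ → Ω → Ω}
    (h : IsTilt Q α b φ) (hb : ∀ θ, b θ ≤ b' θ) : IsTilt Q α b' φ := by
  obtain ⟨h1, f, hf, h2⟩ := h
  refine ⟨h1, f, hf, fun θ => ⟨(h2 θ).1, (h2 θ).2.trans ?_⟩⟩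
  have := hb θ
  have : 0 ≤ α - 1 := by linarith
  gcongr

theorem isTilt_id (Q : Measure Ω) [IsProbabilityMeasure Q] (α : ℝ) :
    IsTilt Q α (fun _ : Θ => 0) (fun _ ω => ω) := by
  refine ⟨measurable_snd, fun _ _ => 1, measurable_const, fun θ => ⟨fun h _ => by simp, by simp⟩⟩

/-- The density of `N(δ, 1)` with respect to `N(0, 1)` is `exp (δ w - δ² / 2)`, and the Gaussian
moment generating function at `α δ` gives its `α`-th moment. -/
theorem isTilt_gaussianReal (α : ℝ) {δ : Θ → ℝ} (hδ : Measurable δ) :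
    IsTilt (gaussianReal 0 1) α (fun θ => α * δ θ ^ 2 / 2) (fun θ w => w + δ θ) := by
  refine ⟨measurable_snd.add (hδ.comp measurable_fst),
    fun θ w => ENNReal.ofReal (Real.exp (δ θ * w - δ θ ^ 2 / 2)), ?_, fun θ => ⟨?_, ?_⟩⟩
  · unfold Function.uncurry
    fun_prop
  · intro h hh
    have e : gaussianReal (δ θ) 1 = (gaussianReal 0 1).map (· + δ θ) := by
      rw [gaussianReal_map_add_const, zero_add]
    have hd : Measurable fun w : ℝ => ENNReal.ofReal (Real.exp (δ θ * w - δ θ ^ 2 / 2)) := by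
      fun_prop
    have hmap := lintegral_map (μ := gaussianReal 0 1) hh
      (show Measurable fun w : ℝ => w + δ θ by fun_prop)
    have hd' : Measurable fun w : ℝ => h w * ENNReal.ofReal (Real.exp (δ θ * w - δ θ ^ 2 / 2)) :=
      hh.mul hd
    rw [← hmap, ← e, gaussianReal_of_var_ne_zero _ one_ne_zero, gaussianReal_of_var_ne_zero _ one_ne_zero,
      lintegral_withDensity_eq_lintegral_mul _ (measurable_gaussianPDF _ _) hh,
      lintegral_withDensity_eq_lintegral_mul _ (measurable_gaussianPDF _ _) hd']
    refine lintegral_congr fun w => ?_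
    simp only [Pi.mul_apply]
    rw [mul_comm (h w), ← mul_assoc]
    congr 1
    rw [gaussianPDF, gaussianPDF, ← ENNReal.ofReal_mul (gaussianPDFReal_nonneg _ _ _)]
    congr 1
    rw [gaussianPDFReal, gaussianPDFReal, mul_assoc _ (Real.exp _), ← Real.exp_add]
    congr 2
    push_cast
    ring
  · have hint : Integrable (fun w => Real.exp ((α * δ θ) * w)) (gaussianReal 0 1) :=
      integrable_exp_mul_gaussianReal _
    have hm := mgf_gaussianReal (p := gaussianReal 0 1) (X := id) (μ := 0) (v := 1)
      Measure.map_id (α * δ θ)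
    simp only [mgf, id] at hm
    have e : ∀ w, ENNReal.ofReal (Real.exp (δ θ * w - δ θ ^ 2 / 2)) ^ α =
        ENNReal.ofReal (Real.exp (-(α * δ θ ^ 2 / 2)) * Real.exp ((α * δ θ) * w)) := by
      intro w
      rw [ENNReal.ofReal_rpow_of_pos (Real.exp_pos _), ← Real.exp_mul, ← Real.exp_add]
      congr 2
      ring
    simp_rw [e]
    rw [← ofReal_integral_eq_lintegral_ofReal (hint.const_mul _)
      (Filter.Eventually.of_forall fun w => by positivity), integral_const_mul, hm,
      ← Real.exp_add]
    apply le_of_eq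
    congr 2
    push_cast
    ring

/-- Adaptive composition: the second map may depend on the output of the first. -/
theorem IsTilt.prod {Q₁ : Measure Ω₁} {Q₂ : Measure Ω₂} [SFinite Q₁] [SFinite Q₂] {α : ℝ}
    (hα : 1 < α)
    {b₁ b₂ : Θ → ℝ} {b₂' : Θ × Ω₁ → ℝ} {φ₁ : Θ → Ω₁ → Ω₁} {φ₂ : Θ × Ω₁ → Ω₂ → Ω₂}
    (h₁ : IsTilt Q₁ α b₁ φ₁) (h₂ : IsTilt Q₂ α b₂' φ₂) (hb : ∀ θ a, b₂' (θ, a) ≤ b₂ θ) :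
    IsTilt (Q₁.prod Q₂) α (fun θ => b₁ θ + b₂ θ)
      (fun θ ω => (φ₁ θ ω.1, φ₂ (θ, φ₁ θ ω.1) ω.2)) := by
  obtain ⟨hm₁, f₁, hf₁, h₁⟩ := h₁
  obtain ⟨hm₂, f₂, hf₂, h₂⟩ := h₂
  have hα0 : 0 ≤ α := by linarith
  have m1 : Measurable fun q : Θ × Ω₁ × Ω₂ => φ₁ q.1 q.2.1 :=
    hm₁.comp (measurable_fst.prodMk (measurable_fst.comp measurable_snd))
  have m2 : Measurable fun q : Θ × Ω₁ × Ω₂ => φ₂ (q.1, φ₁ q.1 q.2.1) q.2.2 :=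
    hm₂.comp ((measurable_fst.prodMk m1).prodMk (measurable_snd.comp measurable_snd))
  have mf1 : Measurable fun q : Θ × Ω₁ × Ω₂ => f₁ q.1 q.2.1 :=
    hf₁.comp (measurable_fst.prodMk (measurable_fst.comp measurable_snd))
  have mf2 : Measurable fun q : Θ × Ω₁ × Ω₂ => f₂ (q.1, q.2.1) q.2.2 :=
    hf₂.comp ((measurable_fst.prodMk (measurable_fst.comp measurable_snd)).prodMk
      (measurable_snd.comp measurable_snd))
  refine ⟨m1.prodMk m2, fun θ ω => f₁ θ ω.1 * f₂ (θ, ω.1) ω.2, mf1.mul mf2, fun θ => ⟨?_, ?_⟩⟩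
  · intro h hh
    have s1 : Measurable (φ₁ θ) := hm₁.comp (measurable_const.prodMk measurable_id)
    have s2 : Measurable fun ω : Ω₁ × Ω₂ => φ₂ (θ, φ₁ θ ω.1) ω.2 :=
      m2.comp (measurable_const.prodMk measurable_id)
    have s2' : Measurable fun ω : Ω₁ × Ω₂ => φ₂ (θ, ω.1) ω.2 :=
      hm₂.comp ((measurable_const.prodMk measurable_fst).prodMk measurable_snd)
    have t1 : Measurable (f₁ θ) := hf₁.comp (measurable_const.prodMk measurable_id)
    have t2 : Measurable fun ω : Ω₁ × Ω₂ => f₂ (θ, ω.1) ω.2 :=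
      mf2.comp (measurable_const.prodMk measurable_id)
    have u1 : Measurable fun ω : Ω₁ × Ω₂ => h (φ₁ θ ω.1, φ₂ (θ, φ₁ θ ω.1) ω.2) :=
      hh.comp ((s1.comp measurable_fst).prodMk s2)
    have u2 : Measurable fun ω : Ω₁ × Ω₂ => h ω * (f₁ θ ω.1 * f₂ (θ, ω.1) ω.2) :=
      hh.mul ((t1.comp measurable_fst).mul t2)
    have u3 : Measurable fun ω : Ω₁ × Ω₂ => h (ω.1, φ₂ (θ, ω.1) ω.2) :=
      hh.comp (measurable_fst.prodMk s2')
    rw [lintegral_prod _ u1.aemeasurable, lintegral_prod _ u2.aemeasurable]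
    -- The second map sees the first noise only after it has been moved. The inner integral is
    -- therefore a function of `φ₁ θ ω.1`, and the change of variables for `φ₁` applies to it as a
    -- whole.
    have := (h₁ θ).1 (fun a => ∫⁻ y, h (a, φ₂ (θ, a) y) ∂Q₂) u3.lintegral_prod_right'
    refine this.trans (lintegral_congr fun a => ?_)
    rw [(h₂ (θ, a)).1 (fun y => h (a, y)) (hh.comp measurable_prodMk_left), mul_comm]
    have m : Measurable fun y => h (a, y) * f₂ (θ, a) y :=
      (hh.comp measurable_prodMk_left).mul (t2.comp measurable_prodMk_left)
    rw [← lintegral_const_mul _ m]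
    refine lintegral_congr fun y => ?_
    simp only
    ring
  · have u2 : Measurable fun ω : Ω₁ × Ω₂ => (f₁ θ ω.1 * f₂ (θ, ω.1) ω.2) ^ α :=
      ((mf1.mul mf2).comp (measurable_const.prodMk measurable_id)).pow_const _
    rw [lintegral_prod _ u2.aemeasurable]
    calc ∫⁻ a, ∫⁻ y, (f₁ θ a * f₂ (θ, a) y) ^ α ∂Q₂ ∂Q₁
        ≤ ∫⁻ a, f₁ θ a ^ α * ENNReal.ofReal (Real.exp ((α - 1) * b₂ θ)) ∂Q₁ := by
          refine lintegral_mono fun a => ?_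
          simp_rw [ENNReal.mul_rpow_of_nonneg _ _ hα0]
          have m : Measurable (f₂ (θ, a)) := hf₂.comp (measurable_const.prodMk measurable_id)
          rw [lintegral_const_mul _ (m.pow_const _)]
          refine mul_le_mul_right ((h₂ (θ, a)).2.trans ?_) _
          have := hb θ a
          have : 0 ≤ α - 1 := by linarith
          gcongr
      _ ≤ _ := by
          have m : Measurable (f₁ θ) := hf₁.comp (measurable_const.prodMk measurable_id)
          rw [lintegral_mul_const _ (m.pow_const _), mul_add,
            Real.exp_add, ENNReal.ofReal_mul (Real.exp_pos _).le]
          exact mul_le_mul_left (h₁ θ).2 _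

theorem IsTilt.congr_equiv {Q₁ : Measure Ω₁} {Q₂ : Measure Ω₂} {α : ℝ} {b : Θ → ℝ}
    {φ : Θ → Ω₂ → Ω₂} (h : IsTilt Q₂ α b φ) (e : Ω₁ ≃ᵐ Ω₂) (he : MeasurePreserving e Q₁ Q₂) :
    IsTilt Q₁ α b (fun θ ω => e.symm (φ θ (e ω))) := by
  obtain ⟨hm, f, hf, h⟩ := h
  refine ⟨e.symm.measurable.comp (hm.comp (measurable_fst.prodMk
    (e.measurable.comp measurable_snd))), fun θ ω => f θ (e ω),
    hf.comp (measurable_fst.prodMk (e.measurable.comp measurable_snd)), fun θ => ⟨?_, ?_⟩⟩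
  · intro g hg
    have h1 := he.lintegral_comp_emb e.measurableEmbedding (fun y => g (e.symm (φ θ y)))
    have h2 := he.lintegral_comp_emb e.measurableEmbedding (fun y => g (e.symm y) * f θ y)
    simp only [MeasurableEquiv.symm_apply_apply] at h2
    rw [h1, h2, (h θ).1 (fun y => g (e.symm y)) (hg.comp e.symm.measurable)]
  · have h1 := he.lintegral_comp_emb e.measurableEmbedding (fun y => f θ y ^ α)
    rw [h1]
    exact (h θ).2

theorem IsTilt.comp_param {Θ' : Type*} [MeasurableSpace Θ'] {Q : Measure Ω} {α : ℝ} {b : Θ → ℝ}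
    {φ : Θ → Ω → Ω} (h : IsTilt Q α b φ) {g : Θ' → Θ} (hg : Measurable g) :
    IsTilt Q α (fun θ => b (g θ)) (fun θ => φ (g θ)) := by
  obtain ⟨hm, f, hf, h⟩ := h
  exact ⟨hm.comp ((hg.comp measurable_fst).prodMk measurable_snd), fun θ => f (g θ),
    hf.comp ((hg.comp measurable_fst).prodMk measurable_snd), fun θ => h (g θ)⟩

/-- Composition along the first coordinate of a power. -/
theorem IsTilt.pi_succ {Q : Measure Ω} [SigmaFinite Q] {α : ℝ} (hα : 1 < α) {n : ℕ}
    {b₁ b₂ : Θ → ℝ} {b₂' : Θ × Ω → ℝ} {φ₁ : Θ → Ω → Ω}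
    {φ₂ : Θ × Ω → (Fin n → Ω) → (Fin n → Ω)}
    (h₁ : IsTilt Q α b₁ φ₁) (h₂ : IsTilt (Measure.pi fun _ : Fin n => Q) α b₂' φ₂)
    (hb : ∀ θ a, b₂' (θ, a) ≤ b₂ θ) :
    IsTilt (Measure.pi fun _ : Fin (n + 1) => Q) α (fun θ => b₁ θ + b₂ θ)
      (fun θ ω => Fin.cons (φ₁ θ (ω 0)) (φ₂ (θ, φ₁ θ (ω 0)) (Fin.tail ω))) := by
  have h := (h₁.prod hα h₂ hb).congr_equiv
    (MeasurableEquiv.piFinSuccAbove (fun _ : Fin (n + 1) => Ω) 0)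
    (measurePreserving_piFinSuccAbove (fun _ : Fin (n + 1) => Q) 0)
  convert h using 3 with θ ω
  simp [MeasurableEquiv.piFinSuccAbove, Fin.insertNthEquiv]

/-- Composition of independent maps on the coordinates of a power. -/
theorem IsTilt.pi {Q : Measure Ω} [IsProbabilityMeasure Q] {α : ℝ} (hα : 1 < α) {n : ℕ}
    {b : Fin n → Θ → ℝ} {φ : Fin n → Θ → Ω → Ω} (h : ∀ i, IsTilt Q α (b i) (φ i)) :
    IsTilt (Measure.pi fun _ : Fin n => Q) α (fun θ => ∑ i, b i θ)
      (fun θ ω i => φ i θ (ω i)) := by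
  induction n with
  | zero =>
    convert isTilt_id (Θ := Θ) (Measure.pi fun _ : Fin 0 => Q) α using 3 with θ θ ω
    · simp
  | succ n ih =>
    have h2 := (ih (fun i => h i.succ)).comp_param (measurable_fst : Measurable
      (Prod.fst : Θ × Ω → Θ))
    convert (h 0).pi_succ hα h2 (b₂ := fun θ => ∑ i : Fin n, b i.succ θ)
      (fun _ _ => le_rfl) using 3 with θ θ ω
    · rw [Fin.sum_univ_succ]
    · funext i
      refine Fin.cases ?_ (fun i => ?_) i <;> simp [Fin.tail]

end

/-! ### Measurability of the mechanism -/

theorem countLE_eq_sum {n : ℕ} (z : Fin n → ℝ) (b : ℝ) :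
    (countLE z b : ℝ) = ∑ j, if z j ≤ b then (1 : ℝ) else 0 := by
  classical
  rw [countLE, Nat.card_eq_fintype_card, Fintype.card_subtype, Finset.sum_boole]

theorem measurable_countLE {n : ℕ} {Θ : Type*} [MeasurableSpace Θ] {z : Θ → Fin n → ℝ} {b : Θ → ℝ}
    (hz : Measurable z) (hb : Measurable b) :
    Measurable fun θ => (countLE (z θ) (b θ) : ℝ) := by
  simp_rw [countLE_eq_sum]
  refine Finset.measurable_sum _ fun j _ => ?_
  exact Measurable.ite (measurableSet_le ((measurable_pi_apply j).comp hz) hb)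
    measurable_const measurable_const

/-- The interval after one round of the search. -/
def nextInterval {n : ℕ} (z : Fin n → ℝ) (target r : ℝ) (I : ℝ × ℝ) : ℝ × ℝ :=
  if (countLE z ((I.1 + I.2) / 2) : ℝ) + r ≤ target
    then ((I.1 + I.2) / 2, I.2) else (I.1, (I.1 + I.2) / 2)

theorem search_succ {n : ℕ} (z : Fin n → ℝ) (target s : ℝ) {T : ℕ} (w : Fin (T + 1) → ℝ)
    (I : ℝ × ℝ) :
    search z target s (T + 1) w I =
      search z target s T (Fin.tail w) (nextInterval z target (s * w 0) I) := rfl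

theorem measurable_nextInterval {n : ℕ} {Θ : Type*} [MeasurableSpace Θ] {z : Θ → Fin n → ℝ}
    (target : ℝ) {r : Θ → ℝ} {I : Θ → ℝ × ℝ} (hz : Measurable z) (hr : Measurable r)
    (hI : Measurable I) :
    Measurable fun θ => nextInterval (z θ) target (r θ) (I θ) := by
  have hm : Measurable fun θ => ((I θ).1 + (I θ).2) / 2 := by fun_prop
  exact Measurable.ite
    (measurableSet_le ((measurable_countLE hz hm).add hr) measurable_const)
    (hm.prodMk hI.snd) (hI.fst.prodMk hm)

theorem measurable_search {n : ℕ} (target s : ℝ) {T : ℕ} {Θ : Type*} [MeasurableSpace Θ]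
    {z : Θ → Fin n → ℝ} {w : Θ → Fin T → ℝ} {I : Θ → ℝ × ℝ} (hz : Measurable z)
    (hw : Measurable w) (hI : Measurable I) :
    Measurable fun θ => search (z θ) target s T (w θ) (I θ) := by
  induction T generalizing I with
  | zero => exact hI
  | succ T ih =>
    simp_rw [search_succ]
    refine ih (w := fun θ => Fin.tail (w θ)) ?_ ?_
    · exact measurable_pi_lambda _ fun i => (measurable_pi_apply i.succ).comp hw
    · exact measurable_nextInterval target hz
        (((measurable_pi_apply 0).comp hw).const_mul s) hI

theorem measurable_privQuantile {n : ℕ} (ρ B q : ℝ) {Θ : Type*} [MeasurableSpace Θ]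
    {z : Θ → Fin n → ℝ} {w : Θ → Fin (steps B) → ℝ} (hz : Measurable z) (hw : Measurable w) :
    Measurable fun θ => privQuantile ρ B q (z θ) (w θ) :=
  measurable_search _ _ hz hw measurable_const

section

variable {d n : ℕ} {Θ : Type*} [MeasurableSpace Θ]

theorem measurable_vecNorm (p : ℝ) {v : Θ → Fin d → ℝ} (hv : Measurable v) :
    Measurable fun θ => vecNorm p (v θ) := by
  unfold vecNorm
  have : ∀ i, Measurable fun θ => v θ i := fun i => (measurable_pi_apply i).comp hv
  fun_prop

theorem measurable_center (M ρ₁ : ℝ) (x : Fin n → Fin d → ℝ) {w : Θ → Fin d → Fin (steps M) → ℝ}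
    (hw : Measurable w) : Measurable fun θ => center M ρ₁ x (w θ) := by
  refine measurable_pi_lambda _ fun i => ?_
  have h : Measurable fun θ => privQuantile (ρ₁ / d) M (1 / 2) (fun j => x j i) (w θ i) :=
    measurable_privQuantile _ _ _ measurable_const ((measurable_pi_apply i).comp hw)
  exact (h.fst.add h.snd).div_const 2

theorem measurable_scaled (p : ℕ) (σhat : Fin d → ℝ) (x : Fin n → Fin d → ℝ) {c : Θ → Fin d → ℝ}
    (hc : Measurable c) : Measurable fun θ => scaled p σhat x (c θ) := by
  refine measurable_pi_lambda _ fun j => measurable_pi_lambda _ fun i => ?_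
  exact (((measurable_pi_apply i).comp hc).const_sub (x j i)).mul_const _

theorem measurable_radius (M ρ₂ k : ℝ) {y : Θ → Fin n → Fin d → ℝ}
    {w : Θ → Fin (steps (lengthBound d M)) → ℝ} (hy : Measurable y) (hw : Measurable w) :
    Measurable fun θ => radius M ρ₂ k (y θ) (w θ) :=
  (measurable_privQuantile _ _ _ (measurable_pi_lambda _ fun j =>
    measurable_vecNorm 2 ((measurable_pi_apply j).comp hy)) hw).snd

/-- The sum of the vectors `y j` clipped to length `C`. -/
def clippedSum (y : Fin n → Fin d → ℝ) (C : ℝ) (i : Fin d) : ℝ :=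
  ∑ j, min (C / vecNorm 2 (y j)) 1 * y j i

theorem measurable_clippedSum {y : Θ → Fin n → Fin d → ℝ} {C : Θ → ℝ} (hy : Measurable y)
    (hC : Measurable C) : Measurable fun θ => clippedSum (y θ) (C θ) := by
  refine measurable_pi_lambda _ fun i => Finset.measurable_sum _ fun j _ => ?_
  have h : Measurable fun θ => y θ j := (measurable_pi_apply j).comp hy
  exact ((hC.div (measurable_vecNorm 2 h)).min measurable_const).mul
    ((measurable_pi_apply i).comp h)

theorem measurable_plan (p : ℕ) (M k ρ₁ ρ₂ ρ₃ : ℝ) (σhat : Fin d → ℝ) (x : Fin n → Fin d → ℝ) :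
    Measurable fun ω : QuantileNoise d M × (Fin d → ℝ) =>
      plan p M k ρ₁ ρ₂ ρ₃ σhat x ω.1 ω.2 := by
  have hc : Measurable fun ω : QuantileNoise d M × (Fin d → ℝ) => center M ρ₁ x ω.1.1 :=
    measurable_center M ρ₁ x measurable_fst.fst
  have hy := measurable_scaled p σhat x hc
  have hC := measurable_radius M ρ₂ k hy
    (measurable_fst.snd : Measurable fun ω : QuantileNoise d M × (Fin d → ℝ) => ω.1.2)
  have hs := measurable_clippedSum hy hC
  refine measurable_pi_lambda _ fun i => ?_
  exact ((measurable_pi_apply i).comp hc).add (((((measurable_pi_apply i).comp hs).add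
    ((((hC.pow_const 2).const_mul 2).div_const ρ₃).sqrt.mul
      ((measurable_pi_apply i).comp measurable_snd))).const_mul (1 / (n : ℝ))).mul_const _)

end

/-! ### Privacy of the searches and of the release -/

theorem abs_countLE_sub_le {n : ℕ} {z z' : Fin n → ℝ} (h : Neighboring z z') (b : ℝ) :
    |(countLE z b : ℝ) - countLE z' b| ≤ 1 := by
  obtain ⟨j, hj⟩ := h
  rw [countLE_eq_sum, countLE_eq_sum, ← Finset.sum_sub_distrib,
    Finset.sum_eq_single j (fun i _ hi => by rw [hj i hi, sub_self]) (by simp)]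
  split_ifs <;> norm_num

/-- A search on `z` is a search on neighbouring data `z'` with shifted noise. -/
theorem exists_isTilt_search {n : ℕ} {α : ℝ} (hα : 1 < α) (target : ℝ) {s : ℝ} {T : ℕ}
    (hs : T ≠ 0 → 0 < s) {Θ : Type*} [MeasurableSpace Θ] {z z' : Θ → Fin n → ℝ}
    {I : Θ → ℝ × ℝ} (hz : Measurable z) (hz' : Measurable z') (hI : Measurable I)
    (hn : ∀ θ, Neighboring (z θ) (z' θ)) :
    ∃ φ : Θ → (Fin T → ℝ) → (Fin T → ℝ),
      IsTilt (Measure.pi fun _ : Fin T => gaussianReal 0 1) α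
        (fun _ => T * (α / (2 * s ^ 2))) φ ∧
      ∀ θ w, search (z θ) target s T w (I θ) = search (z' θ) target s T (φ θ w) (I θ) := by
  induction T generalizing Θ with
  | zero =>
    refine ⟨fun _ w => w, ?_, fun θ w => rfl⟩
    simpa using isTilt_id (Θ := Θ) (Measure.pi fun _ : Fin 0 => gaussianReal 0 1) α
  | succ T ih =>
    have hs0 : 0 < s := hs (Nat.succ_ne_zero T)
    -- This shift gives `z'` the same noisy count as `z`, so both searches take the same branch.
    let δ : Θ → ℝ := fun θ => ((countLE (z θ) (((I θ).1 + (I θ).2) / 2) : ℝ) -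
      countLE (z' θ) (((I θ).1 + (I θ).2) / 2)) / s
    have hm : Measurable fun θ => ((I θ).1 + (I θ).2) / 2 := by fun_prop
    have hδ : Measurable δ :=
      ((measurable_countLE hz hm).sub (measurable_countLE hz' hm)).div_const s
    -- The remaining rounds depend on the first one only through the next interval, which is
    -- determined by the shifted noise; that noise joins the parameters.
    obtain ⟨φ₂, h₂, e₂⟩ := ih (fun _ => hs0) (Θ := Θ × ℝ) (z := fun q => z q.1)
      (z' := fun q => z' q.1)
      (I := fun q => nextInterval (z' q.1) target (s * q.2) (I q.1))
      (hz.comp measurable_fst) (hz'.comp measurable_fst)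
      (measurable_nextInterval target (hz'.comp measurable_fst) (measurable_snd.const_mul s)
        (hI.comp measurable_fst)) (fun q => hn q.1)
    have h₁ : IsTilt (gaussianReal 0 1) α (fun _ : Θ => α / (2 * s ^ 2))
        (fun θ w => w + δ θ) := by
      refine (isTilt_gaussianReal α hδ).mono hα fun θ => ?_
      have h1 := abs_countLE_sub_le (hn θ) (((I θ).1 + (I θ).2) / 2)
      have h2 : δ θ ^ 2 ≤ 1 / s ^ 2 := by
        simp only [δ]
        rw [div_pow]
        gcongr
        exact (sq_le_one_iff_abs_le_one _).mpr h1
      calc α * δ θ ^ 2 / 2 ≤ α * (1 / s ^ 2) / 2 := by gcongr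
        _ = _ := by field_simp
    refine ⟨_, (h₁.pi_succ hα h₂ (b₂ := fun _ => T * (α / (2 * s ^ 2)))
      (fun _ _ => le_rfl)).mono hα fun θ => ?_, fun θ w => ?_⟩
    · apply le_of_eq
      push_cast
      ring
    · rw [search_succ, search_succ]
      simp only [Fin.cons_zero, Fin.tail_cons]
      have e : nextInterval (z θ) target (s * w 0) (I θ) =
          nextInterval (z' θ) target (s * (w 0 + δ θ)) (I θ) := by
        have : s * (w 0 + δ θ) = s * w 0 + ((countLE (z θ) (((I θ).1 + (I θ).2) / 2) : ℝ) -
            countLE (z' θ) (((I θ).1 + (I θ).2) / 2)) := by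
          simp only [δ]; field_simp
        rw [nextInterval, nextInterval, this]
        congr 2
        ring
      rw [e]
      exact e₂ (θ, w 0 + δ θ) (Fin.tail w)

/-- Each of the `T` rounds costs `α / (2 s²)` with `s² = T / (2ρ)`, in total `αρ`. For `T = 0` the
noise scale is `0`, which is why positivity of `s` is required only for `T ≠ 0`. -/
theorem exists_isTilt_privQuantile {n : ℕ} {α : ℝ} (hα : 1 < α) {ρ : ℝ} (hρ : 0 < ρ) (B q : ℝ)
    {Θ : Type*} [MeasurableSpace Θ] {z z' : Θ → Fin n → ℝ} (hz : Measurable z)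
    (hz' : Measurable z') (hn : ∀ θ, Neighboring (z θ) (z' θ)) :
    ∃ φ : Θ → (Fin (steps B) → ℝ) → (Fin (steps B) → ℝ),
      IsTilt (Measure.pi fun _ : Fin (steps B) => gaussianReal 0 1) α (fun _ => α * ρ) φ ∧
      ∀ θ w, privQuantile ρ B q (z θ) w = privQuantile ρ B q (z' θ) (φ θ w) := by
  obtain ⟨φ, h, e⟩ := exists_isTilt_search hα (q * n) (s := Real.sqrt (steps B / (2 * ρ)))
    (T := steps B) (fun hT => Real.sqrt_pos.mpr (by positivity)) hz hz'
    (I := fun _ => (-B, B)) measurable_const hn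
  refine ⟨φ, h.mono hα fun _ => ?_, e⟩
  rcases Nat.eq_zero_or_pos (steps B) with h0 | h0
  · rw [h0]; simp only [Nat.cast_zero, zero_mul]; positivity
  · have : (0 : ℝ) < steps B := by exact_mod_cast h0
    rw [Real.sq_sqrt (by positivity)]
    apply le_of_eq
    field_simp

theorem vecNorm_two_sq {d : ℕ} (v : Fin d → ℝ) : vecNorm 2 v ^ 2 = ∑ i, v i ^ 2 := by
  have h : 0 ≤ ∑ i, |v i| ^ (2 : ℝ) := Finset.sum_nonneg fun i _ => by positivity
  rw [vecNorm, ← Real.rpow_natCast, ← Real.rpow_mul h]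
  norm_num

/-- No sign of `C` can be assumed: an unlucky search may return a negative upper end. Clipping still
leaves a vector of length at most `|C|`, and a zero vector contributes `0`. -/
theorem sum_clip_sq_le {d : ℕ} (y : Fin d → ℝ) (C : ℝ) :
    ∑ i, (min (C / vecNorm 2 y) 1 * y i) ^ 2 ≤ C ^ 2 := by
  simp_rw [mul_pow]
  rw [← Finset.mul_sum, ← vecNorm_two_sq]
  have h0 : 0 ≤ vecNorm 2 y := by
    rw [vecNorm]
    exact Real.rpow_nonneg (Finset.sum_nonneg fun i _ => by positivity) _
  rcases h0.eq_or_lt with h | h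
  · rw [← h]; simp; positivity
  · have h1 : min (C / vecNorm 2 y) 1 ^ 2 ≤ (C / vecNorm 2 y) ^ 2 := by
      rcases le_total (C / vecNorm 2 y) 1 with h1 | h1
      · rw [min_eq_left h1]
      · rw [min_eq_right h1]
        nlinarith
    calc _ ≤ (C / vecNorm 2 y) ^ 2 * vecNorm 2 y ^ 2 := by gcongr
      _ = C ^ 2 := by rw [← mul_pow, div_mul_cancel₀ _ h.ne']

/-- Sums of vectors clipped to length `C` have sensitivity `2 |C|`. -/
theorem sum_clippedSum_sub_sq_le {d n : ℕ} {y y' : Fin n → Fin d → ℝ} (h : Neighboring y y')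
    (C : ℝ) : ∑ i, (clippedSum y C i - clippedSum y' C i) ^ 2 ≤ 4 * C ^ 2 := by
  obtain ⟨j, hj⟩ := h
  have e : ∀ i, clippedSum y C i - clippedSum y' C i =
      min (C / vecNorm 2 (y j)) 1 * y j i - min (C / vecNorm 2 (y' j)) 1 * y' j i := by
    intro i
    rw [clippedSum, clippedSum, ← Finset.sum_sub_distrib,
      Finset.sum_eq_single j (fun l _ hl => by rw [hj l hl, sub_self]) (by simp)]
  simp_rw [e]
  have h1 := sum_clip_sq_le (y j) C
  have h2 := sum_clip_sq_le (y' j) C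
  calc _ ≤ ∑ i, (2 * (min (C / vecNorm 2 (y j)) 1 * y j i) ^ 2 +
        2 * (min (C / vecNorm 2 (y' j)) 1 * y' j i) ^ 2) := by
        refine Finset.sum_le_sum fun i _ => ?_
        nlinarith [sq_nonneg (min (C / vecNorm 2 (y j)) 1 * y j i +
          min (C / vecNorm 2 (y' j)) 1 * y' j i)]
    _ ≤ _ := by
        rw [Finset.sum_add_distrib, ← Finset.mul_sum, ← Finset.mul_sum]
        linarith

/-! ### Privacy of PLAN -/

theorem exists_isTilt_center {d n : ℕ} (hd : 1 ≤ d) {α : ℝ} (hα : 1 < α) {ρ : ℝ} (hρ : 0 < ρ)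
    (M : ℝ) {x x' : Fin n → Fin d → ℝ} (hx : Neighboring x x') :
    ∃ φ : Unit → (Fin d → Fin (steps M) → ℝ) → (Fin d → Fin (steps M) → ℝ),
      IsTilt (Measure.pi fun _ => Measure.pi fun _ => gaussianReal 0 1) α
        (fun _ => α * ρ) φ ∧
      ∀ θ w, center M ρ x w = center M ρ x' (φ θ w) := by
  have hd0 : (0 : ℝ) < d := by exact_mod_cast hd
  have hn : ∀ i, Neighboring (fun j => x j i) (fun j => x' j i) := fun i => by
    obtain ⟨j, hj⟩ := hx
    exact ⟨j, fun l hl => by simp only [hj l hl]⟩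
  choose φ h e using fun i : Fin d => exists_isTilt_privQuantile hα (div_pos hρ hd0) M (1 / 2)
    (Θ := Unit) (z := fun _ j => x j i) (z' := fun _ j => x' j i) measurable_const
    measurable_const (fun _ => hn i)
  refine ⟨_, (IsTilt.pi hα h).mono hα fun _ => ?_, fun θ w => ?_⟩
  · rw [Finset.sum_const, Finset.card_univ, Fintype.card_fin, nsmul_eq_mul]
    apply le_of_eq
    field_simp
  · funext i
    rw [center, center, e i θ (w i)]

/-- After the first shift both runs have the same centre, so the rescaled datasets are again
neighbours. After the second they have the same threshold, and the clipped sums differ by at most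
`2|C|`, which the third shift compensates. -/
theorem exists_isTilt_plan {d n : ℕ} (hd : 1 ≤ d) {α : ℝ} (hα : 1 < α) (p : ℕ) (M k : ℝ)
    {ρ₁ ρ₂ ρ₃ : ℝ} (h₁ : 0 < ρ₁) (h₂ : 0 < ρ₂) (h₃ : 0 < ρ₃) (σhat : Fin d → ℝ)
    {x x' : Fin n → Fin d → ℝ} (hx : Neighboring x x') :
    ∃ φ : Unit → QuantileNoise d M × (Fin d → ℝ) → QuantileNoise d M × (Fin d → ℝ),
      IsTilt ((quantileNoise d M).prod (stdGaussianVec d)) α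
        (fun _ => α * (ρ₁ + ρ₂ + ρ₃)) φ ∧
      ∀ ω, plan p M k ρ₁ ρ₂ ρ₃ σhat x ω.1 ω.2 =
        plan p M k ρ₁ ρ₂ ρ₃ σhat x' (φ () ω).1 (φ () ω).2 := by
  obtain ⟨φ₁, t₁, e₁⟩ := exists_isTilt_center hd hα h₁ M hx
  have hsc : ∀ c, Neighboring (scaled p σhat x c) (scaled p σhat x' c) := fun c => by
    obtain ⟨j, hj⟩ := hx
    exact ⟨j, fun l hl => by funext i; simp only [scaled, hj l hl]⟩
  have hy : ∀ x : Fin n → Fin d → ℝ,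
      Measurable fun q : Unit × (Fin d → Fin (steps M) → ℝ) =>
        scaled p σhat x (center M ρ₁ x' q.2) := fun x =>
    measurable_scaled p σhat x (measurable_center M ρ₁ x' measurable_snd)
  have hl : ∀ x : Fin n → Fin d → ℝ,
      Measurable fun q : Unit × (Fin d → Fin (steps M) → ℝ) =>
        fun j => vecNorm 2 (scaled p σhat x (center M ρ₁ x' q.2) j) := fun x =>
    measurable_pi_lambda _ fun j =>
      measurable_vecNorm 2 ((measurable_pi_apply j).comp (hy x))
  obtain ⟨φ₂, t₂, e₂⟩ := exists_isTilt_privQuantile hα h₂ (lengthBound d M) ((n - k) / n)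
    (hl x) (hl x') (fun q => by
      obtain ⟨j, hj⟩ := hsc (center M ρ₁ x' q.2)
      exact ⟨j, fun l hl => by simp only [hj l hl]⟩)
  have t₁₂ := t₁.prod hα t₂ (b₂ := fun _ => α * ρ₂) (fun _ _ => le_rfl)
  let C : Unit × QuantileNoise d M → ℝ := fun q =>
    radius M ρ₂ k (scaled p σhat x' (center M ρ₁ x' q.2.1)) q.2.2
  have hc' : Measurable fun q : Unit × QuantileNoise d M => center M ρ₁ x' q.2.1 :=
    measurable_center M ρ₁ x' measurable_snd.fst
  have hy' : ∀ x : Fin n → Fin d → ℝ, Measurable fun q : Unit × QuantileNoise d M =>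
      scaled p σhat x (center M ρ₁ x' q.2.1) := fun x => measurable_scaled p σhat x hc'
  have hC : Measurable C := measurable_radius M ρ₂ k (hy' x') measurable_snd.snd
  -- The difference of the clipped sums in units of the noise scale, of squared length at most `4C²
  -- / (2C²/ρ₃) = 2ρ₃`. If `C = 0`, both sums vanish and division by zero gives `δ = 0`.
  let δ : Unit × QuantileNoise d M → Fin d → ℝ := fun q i =>
    (clippedSum (scaled p σhat x (center M ρ₁ x' q.2.1)) (C q) i -
      clippedSum (scaled p σhat x' (center M ρ₁ x' q.2.1)) (C q) i) / √(2 * C q ^ 2 / ρ₃)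
  have hδ : ∀ i, Measurable fun q => δ q i := fun i =>
    (((measurable_pi_apply i).comp (measurable_clippedSum (hy' x) hC)).sub
      ((measurable_pi_apply i).comp (measurable_clippedSum (hy' x') hC))).div
      (((hC.pow_const 2).const_mul 2).div_const ρ₃).sqrt
  have hδ2 : ∀ q, ∑ i, δ q i ^ 2 ≤ 2 * ρ₃ := by
    intro q
    have hs := sum_clippedSum_sub_sq_le (hsc (center M ρ₁ x' q.2.1)) (C q)
    simp only [δ, div_pow]
    rw [← Finset.sum_div, Real.sq_sqrt (by positivity)]
    rcases eq_or_ne (C q) 0 with h0 | h0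
    · rw [h0]; simp; positivity
    · rw [div_le_iff₀ (by positivity)]
      refine hs.trans (le_of_eq ?_)
      field_simp
      norm_num
  have t₃ := IsTilt.pi hα (fun i => isTilt_gaussianReal α (hδ i))
  refine ⟨_, (t₁₂.prod hα t₃ (b₂ := fun _ => α * ρ₃) fun θ a => ?_).mono hα fun _ => ?_,
    fun ω => ?_⟩
  · rw [← Finset.sum_div, ← Finset.mul_sum]
    have := hδ2 (θ, a)
    have : 0 < α := by linarith
    calc _ ≤ α * (2 * ρ₃) / 2 := by gcongr
      _ = _ := by ring
  · apply le_of_eq; ring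
  · set w₁ := φ₁ () ω.1.1 with hw₁
    set w₂ := φ₂ ((), w₁) ω.1.2 with hw₂
    have ec : center M ρ₁ x ω.1.1 = center M ρ₁ x' w₁ := e₁ () ω.1.1
    have er : radius M ρ₂ k (scaled p σhat x (center M ρ₁ x' w₁)) ω.1.2 =
        C ((), (w₁, w₂)) := congrArg Prod.snd (e₂ ((), w₁) ω.1.2)
    funext i
    change release p ρ₃ σhat (scaled p σhat x (center M ρ₁ x ω.1.1)) (center M ρ₁ x ω.1.1)
      (radius M ρ₂ k (scaled p σhat x (center M ρ₁ x ω.1.1)) ω.1.2) ω.2 i =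
      release p ρ₃ σhat (scaled p σhat x' (center M ρ₁ x' w₁)) (center M ρ₁ x' w₁)
      (C ((), (w₁, w₂))) (fun i => ω.2 i + δ ((), (w₁, w₂)) i) i
    rw [ec, er, release, release]
    congr 3
    change clippedSum (scaled p σhat x (center M ρ₁ x' w₁)) (C ((), (w₁, w₂))) i + _ =
      clippedSum (scaled p σhat x' (center M ρ₁ x' w₁)) (C ((), (w₁, w₂))) i + _
    rcases eq_or_ne (C ((), (w₁, w₂))) 0 with h0 | h0
    · simp [h0, clippedSum]
    · have : √(2 * C ((), (w₁, w₂)) ^ 2 / ρ₃) ≠ 0 := (Real.sqrt_pos.mpr (by positivity)).ne'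
      simp only [δ]
      field_simp
      ring

instance (d : ℕ) : IsProbabilityMeasure (stdGaussianVec d) := by
  unfold stdGaussianVec; infer_instance

instance (d : ℕ) (M : ℝ) : IsProbabilityMeasure (quantileNoise d M) := by
  unfold quantileNoise; infer_instance

/-- By `exists_isTilt_plan`, the output law on `x` is the image of a tilted noise law under PLAN on
`x'`, so data processing applies. -/
theorem isZCDP_planLaw {d n : ℕ} (hd : 1 ≤ d) (p : ℕ) (M k : ℝ) {ρ : ℝ} (hρ : 0 < ρ)
    (σhat : Fin d → ℝ) :
    IsZCDP ρ (planLaw (n := n) p M k (ρ / 3) (ρ / 3) (ρ / 3) σhat) := by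
  have hprob : ∀ x : Fin n → Fin d → ℝ,
      IsProbabilityMeasure (planLaw p M k (ρ / 3) (ρ / 3) (ρ / 3) σhat x) := fun x =>
    Measure.isProbabilityMeasure_map (measurable_plan ..).aemeasurable
  refine ⟨hprob, fun α hα x x' hx => ?_⟩
  have hρ3 : 0 < ρ / 3 := by positivity
  obtain ⟨φ, ⟨hφ, f, hf, h⟩, e⟩ := exists_isTilt_plan hd hα p M k hρ3 hρ3 hρ3 σhat hx
  have hG := measurable_plan p M k (ρ / 3) (ρ / 3) (ρ / 3) σhat x'
  have := hprob x
  have key := lintegral_rnDeriv_rpow_le (P := planLaw p M k (ρ / 3) (ρ / 3) (ρ / 3) σhat x) hG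
    (f := f ()) (hf.comp (measurable_const.prodMk measurable_id)) (fun g hg => by
      rw [planLaw, lintegral_map hg (measurable_plan ..)]
      simp_rw [e]
      exact (h ()).1 (fun ω => g (plan p M k (ρ / 3) (ρ / 3) (ρ / 3) σhat x' ω.1 ω.2))
        (hg.comp hG)) hα
  have e3 : α * (ρ / 3 + ρ / 3 + ρ / 3) = ρ * α := by ring
  have hb := (h ()).2
  rw [e3] at hb
  exact renyiDiv_le_of_lintegral hα key.1 (key.2.trans hb)

/-! ### Bounded differences -/

theorem measurePreserving_cons {Ω : Type*} [MeasurableSpace Ω] (D : Measure Ω)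
    [IsProbabilityMeasure D] (n : ℕ) :
    MeasurePreserving (fun q : Ω × (Fin n → Ω) => (Fin.cons q.1 q.2 : Fin (n + 1) → Ω))
      (D.prod (Measure.pi fun _ => D)) (Measure.pi fun _ => D) := by
  have h := (measurePreserving_piFinSuccAbove (fun _ : Fin (n + 1) => D) 0).symm
  convert h using 1
  funext q
  simp [MeasurableEquiv.piFinSuccAbove, Fin.insertNthEquiv]

theorem integrable_of_abs_le {Ω : Type*} [MeasurableSpace Ω] {P : Measure Ω} [IsFiniteMeasure P]
    {f : Ω → ℝ} (hf : Measurable f) {B : ℝ} (h : ∀ x, |f x| ≤ B) : Integrable f P :=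
  Integrable.of_bound hf.aestronglyMeasurable B (Filter.Eventually.of_forall h)

theorem abs_integral_le_of_abs_le {Ω : Type*} [MeasurableSpace Ω] {P : Measure Ω}
    [IsProbabilityMeasure P] {f : Ω → ℝ} {B : ℝ} (h : ∀ x, |f x| ≤ B) : |∫ x, f x ∂P| ≤ B := by
  have := norm_integral_le_of_norm_le_const (μ := P) (f := f) (C := B)
    (Filter.Eventually.of_forall h)
  simpa using this

/-- Functions of independent variables with bounded differences are sub-Gaussian. -/
theorem hasSubgaussianMGF_of_bounded_differences {Ω : Type*} [MeasurableSpace Ω] (D : Measure Ω)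
    [IsProbabilityMeasure D] (c : ℝ≥0) {n : ℕ} {f : (Fin n → Ω) → ℝ} (hf : Measurable f) {B : ℝ}
    (hB : ∀ x, |f x| ≤ B)
    (hc : ∀ x y : Fin n → Ω, ∀ j, (∀ i, i ≠ j → x i = y i) → |f x - f y| ≤ c) :
    HasSubgaussianMGF (fun x => f x - ∫ y, f y ∂(Measure.pi fun _ => D)) (n * c ^ 2)
      (Measure.pi fun _ => D) := by
  induction n with
  | zero =>
    have e : (fun x => f x - ∫ y, f y ∂(Measure.pi fun _ : Fin 0 => D)) = fun _ => 0 := by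
      funext x
      have : ∀ y, f y = f x := fun y => by rw [Subsingleton.elim y x]
      simp [this]
    rw [e]
    simp
  | succ n ih =>
    set P := Measure.pi fun _ : Fin n => D
    set F : Ω × (Fin n → Ω) → ℝ := fun q => f (Fin.cons q.1 q.2) with hF
    have hmp := measurePreserving_cons D n
    have hFm : Measurable F := hf.comp hmp.measurable
    have hFB : ∀ q, |F q| ≤ B := fun q => hB _
    have hFi : ∀ a, Integrable (fun x => F (a, x)) P := fun a =>
      integrable_of_abs_le (hFm.comp measurable_prodMk_left) fun x => hFB _
    -- The deviation of `f` splits into that of `g`, which depends on the first coordinate alone,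
    -- and that of `f` around `g` with the first coordinate fixed, to which induction applies.
    set g : Ω → ℝ := fun a => ∫ x, F (a, x) ∂P with hg
    have hgm : Measurable g := (hFm.stronglyMeasurable.integral_prod_right').measurable
    have hgc : ∀ a a', |g a - g a'| ≤ c := by
      intro a a'
      rw [hg, ← integral_sub (hFi a) (hFi a')]
      refine abs_integral_le_of_abs_le fun x => ?_
      refine hc _ _ 0 fun i hi => ?_
      obtain ⟨k, rfl⟩ := Fin.exists_succ_eq.mpr hi
      simp
    obtain ⟨a₀⟩ : Nonempty Ω := nonempty_of_isProbabilityMeasure D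
    have hsg : HasSubgaussianMGF (fun a => g a - ∫ a, g a ∂D) (c ^ 2) D := by
      -- All values of `g` are within `c` of a single one. Hoeffding's lemma on this interval of
      -- length `2c` gives `c²`; the sharper `c²/4` is not needed.
      have h := hasSubgaussianMGF_of_mem_Icc (μ := D) (a := g a₀ - c) (b := g a₀ + c)
        hgm.aemeasurable (Filter.Eventually.of_forall fun a => by
          have := abs_le.mp (hgc a a₀)
          constructor <;> linarith)
      convert h using 1
      have : g a₀ + c - (g a₀ - c) = 2 * (c : ℝ) := by ring
      rw [this]
      ext
      simp
    have hih : ∀ a, HasSubgaussianMGF (fun x => F (a, x) - g a) (n * c ^ 2) P := fun a =>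
      ih (f := fun x => F (a, x)) (hFm.comp measurable_prodMk_left) (fun x => hFB _)
        (fun x y j h => hc _ _ j.succ fun i hi => by
          refine Fin.cases ?_ (fun i hi => ?_) i hi
          · simp
          · simpa using h i fun h' => hi (by rw [h']))
    have hint : ∫ y, f y ∂(Measure.pi fun _ : Fin (n + 1) => D) = ∫ a, g a ∂D := by
      rw [← hmp.map_eq, integral_map hmp.measurable.aemeasurable hf.aestronglyMeasurable,
        integral_prod _ (integrable_of_abs_le hFm hFB)]
    have hgB : ∀ a, |g a| ≤ B := fun a => abs_integral_le_of_abs_le fun x => hFB _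
    have hEg : |∫ a, g a ∂D| ≤ B :=
      abs_integral_le_of_abs_le hgB
    rw [hint]
    have hexp : ∀ (t : ℝ) (x), |Real.exp (t * (f x - ∫ a, g a ∂D))| ≤
        Real.exp (|t| * (B + B)) := by
      intro t x
      rw [abs_of_pos (Real.exp_pos _)]
      refine Real.exp_le_exp.mpr ((le_abs_self _).trans ?_)
      rw [abs_mul]
      gcongr
      exact (abs_sub _ _).trans (add_le_add (hB x) hEg)
    have hm : ∀ t : ℝ, Measurable fun x => Real.exp (t * (f x - ∫ a, g a ∂D)) := fun t => by
      fun_prop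
    refine ⟨fun t => integrable_of_abs_le (hm t) (hexp t), fun t => ?_⟩
    have hmF : Measurable fun q => Real.exp (t * (F q - ∫ a, g a ∂D)) := by fun_prop
    rw [mgf, ← hmp.map_eq, integral_map hmp.measurable.aemeasurable (hm t).aestronglyMeasurable]
    change ∫ q, Real.exp (t * (F q - ∫ a, g a ∂D)) ∂(D.prod P) ≤ _
    have hFint : Integrable (fun q => Real.exp (t * (F q - ∫ a, g a ∂D))) (D.prod P) :=
      integrable_of_abs_le hmF fun q => hexp t _
    rw [integral_prod _ hFint]
    calc ∫ a, ∫ x, Real.exp (t * (F (a, x) - ∫ a, g a ∂D)) ∂P ∂D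
        ≤ ∫ a, Real.exp (t * (g a - ∫ a, g a ∂D)) *
            Real.exp ((n * c ^ 2 : ℝ≥0) * t ^ 2 / 2) ∂D := by
          refine integral_mono hFint.integral_prod_left
            ((hsg.integrable_exp_mul t).mul_const _) fun a => ?_
          have e : ∀ x, Real.exp (t * (F (a, x) - ∫ a, g a ∂D)) =
              Real.exp (t * (g a - ∫ a, g a ∂D)) * Real.exp (t * (F (a, x) - g a)) := fun x => by
            rw [← Real.exp_add]; ring_nf
          simp_rw [e]
          rw [integral_const_mul]
          gcongr
          exact (hih a).mgf_le t
      _ ≤ Real.exp ((c ^ 2 : ℝ≥0) * t ^ 2 / 2) * Real.exp ((n * c ^ 2 : ℝ≥0) * t ^ 2 / 2) := by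
          rw [integral_mul_const]
          gcongr
          exact hsg.mgf_le t
      _ = _ := by
          rw [← Real.exp_add]
          congr 1
          push_cast
          ring

theorem measure_lt_of_bounded_differences {Ω : Type*} [MeasurableSpace Ω] (D : Measure Ω)
    [IsProbabilityMeasure D] {c : ℝ} (hc0 : 0 ≤ c) {n : ℕ} {f : (Fin n → Ω) → ℝ}
    (hf : Measurable f) {B : ℝ} (hB : ∀ x, |f x| ≤ B)
    (hc : ∀ x y : Fin n → Ω, ∀ j, (∀ i, i ≠ j → x i = y i) → |f x - f y| ≤ c) {m ε : ℝ}
    (hm : ∫ y, f y ∂(Measure.pi fun _ => D) ≤ m) (hε : 0 ≤ ε) :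
    (Measure.pi fun _ => D) {x | m + ε < f x} ≤
      ENNReal.ofReal (Real.exp (-ε ^ 2 / (2 * (n * c ^ 2)))) := by
  lift c to ℝ≥0 using hc0
  have h := (hasSubgaussianMGF_of_bounded_differences D c hf hB hc).measure_ge_le hε
  rw [measureReal_def, ← ENNReal.le_ofReal_iff_toReal_le (measure_ne_top _ _)
    (Real.exp_pos _).le] at h
  refine (measure_mono fun x hx => ?_).trans (h.trans (le_of_eq (by push_cast; rfl)))
  simp only [Set.mem_ofPred_eq] at hx ⊢
  linarith

/-! ### Moments of sums of independent centred variables -/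

/-- A second-order Taylor bound. The linear term is kept exactly because it integrates to zero
against a centred variable. In the induction the quadratic coefficient grows by a factor of at most
`4`. -/
theorem add_pow_le_of_abs_le {s z : ℝ} (h : |z| ≤ s) (m : ℕ) :
    (s + z) ^ (m + 2) ≤ s ^ (m + 2) + (m + 2) * s ^ m * s * z + 4 ^ (m + 2) * (s ^ m * z ^ 2) := by
  have hs : 0 ≤ s := (abs_nonneg z).trans h
  obtain ⟨h1, h2⟩ := abs_le.mp h
  induction m with
  | zero => norm_num; nlinarith [sq_nonneg z]
  | succ m ih =>
    have h4 : ((m : ℝ) + 2) ≤ 4 ^ (m + 2) := by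
      have : m + 2 < 4 ^ (m + 2) := Nat.lt_pow_self (by norm_num)
      exact_mod_cast this.le
    have hpos : 0 ≤ s ^ m * z ^ 2 := by positivity
    calc (s + z) ^ (m + 1 + 2) = (s + z) * (s + z) ^ (m + 2) := by ring
      _ ≤ (s + z) * (s ^ (m + 2) + (m + 2) * s ^ m * s * z + 4 ^ (m + 2) * (s ^ m * z ^ 2)) :=
          mul_le_mul_of_nonneg_left ih (by linarith)
      _ = s ^ (m + 1 + 2) + (m + 1 + 2) * s ^ (m + 1) * s * z + ((m + 2) * s +
            4 ^ (m + 2) * (s + z)) * (s ^ m * z ^ 2) := by ring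
      _ ≤ s ^ (m + 1 + 2) + (m + 1 + 2) * s ^ (m + 1) * s * z + (4 ^ (m + 2) * s +
            4 ^ (m + 2) * (s + s)) * (s ^ m * z ^ 2) := by gcongr
      _ ≤ _ := by
          push_cast
          have : 0 ≤ 4 ^ (m + 2) * s * (s ^ m * z ^ 2) := by positivity
          have e : (4 : ℝ) ^ (m + 1 + 2) * (s ^ (m + 1) * z ^ 2) =
              4 * (4 ^ (m + 2) * s * (s ^ m * z ^ 2)) := by ring
          rw [e]
          nlinarith

/-- If `|z| ≤ |s|`, this is the Taylor bound up to signs; otherwise `|z|^(m+2)` dominates all terms.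
-/
theorem abs_add_pow_le (s z : ℝ) (m : ℕ) :
    |s + z| ^ (m + 2) ≤ |s| ^ (m + 2) + (m + 2) * (|s| ^ m * s) * z +
      4 ^ (m + 2) * (|s| ^ m * z ^ 2 + |z| ^ (m + 2)) := by
  rcases le_total |z| |s| with h | h
  · have hz : 0 ≤ (4 : ℝ) ^ (m + 2) * |z| ^ (m + 2) := by positivity
    rcases le_total 0 s with hs | hs
    · rw [abs_of_nonneg hs] at h ⊢
      have h1 := abs_le.mp h
      rw [abs_of_nonneg (by linarith : 0 ≤ s + z)]
      have := add_pow_le_of_abs_le h m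
      nlinarith
    · rw [abs_of_nonpos hs] at h ⊢
      have h1 := abs_le.mp h
      rw [abs_of_nonpos (by linarith : s + z ≤ 0)]
      have := add_pow_le_of_abs_le (s := -s) (z := -z) (by rwa [abs_neg]) m
      rw [show -(s + z) = -s + -z by ring]
      nlinarith
  · have h4 : ((m : ℝ) + 2) ≤ 2 ^ (m + 2) := by
      have : m + 2 < 2 ^ (m + 2) := Nat.lt_pow_self (by norm_num)
      exact_mod_cast this.le
    have h5 : (2 : ℝ) ^ (m + 2) + 2 ^ (m + 2) ≤ 4 ^ (m + 2) := by
      have h6 : (2 : ℝ) ≤ 2 ^ (m + 2) := by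
        have h7 : (1 : ℝ) ≤ 2 ^ m := one_le_pow₀ (by norm_num)
        rw [pow_add]; nlinarith
      have e : (4 : ℝ) ^ (m + 2) = 2 ^ (m + 2) * 2 ^ (m + 2) := by
        rw [← mul_pow]; norm_num
      rw [e]; nlinarith
    have h1 : |s + z| ^ (m + 2) ≤ 2 ^ (m + 2) * |z| ^ (m + 2) := by
      rw [← mul_pow]
      gcongr
      exact (abs_add_le s z).trans (by linarith)
    have h2 : -((m + 2) * (|s| ^ m * s) * z) ≤ 2 ^ (m + 2) * |z| ^ (m + 2) := by
      refine (neg_le_abs _).trans ?_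
      rw [abs_mul, abs_mul, abs_mul, abs_pow, abs_abs,
        abs_of_nonneg (by positivity : (0 : ℝ) ≤ m + 2)]
      calc ((m : ℝ) + 2) * (|s| ^ m * |s|) * |z| ≤ 2 ^ (m + 2) * (|z| ^ m * |z|) * |z| := by gcongr
        _ = _ := by ring
    have h3 : 0 ≤ |s| ^ (m + 2) := by positivity
    have h6 : 0 ≤ (4 : ℝ) ^ (m + 2) * (|s| ^ m * z ^ 2) := by positivity
    have h7 : 0 ≤ |z| ^ (m + 2) := by positivity
    nlinarith

theorem pow_le_one_add_pow {x : ℝ} (hx : 0 ≤ x) {k l : ℕ} (h : k ≤ l) : x ^ k ≤ 1 + x ^ l := by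
  rcases le_total x 1 with h1 | h1
  · have := pow_le_one₀ (n := k) hx h1
    have : 0 ≤ x ^ l := by positivity
    linarith
  · have := pow_le_pow_right₀ h1 h
    linarith

/-- In units of `u`, a lower power is at most `1` plus the higher one. The factor `2` is the price
for avoiding Jensen's inequality. -/
theorem integral_abs_pow_le {Ω : Type*} [MeasurableSpace Ω] {P : Measure Ω}
    [IsProbabilityMeasure P] {X : Ω → ℝ} {k r : ℕ} (hk : k ≤ r) (hX : MemLp X (r : ℝ≥0∞) P)
    {u : ℝ} (hu : 0 < u) (h : ∫ ω, |X ω| ^ r ∂P ≤ u ^ r) :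
    Integrable (fun ω => |X ω| ^ k) P ∧ ∫ ω, |X ω| ^ k ∂P ≤ 2 * u ^ k := by
  have hr : Integrable (fun ω => |X ω| ^ r) P := hX.integrable_norm_pow'
  have hk' : Integrable (fun ω => |X ω| ^ k) P :=
    (hX.mono_exponent (by exact_mod_cast hk)).integrable_norm_pow'
  refine ⟨hk', ?_⟩
  calc ∫ ω, |X ω| ^ k ∂P ≤ ∫ ω, u ^ k * (1 + |X ω| ^ r / u ^ r) ∂P := by
        refine integral_mono hk' (((integrable_const _).add (hr.div_const _)).const_mul _)
          fun ω => ?_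
        have := pow_le_one_add_pow (div_nonneg (abs_nonneg (X ω)) hu.le) hk
        rw [div_pow, div_pow, div_le_iff₀ (by positivity)] at this
        simp only
        linarith
    _ = u ^ k * (1 + (∫ ω, |X ω| ^ r ∂P) / u ^ r) := by
        rw [integral_const_mul, integral_add (integrable_const _) (hr.div_const _),
          integral_div]
        simp
    _ ≤ u ^ k * (1 + 1) := by
        gcongr
        rw [div_le_one (by positivity)]
        exact h
    _ = _ := by ring

theorem memLp_sum_pi {Ω : Type*} [MeasurableSpace Ω] {D : Measure Ω} [IsProbabilityMeasure D]
    {h : Ω → ℝ} {r : ℝ≥0∞} (hh : MemLp h r D) (n : ℕ) :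
    MemLp (fun x : Fin n → Ω => ∑ j, h (x j)) r (Measure.pi fun _ => D) :=
  memLp_finsetSum _ fun j _ => hh.comp_measurePreserving (measurePreserving_eval _ j)

/-- The moments of a sum of `n` independent centred variables grow like those of a Gaussian. -/
theorem integral_abs_sum_pow_le {Ω : Type*} [MeasurableSpace Ω] {D : Measure Ω}
    [IsProbabilityMeasure D] {h : Ω → ℝ} {m : ℕ} (hh : MemLp h ((m + 2 : ℕ) : ℝ≥0∞) D)
    (h0 : ∫ ω, h ω ∂D = 0) {s : ℝ} (hs : 0 < s) (hm : ∫ ω, |h ω| ^ (m + 2) ∂D ≤ s ^ (m + 2))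
    (n : ℕ) :
    ∫ x, |∑ j, h (x j)| ^ (m + 2) ∂(Measure.pi fun _ : Fin n => D) ≤
      (√(5 * 4 ^ (m + 2) * (n + 1)) * s) ^ (m + 2) := by
  induction n with
  | zero => simp; positivity
  | succ n ih =>
    set P := Measure.pi fun _ : Fin n => D
    set C : ℝ := 4 ^ (m + 2) with hC
    have hC1 : 1 ≤ C := one_le_pow₀ (by norm_num)
    set S : (Fin n → Ω) → ℝ := fun x => ∑ j, h (x j) with hSdef
    have hS : MemLp S ((m + 2 : ℕ) : ℝ≥0∞) P := memLp_sum_pi hh n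
    set q : ℝ := 5 * C * (n + 1) with hq
    have hq0 : 0 < q := by positivity
    have hmp := measurePreserving_cons D n
    have hT := memLp_sum_pi hh (n + 1)
    have hTi : Integrable (fun x : Fin (n + 1) → Ω => |∑ j, h (x j)| ^ (m + 2))
      (Measure.pi fun _ => D) := hT.integrable_norm_pow'
    have e1 : ∫ x, |∑ j, h (x j)| ^ (m + 2) ∂(Measure.pi fun _ : Fin (n + 1) => D) =
        ∫ y, |S y.2 + h y.1| ^ (m + 2) ∂(D.prod P) := by
      rw [← hmp.map_eq, integral_map hmp.measurable.aemeasurable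
        (by rw [hmp.map_eq]; exact hTi.aestronglyMeasurable)]
      refine integral_congr_ae (Filter.Eventually.of_forall fun y => ?_)
      simp [Fin.sum_univ_succ, hSdef, add_comm]
    have hTi' : Integrable (fun y : Ω × (Fin n → Ω) => |S y.2 + h y.1| ^ (m + 2))
        (D.prod P) := by
      have := hmp.integrable_comp_of_integrable hTi
      convert this using 2 with y
      simp [Fin.sum_univ_succ, hSdef, add_comm]
    have iS : Integrable (fun x => |S x| ^ (m + 2)) P := hS.integrable_norm_pow'
    have ih' : ∫ x, |S x| ^ (m + 2) ∂P ≤ (√q * s) ^ (m + 2) := ih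
    obtain ⟨iSm, bSm⟩ := integral_abs_pow_le (k := m) (by omega) hS (u := √q * s)
      (by positivity) ih'
    obtain ⟨ih2, bh2⟩ := integral_abs_pow_le (k := 2) (by omega) hh hs hm
    simp only [sq_abs] at ih2 bh2
    have ih1 : Integrable h D := hh.integrable (by norm_cast; omega)
    have ihm : Integrable (fun ω => |h ω| ^ (m + 2)) D := hh.integrable_norm_pow'
    have iS1 : Integrable (fun x => |S x| ^ m * S x) P := by
      refine ((integral_abs_pow_le (k := m + 1) (by omega) hS (u := √q * s)
        (by positivity) ih').1).mono
        (iSm.aestronglyMeasurable.mul hS.aestronglyMeasurable)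
        (Filter.Eventually.of_forall fun x => ?_)
      simp [pow_succ]
    have j1 : Integrable (fun y : Ω × (Fin n → Ω) => |S y.2| ^ (m + 2)) (D.prod P) :=
      iS.comp_snd D
    have j2 : Integrable (fun y : Ω × (Fin n → Ω) => h y.1 * (|S y.2| ^ m * S y.2))
      (D.prod P) := ih1.mul_prod iS1
    have j3 : Integrable (fun y : Ω × (Fin n → Ω) => h y.1 ^ 2 * |S y.2| ^ m)
      (D.prod P) := ih2.mul_prod iSm
    have j4 : Integrable (fun y : Ω × (Fin n → Ω) => |h y.1| ^ (m + 2)) (D.prod P) :=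
      ihm.comp_fst P
    have j2' : Integrable (fun y : Ω × (Fin n → Ω) =>
      ((m : ℝ) + 2) * (h y.1 * (|S y.2| ^ m * S y.2))) (D.prod P) := j2.const_mul _
    have j12 : Integrable (fun y : Ω × (Fin n → Ω) => |S y.2| ^ (m + 2) +
      ((m : ℝ) + 2) * (h y.1 * (|S y.2| ^ m * S y.2))) (D.prod P) := j1.add j2'
    have j34 : Integrable (fun y : Ω × (Fin n → Ω) =>
      C * (h y.1 ^ 2 * |S y.2| ^ m + |h y.1| ^ (m + 2))) (D.prod P) := (j3.add j4).const_mul C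
    have v1 : ∫ y : Ω × (Fin n → Ω), |S y.2| ^ (m + 2) ∂(D.prod P) = ∫ x, |S x| ^ (m + 2) ∂P := by
      simpa using integral_prod_mul (μ := D) (ν := P) (fun _ => (1 : ℝ)) fun x => |S x| ^ (m + 2)
    -- Independence and centring remove the linear term; this is why the growth is that of a
    -- Gaussian.
    have v2 : ∫ y : Ω × (Fin n → Ω), h y.1 * (|S y.2| ^ m * S y.2) ∂(D.prod P) = 0 := by
      have := integral_prod_mul (μ := D) (ν := P) h fun x => |S x| ^ m * S x
      rw [this, h0, zero_mul]
    have v3 : ∫ y : Ω × (Fin n → Ω), h y.1 ^ 2 * |S y.2| ^ m ∂(D.prod P) =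
        (∫ ω, h ω ^ 2 ∂D) * ∫ x, |S x| ^ m ∂P :=
      integral_prod_mul (fun ω => h ω ^ 2) fun x => |S x| ^ m
    have v4 : ∫ y : Ω × (Fin n → Ω), |h y.1| ^ (m + 2) ∂(D.prod P) =
        ∫ ω, |h ω| ^ (m + 2) ∂D := by
      simpa using integral_prod_mul (μ := D) (ν := P) (fun ω => |h ω| ^ (m + 2)) fun _ => (1 : ℝ)
    rw [e1]
    have hSm0 : 0 ≤ ∫ x, |S x| ^ m ∂P := integral_nonneg fun x => by positivity
    calc ∫ y, |S y.2 + h y.1| ^ (m + 2) ∂(D.prod P)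
        ≤ ∫ y, (|S y.2| ^ (m + 2) + (m + 2) * (h y.1 * (|S y.2| ^ m * S y.2)) +
            C * (h y.1 ^ 2 * |S y.2| ^ m + |h y.1| ^ (m + 2))) ∂(D.prod P) := by
          refine integral_mono hTi' (j12.add j34) fun y => ?_
          refine (abs_add_pow_le (S y.2) (h y.1) m).trans (le_of_eq ?_)
          ring
      _ = ∫ x, |S x| ^ (m + 2) ∂P + C * ((∫ ω, h ω ^ 2 ∂D) * (∫ x, |S x| ^ m ∂P) +
            ∫ ω, |h ω| ^ (m + 2) ∂D) := by
          rw [integral_add j12 j34, integral_add j1 j2', integral_const_mul, integral_const_mul,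
            integral_add j3 j4, v1, v2, v3, v4]
          ring
      _ ≤ (√q * s) ^ (m + 2) + C * ((2 * s ^ 2) * (2 * (√q * s) ^ m) + s ^ (m + 2)) := by
          gcongr
      _ = (√q ^ m * q + C * (4 * √q ^ m + 1)) * s ^ (m + 2) := by
          have : √q ^ (m + 2) = √q ^ m * q := by rw [pow_add, Real.sq_sqrt hq0.le]
          rw [mul_pow, this]
          ring
      -- As `√q ≥ 1`, the new terms `C (4 √q^m + 1)` are at most `5 C √q^m`, which is exactly the
      -- increase of `q` from `n` to `n + 1`. The `n + 1` in the bound provides `√q ≥ 1` from the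
      -- start.
      _ ≤ (√(q + 5 * C) ^ m * (q + 5 * C)) * s ^ (m + 2) := by
          have h1 : (1 : ℝ) ≤ √q ^ m := one_le_pow₀ (by
            rw [Real.one_le_sqrt, hq]
            have : (0 : ℝ) ≤ n := Nat.cast_nonneg n
            nlinarith)
          have h2 : √q ^ m ≤ √(q + 5 * C) ^ m := by gcongr; linarith
          gcongr
          calc √q ^ m * q + C * (4 * √q ^ m + 1) ≤ √q ^ m * (q + 5 * C) := by nlinarith
            _ ≤ _ := by gcongr
      _ = _ := by
          have e : q + 5 * C = 5 * C * ((n + 1 : ℕ) + 1) := by rw [hq]; push_cast; ring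
          rw [e, mul_pow, pow_add (√_), Real.sq_sqrt (by positivity)]

/-! ### The norms -/

section

variable {d : ℕ}

theorem vecNorm_nonneg (p : ℝ) (v : Fin d → ℝ) : 0 ≤ vecNorm p v :=
  Real.rpow_nonneg (Finset.sum_nonneg fun i _ => by positivity) _

theorem vecNorm_rpow {p : ℝ} (hp : p ≠ 0) (v : Fin d → ℝ) : vecNorm p v ^ p = ∑ i, |v i| ^ p := by
  have h : 0 ≤ ∑ i, |v i| ^ p := Finset.sum_nonneg fun i _ => by positivity
  rw [vecNorm, ← Real.rpow_mul h, one_div_mul_cancel hp, Real.rpow_one]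

theorem vecNorm_pow {p : ℕ} (hp : p ≠ 0) (v : Fin d → ℝ) : vecNorm p v ^ p = ∑ i, |v i| ^ p := by
  have := vecNorm_rpow (p := p) (by exact_mod_cast hp) v
  simpa only [Real.rpow_natCast] using this

theorem vecNorm_le_iff {p : ℕ} (hp : p ≠ 0) (v : Fin d → ℝ) {b : ℝ} (hb : 0 ≤ b) :
    vecNorm p v ≤ b ↔ ∑ i, |v i| ^ p ≤ b ^ p := by
  rw [← vecNorm_pow hp, pow_le_pow_iff_left₀ (vecNorm_nonneg _ _) hb hp]

theorem vecNorm_add_le {p : ℝ} (hp : 1 ≤ p) (u v : Fin d → ℝ) :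
    vecNorm p (u + v) ≤ vecNorm p u + vecNorm p v :=
  Real.Lp_add_le Finset.univ u v hp

theorem vecNorm_smul {p : ℝ} (hp : 0 < p) (a : ℝ) (v : Fin d → ℝ) :
    vecNorm p (fun i => a * v i) = |a| * vecNorm p v := by
  have h : 0 ≤ ∑ i, |v i| ^ p := Finset.sum_nonneg fun i _ => by positivity
  simp_rw [vecNorm, abs_mul, Real.mul_rpow (abs_nonneg _) (abs_nonneg _)]
  rw [← Finset.mul_sum, Real.mul_rpow (by positivity) h, ← Real.rpow_mul (abs_nonneg _),
    mul_one_div_cancel hp.ne', Real.rpow_one]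

theorem vecNorm_mono {p : ℝ} (hp : 0 < p) {u v : Fin d → ℝ} (h : ∀ i, |u i| ≤ |v i|) :
    vecNorm p u ≤ vecNorm p v := by
  have h0 : 0 ≤ ∑ i, |u i| ^ p := Finset.sum_nonneg fun i _ => by positivity
  exact Real.rpow_le_rpow h0 (Finset.sum_le_sum fun i _ =>
    Real.rpow_le_rpow (abs_nonneg _) (h i) hp.le) (by positivity)

theorem vecNorm_zero {p : ℝ} (hp : 0 < p) : vecNorm p (0 : Fin d → ℝ) = 0 := by
  simp [vecNorm, Real.zero_rpow hp.ne', Real.zero_rpow (inv_ne_zero hp.ne')]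

theorem vecNorm_sum_le {p : ℝ} (hp : 1 ≤ p) {ι : Type*} (s : Finset ι) (v : ι → Fin d → ℝ) :
    vecNorm p (fun i => ∑ j ∈ s, v j i) ≤ ∑ j ∈ s, vecNorm p (v j) := by
  classical
  induction s using Finset.induction_on with
  | empty =>
    have := vecNorm_zero (d := d) (by linarith : 0 < p)
    exact this.le
  | insert a s ha ih =>
    simp_rw [Finset.sum_insert ha]
    exact (vecNorm_add_le hp (v a) fun i => ∑ j ∈ s, v j i).trans (by linarith)

theorem vecNorm_neg (p : ℝ) (v : Fin d → ℝ) : vecNorm p (-v) = vecNorm p v := by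
  simp [vecNorm]

theorem vecNorm_le_of_abs_le {p : ℝ} (hp : 1 ≤ p) {v : Fin d → ℝ} {b : ℝ} (hb : 0 ≤ b)
    (h : ∀ i, |v i| ≤ b) : vecNorm p v ≤ d * b := by
  rcases Nat.eq_zero_or_pos d with rfl | hd
  · have : v = 0 := Subsingleton.elim _ _
    rw [this, vecNorm_zero (by linarith)]
    simp
  have hd1 : (1 : ℝ) ≤ d := by exact_mod_cast hd
  have h1 : vecNorm p v ^ p ≤ (d * b) ^ p := by
    rw [vecNorm_rpow (by linarith), Real.mul_rpow (by positivity) hb]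
    calc ∑ i, |v i| ^ p ≤ ∑ _i : Fin d, b ^ p :=
          Finset.sum_le_sum fun i _ => Real.rpow_le_rpow (abs_nonneg _) (h i) (by linarith)
      _ = d * b ^ p := by simp
      _ ≤ (d : ℝ) ^ p * b ^ p := by
          gcongr
          calc (d : ℝ) = (d : ℝ) ^ (1 : ℝ) := (Real.rpow_one _).symm
            _ ≤ _ := Real.rpow_le_rpow_of_exponent_le hd1 hp
  exact (Real.rpow_le_rpow_iff (vecNorm_nonneg _ _) (by positivity) (by linarith)).mp h1

end

/-! ### Accuracy of the noisy search -/

/-- An end of the current interval is either an original end or an earlier midpoint, and the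
comparison that made it an end bounds the true count there up to the noise. -/
theorem search_spec {n : ℕ} (z : Fin n → ℝ) (target s : ℝ) {τ : ℝ} {T : ℕ} (w : Fin T → ℝ)
    (hw : ∀ t, |s * w t| ≤ τ) (I : ℝ × ℝ) (hI : I.1 ≤ I.2) :
    (search z target s T w I).2 - (search z target s T w I).1 = (I.2 - I.1) / 2 ^ T ∧
    I.1 ≤ (search z target s T w I).1 ∧ (search z target s T w I).2 ≤ I.2 ∧
    ((search z target s T w I).1 = I.1 ∨
      (countLE z (search z target s T w I).1 : ℝ) ≤ target + τ) ∧
    ((search z target s T w I).2 = I.2 ∨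
      target - τ < (countLE z (search z target s T w I).2 : ℝ)) := by
  induction T generalizing I with
  | zero => simp [search]
  | succ T ih =>
    rw [search_succ]
    have h0 := abs_le.mp (hw 0)
    have ih' := ih (Fin.tail w) (fun t => hw t.succ)
    by_cases hc : (countLE z ((I.1 + I.2) / 2) : ℝ) + s * w 0 ≤ target
    · have e : nextInterval z target (s * w 0) I = ((I.1 + I.2) / 2, I.2) := if_pos hc
      rw [e]
      obtain ⟨h1, h2, h3, h4, h5⟩ := ih' ((I.1 + I.2) / 2, I.2) (by simp only; linarith)
      simp only at h1 h2 h3 h4 h5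
      refine ⟨?_, by linarith, h3, Or.inr ?_, h5⟩
      · rw [h1, pow_succ]; field_simp; ring
      · rcases h4 with h4 | h4
        · rw [h4]; linarith
        · exact h4
    · have e : nextInterval z target (s * w 0) I = (I.1, (I.1 + I.2) / 2) := if_neg hc
      rw [e]
      obtain ⟨h1, h2, h3, h4, h5⟩ := ih' (I.1, (I.1 + I.2) / 2) (by simp only; linarith)
      simp only at h1 h2 h3 h4 h5
      refine ⟨?_, h2, by linarith, h4, Or.inr ?_⟩
      · rw [h1, pow_succ]; field_simp; ring
      · rcases h5 with h5 | h5
        · rw [h5]; linarith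
        · exact h5

theorem le_two_pow_steps {B : ℝ} (hB : 0 < B) : B ≤ 2 ^ steps B := by
  have h : Real.logb 2 B ≤ steps B := Nat.le_ceil _
  rw [Real.logb_le_iff_le_rpow one_lt_two hB, Real.rpow_natCast] at h
  exact h

/-- The interval found by a private quantile search, if no noise exceeds `τ`. -/
theorem privQuantile_spec {n : ℕ} {ρ B : ℝ} (hB : 0 < B) (q : ℝ) (z : Fin n → ℝ) {τ : ℝ}
    (w : Fin (steps B) → ℝ) (hw : ∀ t, |√(steps B / (2 * ρ)) * w t| ≤ τ) :
    (privQuantile ρ B q z w).2 - (privQuantile ρ B q z w).1 ≤ 2 ∧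
    (privQuantile ρ B q z w).1 ≤ (privQuantile ρ B q z w).2 ∧
    -B ≤ (privQuantile ρ B q z w).1 ∧ (privQuantile ρ B q z w).2 ≤ B ∧
    ((privQuantile ρ B q z w).1 = -B ∨
      (countLE z (privQuantile ρ B q z w).1 : ℝ) ≤ q * n + τ) ∧
    ((privQuantile ρ B q z w).2 = B ∨
      q * n - τ < (countLE z (privQuantile ρ B q z w).2 : ℝ)) := by
  obtain ⟨h1, h2, h3, h4, h5⟩ := search_spec z (q * n) (√(steps B / (2 * ρ))) w hw (-B, B)
    (by simp only; linarith)
  simp only at h1 h2 h3 h4 h5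
  refine ⟨?_, ?_, h2, h3, h4, h5⟩
  · have := le_two_pow_steps hB
    unfold privQuantile
    rw [h1, div_le_iff₀ (by positivity)]
    linarith
  · unfold privQuantile
    have : 0 ≤ (B - -B) / 2 ^ steps B := by
      apply div_nonneg <;> [linarith; positivity]
    linarith

theorem countLE_eq_card {n : ℕ} {z : Fin n → ℝ} {b : ℝ} (h : ∀ j, z j ≤ b) :
    (countLE z b : ℝ) = n := by
  rw [countLE_eq_sum]
  simp [h]

/-- A point of the median interval lies near any centre around which most data concentrate. -/
theorem abs_midpoint_sub_le {n : ℕ} {ρ B : ℝ} (hB : 0 < B) (z : Fin n → ℝ) {τ : ℝ}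
    (w : Fin (steps B) → ℝ) (hw : ∀ t, |√(steps B / (2 * ρ)) * w t| ≤ τ) {μ s : ℝ}
    (hs : 0 ≤ s) (hμ : |μ| ≤ B) (hn : 0 < n) (hτ : τ ≤ n / 8)
    (hz : ∑ j, (if s < |z j - μ| then (1 : ℝ) else 0) ≤ n / 4) :
    |((privQuantile ρ B (1 / 2) z w).1 + (privQuantile ρ B (1 / 2) z w).2) / 2 - μ| ≤ s + 1 := by
  obtain ⟨h1, h2, h3, h4, h5, h6⟩ := privQuantile_spec hB (1 / 2) z w hw
  set l := (privQuantile ρ B (1 / 2) z w).1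
  set u := (privQuantile ρ B (1 / 2) z w).2
  have hn0 : (0 : ℝ) < n := by exact_mod_cast hn
  obtain ⟨hμ1, hμ2⟩ := abs_le.mp hμ
  have hl : l ≤ μ + s := by
    by_contra hc
    push Not at hc
    rcases h5 with h5 | h5
    · linarith
    -- Every sample is at most `l` or deviates by more than `s`, which would give `n ≤ n/2 + n/8 +
    -- n/4`. On the other side, more than `n/2 - n/8` samples would have to deviate.
    · have : (n : ℝ) ≤ countLE z l + ∑ j, (if s < |z j - μ| then (1 : ℝ) else 0) := by
        rw [countLE_eq_sum, ← Finset.sum_add_distrib]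
        calc (n : ℝ) = ∑ _j : Fin n, (1 : ℝ) := by simp
          _ ≤ _ := Finset.sum_le_sum fun j _ => by
            by_cases hj : z j ≤ l
            · rw [if_pos hj]; split_ifs; all_goals norm_num
            · have : s < |z j - μ| := lt_of_lt_of_le (by linarith) (le_abs_self _)
              rw [if_pos this, if_neg hj, zero_add]
      linarith
  have hu : μ - s ≤ u := by
    by_contra hc
    push Not at hc
    rcases h6 with h6 | h6
    · linarith
    · have : (countLE z u : ℝ) ≤ ∑ j, (if s < |z j - μ| then (1 : ℝ) else 0) := by
        rw [countLE_eq_sum]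
        refine Finset.sum_le_sum fun j _ => ?_
        by_cases hj : z j ≤ u
        · have : s < |z j - μ| := lt_of_lt_of_le (by linarith) (neg_le_abs _)
          rw [if_pos this, if_pos hj]
        · rw [if_neg hj]; positivity
      linarith
  rw [abs_le]
  constructor <;> linarith

/-- The upper end of the interval found for the upper quantile of lengths `ℓ`. -/
theorem privQuantile_upper_spec {n : ℕ} {ρ B k Y : ℝ} (hB : 0 < B) (ℓ : Fin n → ℝ) {τ : ℝ}
    (w : Fin (steps B) → ℝ) (hw : ∀ t, |√(steps B / (2 * ρ)) * w t| ≤ τ) (hτ : 0 ≤ τ)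
    (hn : 0 < n) (hk : τ < k) (hkn : k + τ < n) (h0 : ∀ j, 0 ≤ ℓ j) (hY : ∀ j, ℓ j ≤ Y)
    (hℓ : ∀ j, ℓ j ≤ B) :
    0 ≤ (privQuantile ρ B ((n - k) / n) ℓ w).2 ∧
    (privQuantile ρ B ((n - k) / n) ℓ w).2 ≤ Y + 2 ∧
    ∑ j, (if (privQuantile ρ B ((n - k) / n) ℓ w).2 < ℓ j then (1 : ℝ) else 0) ≤ k + τ := by
  have hn0 : (0 : ℝ) < n := by exact_mod_cast hn
  obtain ⟨h1, h2, h3, h4, h5, h6⟩ := privQuantile_spec hB ((n - k) / n) ℓ w hw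
  rw [div_mul_cancel₀ _ hn0.ne'] at h5 h6
  set l := (privQuantile ρ B ((n - k) / n) ℓ w).1
  set u := (privQuantile ρ B ((n - k) / n) ℓ w).2
  have hY0 : 0 ≤ Y := (h0 ⟨0, hn⟩).trans (hY ⟨0, hn⟩)
  refine ⟨?_, ?_, ?_⟩
  · rcases h6 with h6 | h6
    · linarith
    · by_contra hc
      push Not at hc
      have : (countLE ℓ u : ℝ) = 0 := by
        rw [countLE_eq_sum]
        refine Finset.sum_eq_zero fun j _ => if_neg ?_
        linarith [h0 j]
      linarith
  -- A lower end above `Y` would count all `n` samples, but the search allows only `n - k + τ`; here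
  -- the noise must stay below `k`.
  · rcases h5 with h5 | h5
    · linarith
    · by_contra hc
      push Not at hc
      have : (countLE ℓ l : ℝ) = n := countLE_eq_card fun j => by linarith [hY j]
      linarith
  · have e : ∑ j, (if u < ℓ j then (1 : ℝ) else 0) = n - countLE ℓ u := by
      rw [eq_sub_iff_add_eq, countLE_eq_sum, ← Finset.sum_add_distrib]
      calc _ = ∑ _j : Fin n, (1 : ℝ) := Finset.sum_congr rfl fun j _ => by
            by_cases hj : ℓ j ≤ u
            · rw [if_neg (not_lt.mpr hj), if_pos hj, zero_add]
            · rw [if_pos (not_le.mp hj), if_neg hj, add_zero]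
        _ = n := by simp
    rw [e]
    rcases h6 with h6 | h6
    · rw [h6, countLE_eq_card hℓ]; linarith
    · linarith

/-! ### Concentration of the empirical mean -/

theorem measure_pi_exists_le {Ω : Type*} [MeasurableSpace Ω] {n : ℕ} (D : Fin n → Measure Ω)
    [∀ j, IsProbabilityMeasure (D j)] (s : Set Ω) {b : ℝ≥0∞} (h : ∀ j, D j s ≤ b) :
    (Measure.pi D) {x | ∃ j, x j ∈ s} ≤ n * b := by
  have e : {x : Fin n → Ω | ∃ j, x j ∈ s} = ⋃ j, Function.eval j ⁻¹' s := by
    ext x; simp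
  rw [e]
  refine (measure_iUnion_le _).trans ?_
  rw [tsum_fintype]
  calc _ ≤ ∑ _j : Fin n, b := Finset.sum_le_sum fun j _ => by
        refine le_trans ?_ (h j)
        -- The set `s` need not be measurable, so it is replaced by a measurable hull.
        rw [← measure_toMeasurable (μ := D j) s, ← (measurePreserving_eval D j).measure_preimage
          (measurableSet_toMeasurable _ _).nullMeasurableSet]
        exact measure_mono (Set.preimage_mono (subset_toMeasurable _ _))
    _ = n * b := by simp

theorem abs_mean_le {d : ℕ} {D : Measure (Fin d → ℝ)} [IsProbabilityMeasure D] {M : ℝ}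
    (hD : ∀ᵐ x ∂D, ∀ i, |x i| ≤ M) (i : Fin d) : |mean D i| ≤ M := by
  have := norm_integral_le_of_norm_le_const (μ := D) (f := fun x => x i) (C := M)
    (hD.mono fun x hx => hx i)
  simpa [mean] using this

/-- The sum of the recentred samples. -/
def centredSum {d n : ℕ} (D : Measure (Fin d → ℝ)) (x : Fin n → Fin d → ℝ) (i : Fin d) : ℝ :=
  ∑ j, (x j i - mean D i)

theorem integral_abs_centredSum_pow_le {d n p : ℕ} {D : Measure (Fin d → ℝ)}
    [IsProbabilityMeasure D] {σ : Fin d → ℝ} (hσ : ∀ i, 0 < σ i)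
    (hmem : ∀ i, MemLp (fun x => x i) ((max p 2 : ℕ) : ℝ≥0∞) D)
    (hmom : ∀ i, ∫ x, |x i - mean D i| ^ max p 2 ∂D = σ i ^ max p 2) (i : Fin d) :
    Integrable (fun x : Fin n → Fin d → ℝ => |centredSum D x i| ^ p) (Measure.pi fun _ => D) ∧
    ∫ x : Fin n → Fin d → ℝ, |centredSum D x i| ^ p ∂(Measure.pi fun _ => D) ≤
      2 * (√(5 * 4 ^ max p 2 * (n + 1)) * σ i) ^ p := by
  obtain ⟨m, hm⟩ : ∃ m, max p 2 = m + 2 := ⟨max p 2 - 2, by omega⟩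
  have hmem' : MemLp (fun x => x i - mean D i) ((m + 2 : ℕ) : ℝ≥0∞) D := by
    rw [← hm]
    exact (hmem i).sub (memLp_const _)
  have hint : Integrable (fun x : Fin d → ℝ => x i) D := (hmem i).integrable (by norm_cast; omega)
  have h0 : ∫ x, (x i - mean D i) ∂D = 0 := by
    rw [integral_sub hint (integrable_const _)]
    simp [mean]
  have hmom' := hmom i
  rw [hm] at hmom'
  have key := integral_abs_sum_pow_le hmem' h0 (hσ i) hmom'.le n
  have hpos := hσ i
  rw [hm]
  exact integral_abs_pow_le (r := m + 2) (by omega) (memLp_sum_pi hmem' n) (by positivity) key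

/-- Samples with `p`-norm deviation above `b` are replaced by the mean; then one sample changes the
norm of the sum by at most `2b`, and bounded differences apply. The truncation shifts the
expectation by at most `n q` times the crude diameter `d · 2M`, and it is inactive unless some
sample is bad, which costs `n q`. -/
theorem measure_vecNorm_centredSum_gt_le {d n p : ℕ} (hd : 1 ≤ d) (hp : 1 ≤ p)
    {D : Measure (Fin d → ℝ)}
    [IsProbabilityMeasure D] {M b q : ℝ} (hM : 0 ≤ M) (hb : 0 ≤ b) (hq0 : 0 ≤ q)
    (hD : ∀ᵐ x ∂D, ∀ i, |x i| ≤ M) {σ : Fin d → ℝ} (hσ : ∀ i, 0 < σ i)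
    (hmem : ∀ i, MemLp (fun x => x i) ((max p 2 : ℕ) : ℝ≥0∞) D)
    (hmom : ∀ i, ∫ x, |x i - mean D i| ^ max p 2 ∂D = σ i ^ max p 2)
    (hq : D {x | b < vecNorm p (x - mean D)} ≤ ENNReal.ofReal q) {ε : ℝ} (hε : 0 ≤ ε) :
    (Measure.pi fun _ : Fin n => D) {x | 3 * (√(5 * 4 ^ max p 2 * (n + 1)) * vecNorm p σ) +
        n * (d * (2 * M) * q) + ε < vecNorm p (centredSum D x)} ≤
      n * ENNReal.ofReal q + ENNReal.ofReal (Real.exp (-ε ^ 2 / (2 * (n * (2 * b) ^ 2)))) := by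
  classical
  have hp1 : (1 : ℝ) ≤ p := by exact_mod_cast hp
  have hp0 : p ≠ 0 := by omega
  set P := Measure.pi fun _ : Fin n => D
  set bad : Set (Fin d → ℝ) := {x | b < vecNorm p (x - mean D)} with hbad
  have hbadm : MeasurableSet bad :=
    measurableSet_lt measurable_const (measurable_vecNorm _ (measurable_id.sub_const _))
  set zt : (Fin d → ℝ) → Fin d → ℝ := badᶜ.indicator fun x => x - mean D with hzt
  have hztm : Measurable zt := (measurable_id.sub_const _).indicator hbadm.compl
  have hztb : ∀ x, vecNorm p (zt x) ≤ b := by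
    intro x
    by_cases hx : x ∈ bad
    · have : zt x = 0 := by simp [hzt, hx]
      rw [this, vecNorm_zero (by linarith)]
      exact hb
    · have : zt x = x - mean D := by simp [hzt, hx]
      rw [this]
      exact not_lt.mp hx
  set f : (Fin n → Fin d → ℝ) → ℝ := fun x => vecNorm p (fun i => ∑ j, zt (x j) i) with hf
  have hfm : Measurable f := measurable_vecNorm _ (measurable_pi_lambda _ fun i =>
    Finset.measurable_sum _ fun j _ =>
      (measurable_pi_apply i).comp (hztm.comp (measurable_pi_apply j)))
  have hfB : ∀ x, |f x| ≤ n * b := by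
    intro x
    rw [abs_of_nonneg (vecNorm_nonneg _ _)]
    refine (vecNorm_sum_le hp1 _ _).trans ?_
    calc _ ≤ ∑ _j : Fin n, b := Finset.sum_le_sum fun j _ => hztb _
      _ = n * b := by simp
  have hfc' : ∀ x y : Fin n → Fin d → ℝ, ∀ j, (∀ i, i ≠ j → x i = y i) → f x - f y ≤ 2 * b := by
    intro x y j h
    have e : (fun i => ∑ l, zt (x l) i) =
        (fun i => ∑ l, zt (y l) i) + (zt (x j) + -zt (y j)) := by
      funext i
      rw [Pi.add_apply, ← sub_eq_iff_eq_add', ← Finset.sum_sub_distrib,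
        Finset.sum_eq_single j (fun l _ hl => by rw [h l hl, sub_self]) (by simp)]
      simp [sub_eq_add_neg]
    have h1 : f x ≤ f y + vecNorm p (zt (x j) + -zt (y j)) := by
      simp only [hf]
      rw [e]
      exact vecNorm_add_le hp1 _ _
    have h2 := vecNorm_add_le hp1 (zt (x j)) (-zt (y j))
    rw [vecNorm_neg] at h2
    have h3 := hztb (x j)
    have h4 := hztb (y j)
    linarith
  have hfc : ∀ x y : Fin n → Fin d → ℝ, ∀ j, (∀ i, i ≠ j → x i = y i) →
      |f x - f y| ≤ 2 * b := fun x y j h => abs_sub_le_iff.mpr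
    ⟨hfc' x y j h, hfc' y x j fun i hi => (h i hi).symm⟩
  set s : ℝ := √(5 * 4 ^ max p 2 * (n + 1)) with hs
  have hs0 : 0 < s := Real.sqrt_pos.mpr (by positivity)
  set V : ℝ := s * vecNorm p σ with hV
  have hVp : V ^ p = ∑ i, (s * σ i) ^ p := by
    rw [hV, mul_pow, vecNorm_pow hp0, Finset.mul_sum]
    refine Finset.sum_congr rfl fun i _ => ?_
    rw [abs_of_pos (hσ i), mul_pow]
  have hV0 : 0 < V := by
    have h1 : 0 < V ^ p := by
      rw [hVp]
      exact Finset.sum_pos (fun i _ => by have := hσ i; positivity) ⟨⟨0, hd⟩, Finset.mem_univ _⟩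
    have h2 : 0 ≤ V := mul_nonneg hs0.le (vecNorm_nonneg _ _)
    refine h2.lt_of_ne fun h => ?_
    rw [← h, zero_pow hp0] at h1
    exact lt_irrefl _ h1
  have hmomS := fun i => integral_abs_centredSum_pow_le (n := n) hσ hmem hmom i
  have hmean : ∫ x, f x ∂P ≤ 3 * V + n * (d * (2 * M) * q) := by
    -- The bound `y ≤ V (1 + y^p / V^p)` reduces the expected norm to coordinate-wise moments. These
    -- sum to at most `2 V^p`, whence `3V`.
    set G : (Fin n → Fin d → ℝ) → ℝ := fun x => V * (1 + (∑ i, |centredSum D x i| ^ p) / V ^ p) +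
      ∑ j, bad.indicator (fun _ => d * (2 * M)) (x j) with hG
    have hbi : ∀ j, Integrable (fun x : Fin n → Fin d → ℝ =>
        bad.indicator (fun _ => (d : ℝ) * (2 * M)) (x j)) P := fun j =>
      (measurePreserving_eval (fun _ : Fin n => D) j).integrable_comp_of_integrable
        ((integrable_const _).indicator hbadm)
    have i1 : Integrable (fun x => ∑ i, |centredSum D x i| ^ p) P :=
      integrable_finsetSum _ fun i _ => (hmomS i).1
    have i2 : Integrable (fun x => V * (1 + (∑ i, |centredSum D x i| ^ p) / V ^ p)) P :=
      ((integrable_const 1).add (i1.div_const _)).const_mul V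
    have i3 : Integrable (fun x : Fin n → Fin d → ℝ =>
        ∑ j, bad.indicator (fun _ => (d : ℝ) * (2 * M)) (x j)) P :=
      integrable_finsetSum _ fun j _ => hbi j
    have hbv : ∀ j, ∫ x : Fin n → Fin d → ℝ,
        bad.indicator (fun _ => (d : ℝ) * (2 * M)) (x j) ∂P ≤ d * (2 * M) * q := by
      intro j
      have h1 := (measurePreserving_eval (fun _ : Fin n => D) j)
      have h2 : ∫ x, bad.indicator (fun _ => (d : ℝ) * (2 * M)) x ∂D =
          ∫ x : Fin n → Fin d → ℝ, bad.indicator (fun _ => (d : ℝ) * (2 * M)) (x j) ∂P := by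
        rw [← h1.map_eq]
        exact integral_map h1.measurable.aemeasurable
          ((measurable_const.indicator hbadm).aestronglyMeasurable)
      rw [← h2, integral_indicator_const _ hbadm, smul_eq_mul, mul_comm]
      gcongr
      rw [measureReal_def]
      exact ENNReal.toReal_le_of_le_ofReal hq0 hq
    have hae : ∀ᵐ x ∂P, ∀ j, ∀ i, |x j i| ≤ M := ae_all_iff.mpr fun j =>
      (measurePreserving_eval (fun _ : Fin n => D) j).quasiMeasurePreserving.ae hD
    have hfG : ∀ᵐ x ∂P, f x ≤ G x := by
      filter_upwards [hae] with x hx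
      have e : (fun i => ∑ j, zt (x j) i) = centredSum D x +
          fun i => ∑ j, (zt (x j) - (x j - mean D)) i := by
        funext i
        simp only [Pi.add_apply, centredSum, ← Finset.sum_add_distrib, Pi.sub_apply]
        refine Finset.sum_congr rfl fun j _ => by ring
      have h1 : f x ≤ vecNorm p (centredSum D x) +
          ∑ j, vecNorm p (zt (x j) - (x j - mean D)) := by
        simp only [hf]
        rw [e]
        exact (vecNorm_add_le hp1 _ _).trans (by gcongr; exact vecNorm_sum_le hp1 _ _)
      refine h1.trans (add_le_add ?_ (Finset.sum_le_sum fun j _ => ?_))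
      · have h2 := pow_le_one_add_pow (div_nonneg (vecNorm_nonneg p (centredSum D x)) hV0.le)
          (k := 1) (l := p) hp
        rw [pow_one, div_pow, vecNorm_pow hp0, div_le_iff₀ hV0] at h2
        linarith
      · by_cases hj : x j ∈ bad
        · rw [Set.indicator_of_mem hj]
          have : zt (x j) = 0 := by simp [hzt, hj]
          rw [this, zero_sub, vecNorm_neg]
          refine vecNorm_le_of_abs_le hp1 (by positivity) fun i => ?_
          have h3 := abs_sub (x j i) (mean D i)
          have h4 := abs_mean_le hD i
          have h5 := hx j i
          rw [Pi.sub_apply]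
          linarith
        · rw [Set.indicator_of_notMem hj]
          have : zt (x j) = x j - mean D := by simp [hzt, hj]
          rw [this, sub_self, vecNorm_zero (by linarith)]
    calc ∫ x, f x ∂P ≤ ∫ x, G x ∂P :=
          integral_mono_ae (integrable_of_abs_le hfm hfB) (i2.add i3) hfG
      _ = V * (1 + (∑ i, ∫ x, |centredSum D x i| ^ p ∂P) / V ^ p) +
          ∑ j, ∫ x : Fin n → Fin d → ℝ, bad.indicator (fun _ => (d : ℝ) * (2 * M)) (x j) ∂P := by
          simp only [hG]
          rw [integral_add i2 i3, integral_const_mul,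
            integral_add (integrable_const _) (i1.div_const _), integral_div,
            integral_finsetSum _ (fun i _ => (hmomS i).1), integral_finsetSum _ fun j _ => hbi j,
            integral_const, probReal_univ, one_smul]
      _ ≤ V * (1 + (∑ i, 2 * (s * σ i) ^ p) / V ^ p) + ∑ _j : Fin n, d * (2 * M) * q := by
          gcongr with i _ j _
          · exact (hmomS i).2
          · exact hbv j
      _ = _ := by
          rw [← Finset.mul_sum, ← hVp, mul_div_assoc, div_self (by positivity)]
          simp
          ring
  have hmain := measure_lt_of_bounded_differences D (by positivity : 0 ≤ 2 * b) hfm hfB hfc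
    hmean hε
  have hex := measure_pi_exists_le (fun _ : Fin n => D) bad (fun _ => hq)
  refine (measure_mono ?_).trans ((measure_union_le _ _).trans (add_le_add hex hmain))
  intro x hx
  by_cases hj : ∃ j, x j ∈ bad
  · exact Or.inl hj
  · right
    push Not at hj
    have e : (fun i => ∑ j, zt (x j) i) = centredSum D x := by
      funext i
      refine Finset.sum_congr rfl fun j _ => ?_
      simp [hzt, hj j]
    simp only [Set.mem_ofPred_eq, hf] at hx ⊢
    rw [e]
    exact hx

/-! ### Error of the release for a given centre and threshold -/

/-- The scaling factors of the release. -/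
def scale {d : ℕ} (p : ℕ) (σhat : Fin d → ℝ) (i : Fin d) : ℝ :=
  (σhat i ^ 2) ^ (1 / ((p : ℝ) + 2))

/-- The sum of the squares of `σ_i ^ (p / (p + 2))`. -/
def scaledVar {d : ℕ} (p : ℕ) (σ : Fin d → ℝ) : ℝ := ∑ i, σ i ^ (2 * (p : ℝ) / (p + 2))

section

variable {d n p : ℕ} {σ σhat : Fin d → ℝ}

theorem scale_pos (h : ∀ i, 0 < σhat i) (i : Fin d) : 0 < scale p σhat i := by
  have := h i
  unfold scale; positivity

theorem scaled_eq (h : ∀ i, 0 < σhat i) (x : Fin n → Fin d → ℝ) (c : Fin d → ℝ) (j : Fin n)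
    (i : Fin d) : scaled p σhat x c j i = (x j i - c i) / scale p σhat i := by
  have := h i
  rw [scaled, scale, Real.rpow_neg (by positivity), ← div_eq_mul_inv]

theorem scale_pow (h : ∀ i, 0 < σhat i) (i : Fin d) :
    scale p σhat i ^ p = σhat i ^ (2 * (p : ℝ) / (p + 2)) := by
  have := h i
  rw [scale, ← Real.rpow_natCast, ← Real.rpow_natCast, ← Real.rpow_mul this.le,
    ← Real.rpow_mul this.le]
  congr 1
  push_cast
  ring

theorem scale_sq (h : ∀ i, 0 < σhat i) (i : Fin d) :
    scale p σhat i ^ 2 = σhat i ^ (4 / ((p : ℝ) + 2)) := by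
  have := h i
  rw [scale, ← Real.rpow_natCast, ← Real.rpow_natCast, ← Real.rpow_mul this.le,
    ← Real.rpow_mul this.le]
  congr 1
  push_cast
  ring

theorem one_le_scale (h : ∀ i, 1 ≤ σhat i) (i : Fin d) : 1 ≤ scale p σhat i :=
  Real.one_le_rpow (one_le_pow₀ (h i)) (by positivity)

/-- Since `2 = 2p/(p+2) + 4/(p+2)`, only `σ_i ≤ σ̂_i` is needed. It keeps the error of the rough
centre comparable with `scaledVar` after rescaling. -/
theorem sq_div_scale_sq_le (hσ : ∀ i, 0 < σ i) (h : ∀ i, σ i ≤ σhat i) (i : Fin d) :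
    σ i ^ 2 / scale p σhat i ^ 2 ≤ σ i ^ (2 * (p : ℝ) / (p + 2)) := by
  have h0 := hσ i
  have h1 : ∀ i, 0 < σhat i := fun i => (hσ i).trans_le (h i)
  have h2 := h1 i
  rw [scale_sq h1, div_le_iff₀ (by positivity)]
  calc σ i ^ 2 = σ i ^ (2 * (p : ℝ) / (p + 2)) * σ i ^ (4 / ((p : ℝ) + 2)) := by
        rw [← Real.rpow_add h0, ← Real.rpow_natCast]
        congr 1
        push_cast
        field_simp
        ring
    _ ≤ _ := by
        gcongr
        exact h i

theorem vecNorm_two_rpow_sq (hσ : ∀ i, 0 < σ i) :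
    vecNorm 2 (fun i => σ i ^ ((p : ℝ) / (p + 2))) ^ 2 = scaledVar p σ := by
  rw [vecNorm_two_sq, scaledVar]
  refine Finset.sum_congr rfl fun i _ => ?_
  rw [← Real.rpow_natCast, ← Real.rpow_mul (hσ i).le]
  congr 1
  push_cast
  ring

/-- The origin of the exponent `2p/(p+2)`: the clipping threshold contributes `√S`, the `p`-norm of
the rescaled noise contributes `S^(1/p)`, and `1/2 + 1/p = (p+2)/(2p)`. -/
theorem scaledVar_rpow (hp : 1 ≤ p) (hσ : ∀ i, 0 < σ i) :
    √(scaledVar p σ) * scaledVar p σ ^ (1 / (p : ℝ)) = vecNorm (2 * (p : ℝ) / (p + 2)) σ := by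
  have hp0 : (0 : ℝ) < p := by exact_mod_cast hp
  have h0 : 0 ≤ scaledVar p σ := Finset.sum_nonneg fun i _ => by have := hσ i; positivity
  have e : vecNorm (2 * (p : ℝ) / (p + 2)) σ =
      scaledVar p σ ^ (1 / (2 * (p : ℝ) / (p + 2))) := by
    rw [vecNorm, scaledVar]
    congr 1
    exact Finset.sum_congr rfl fun i _ => by rw [abs_of_pos (hσ i)]
  rw [e, Real.sqrt_eq_rpow, ← Real.rpow_add' h0 (by positivity)]
  congr 1
  field_simp

theorem one_le_scaledVar (hd : 1 ≤ d) (hσ : ∀ i, 1 ≤ σ i) : 1 ≤ scaledVar p σ := by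
  have h : ∀ i, 1 ≤ σ i ^ (2 * (p : ℝ) / (p + 2)) := fun i =>
    Real.one_le_rpow (hσ i) (by positivity)
  refine (h ⟨0, hd⟩).trans (Finset.single_le_sum
    (f := fun i => σ i ^ (2 * (p : ℝ) / (p + 2))) (fun i _ => ?_) (Finset.mem_univ _))
  linarith [h i]

/-- Good estimates at most double the scaled variance. -/
theorem sum_scale_pow_le (hp : 1 ≤ p) (hd : 1 ≤ d) (hσ : ∀ i, 1 ≤ σ i)
    (h : IsGoodEstimate p σ σhat) : ∑ i, scale p σhat i ^ p ≤ 2 * scaledVar p σ := by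
  have hp0 : (0 : ℝ) < p := by exact_mod_cast hp
  have hd0 : (0 : ℝ) < d := by exact_mod_cast hd
  have hσ0 : ∀ i, 0 < σ i := fun i => by linarith [hσ i]
  have h1 : ∀ i, 0 < σhat i := fun i => (hσ0 i).trans_le (h i).1
  have e : vecNorm 1 (fun l => σ l ^ (2 * (p : ℝ) / (p + 2))) = scaledVar p σ := by
    simp only [vecNorm, scaledVar, Real.rpow_one, div_one]
    exact Finset.sum_congr rfl fun i _ => abs_of_nonneg (by have := hσ0 i; positivity)
  have hS := one_le_scaledVar (p := p) hd hσ
  calc ∑ i, scale p σhat i ^ p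
      ≤ ∑ i, (σ i ^ (2 * (p : ℝ) / (p + 2)) + scaledVar p σ / d) := by
        refine Finset.sum_le_sum fun i _ => ?_
        rw [scale_pow h1]
        have h2 := (h i).2.le
        rw [e] at h2
        have := hσ0 i
        calc σhat i ^ (2 * (p : ℝ) / (p + 2))
            ≤ ((σ i ^ (2 * (p : ℝ) / (p + 2)) + scaledVar p σ / d) ^
                (((p : ℝ) + 2) / (2 * p))) ^ (2 * (p : ℝ) / (p + 2)) :=
              Real.rpow_le_rpow (h1 i).le h2 (by positivity)
          _ = _ := by
              rw [← Real.rpow_mul (by positivity)]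
              have : ((p : ℝ) + 2) / (2 * p) * (2 * (p : ℝ) / (p + 2)) = 1 := by field_simp
              rw [this, Real.rpow_one]
    _ = 2 * scaledVar p σ := by
        rw [Finset.sum_add_distrib]
        simp only [Finset.sum_const, Finset.card_univ, Fintype.card_fin, nsmul_eq_mul]
        rw [mul_div_cancel₀ _ hd0.ne', scaledVar]
        ring

theorem vecNorm_scale_le (hp : 1 ≤ p) (hd : 1 ≤ d) (hσ : ∀ i, 1 ≤ σ i)
    (h : IsGoodEstimate p σ σhat) :
    vecNorm p (scale p σhat) ≤ 2 * scaledVar p σ ^ (1 / (p : ℝ)) := by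
  have hp0 : p ≠ 0 := by omega
  have h1 : ∀ i, 0 < σhat i := fun i => by linarith [hσ i, (h i).1]
  have hS := one_le_scaledVar (p := p) hd hσ
  rw [vecNorm_le_iff hp0 _ (by positivity), mul_pow, ← Real.rpow_natCast (scaledVar p σ ^ _),
    ← Real.rpow_mul (by linarith), one_div_mul_cancel (by exact_mod_cast hp0), Real.rpow_one]
  calc ∑ i, |scale p σhat i| ^ p = ∑ i, scale p σhat i ^ p :=
        Finset.sum_congr rfl fun i _ => by rw [abs_of_pos (scale_pos h1 i)]
    _ ≤ 2 * scaledVar p σ := sum_scale_pow_le hp hd hσ h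
    _ ≤ _ := by
        gcongr
        calc (2 : ℝ) = 2 ^ 1 := by norm_num
          _ ≤ 2 ^ p := pow_le_pow_right₀ (by norm_num) hp

/-- The lengths of the scaled vectors. -/
theorem vecNorm_scaled_le (hσ : ∀ i, 0 < σ i) (h : ∀ i, σ i ≤ σhat i) {μ c : Fin d → ℝ}
    (hc : ∀ i, |c i - μ i| ≤ 5 * σ i) (x : Fin n → Fin d → ℝ) (j : Fin n) {t : ℝ} (ht : 1 ≤ t)
    (hx : ∑ i, (x j i - μ i) ^ 2 / σhat i ^ (4 / ((p : ℝ) + 2)) ≤ t * scaledVar p σ) :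
    vecNorm 2 (scaled p σhat x c j) ≤ 8 * t * √(scaledVar p σ) := by
  have h1 : ∀ i, 0 < σhat i := fun i => (hσ i).trans_le (h i)
  have h0 : 0 ≤ scaledVar p σ := Finset.sum_nonneg fun i _ => by have := hσ i; positivity
  refine abs_le_of_sq_le_sq' ?_ (by positivity) |>.2
  rw [vecNorm_two_sq, mul_pow, Real.sq_sqrt h0]
  -- Here `50 = 2 · 5²` comes from the error `5σ_i` of the centre, and `2t + 50 ≤ (8t)²` because `t
  -- ≥ 1`.
  calc ∑ i, scaled p σhat x c j i ^ 2
      ≤ ∑ i, (2 * ((x j i - μ i) ^ 2 / σhat i ^ (4 / ((p : ℝ) + 2))) +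
          50 * σ i ^ (2 * (p : ℝ) / (p + 2))) := by
        refine Finset.sum_le_sum fun i _ => ?_
        have hs := sq_div_scale_sq_le (p := p) hσ h i
        have hs0 : 0 < scale p σhat i ^ 2 := by have := scale_pos (p := p) h1 i; positivity
        rw [scaled_eq h1, div_pow, ← scale_sq h1]
        have h2 : (x j i - c i) ^ 2 ≤ 2 * (x j i - μ i) ^ 2 + 50 * σ i ^ 2 := by
          have h3 : (c i - μ i) ^ 2 ≤ (5 * σ i) ^ 2 := sq_le_sq.mpr (by
            rw [abs_of_pos (by linarith [hσ i] : 0 < 5 * σ i)]; exact hc i)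
          nlinarith [sq_nonneg (x j i - μ i + (c i - μ i))]
        calc (x j i - c i) ^ 2 / scale p σhat i ^ 2
            ≤ (2 * (x j i - μ i) ^ 2 + 50 * σ i ^ 2) / scale p σhat i ^ 2 := by gcongr
          _ = 2 * ((x j i - μ i) ^ 2 / scale p σhat i ^ 2) +
              50 * (σ i ^ 2 / scale p σhat i ^ 2) := by ring
          _ ≤ _ := by gcongr
    _ = 2 * (∑ i, (x j i - μ i) ^ 2 / σhat i ^ (4 / ((p : ℝ) + 2))) + 50 * scaledVar p σ := by
        rw [Finset.sum_add_distrib, ← Finset.mul_sum, ← Finset.mul_sum, scaledVar]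
    _ ≤ 2 * (t * scaledVar p σ) + 50 * scaledVar p σ := by gcongr
    _ = (2 * t + 50) * scaledVar p σ := by ring
    _ ≤ (8 * t) ^ 2 * scaledVar p σ := by gcongr; nlinarith

/-- Guarantees that the lengths lie in the range of the second search, so that a search ending at
its initial upper end clips nothing. -/
theorem vecNorm_scaled_le_lengthBound (hσ : ∀ i, 1 ≤ σhat i) {M : ℝ} (hM : 0 ≤ M)
    {x : Fin n → Fin d → ℝ} {c : Fin d → ℝ} (j : Fin n) (hx : ∀ i, |x j i| ≤ M)
    (hc : ∀ i, |c i| ≤ M) : vecNorm 2 (scaled p σhat x c j) ≤ lengthBound d M := by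
  have h1 : ∀ i, 0 < σhat i := fun i => by linarith [hσ i]
  refine abs_le_of_sq_le_sq' ?_ (by unfold lengthBound; positivity) |>.2
  rw [vecNorm_two_sq, lengthBound, mul_pow, Real.sq_sqrt (Nat.cast_nonneg d)]
  calc ∑ i, scaled p σhat x c j i ^ 2 ≤ ∑ _i : Fin d, (2 * M) ^ 2 := by
        refine Finset.sum_le_sum fun i _ => ?_
        rw [scaled_eq h1, div_pow]
        have h2 : 1 ≤ scale p σhat i ^ 2 := one_le_pow₀ (one_le_scale hσ i)
        refine (div_le_self (sq_nonneg _) h2).trans (sq_le_sq.mpr ?_)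
        rw [abs_of_nonneg (by linarith : 0 ≤ 2 * M)]
        linarith [abs_sub (x j i) (c i), hx i, hc i]
    _ = _ := by simp; ring

theorem eq_zero_of_vecNorm_two_eq_zero {v : Fin d → ℝ} (h : vecNorm 2 v = 0) (i : Fin d) :
    v i = 0 := by
  have h1 := vecNorm_two_sq v
  rw [h, zero_pow two_ne_zero, eq_comm, Finset.sum_eq_zero_iff_of_nonneg fun i _ => sq_nonneg _]
    at h1
  exact pow_eq_zero_iff two_ne_zero |>.mp (h1 i (Finset.mem_univ i))

/-- The error is at most the sum of the sampling error, the clipping error and the noise. -/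
theorem vecNorm_release_sub_le (hp : 1 ≤ p) (hn : 0 < n) (h1 : ∀ i, 0 < σhat i)
    {D : Measure (Fin d → ℝ)} {c : Fin d → ℝ} {x : Fin n → Fin d → ℝ} {C ρ₃ b e : ℝ} (hC : 0 ≤ C)
    (hb : ∀ j, vecNorm p (x j - c) ≤ b)
    (hclip : ∑ j, (if C < vecNorm 2 (scaled p σhat x c j) then (1 : ℝ) else 0) ≤ e)
    (g : Fin d → ℝ) :
    vecNorm p (release p ρ₃ σhat (scaled p σhat x c) c C g - mean D) ≤
      1 / n * vecNorm p (centredSum D x) + 1 / n * (e * b) +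
        1 / n * √(2 * C ^ 2 / ρ₃) * vecNorm p (fun i => g i * scale p σhat i) := by
  have hp1 : (1 : ℝ) ≤ p := by exact_mod_cast hp
  have hp0 : (0 : ℝ) < p := by linarith
  have hn0 : (0 : ℝ) < n := by exact_mod_cast hn
  set y := scaled p σhat x c with hy
  have hb0 : 0 ≤ b := (vecNorm_nonneg _ _).trans (hb ⟨0, hn⟩)
  -- The change that clipping makes to each sample, in the original coordinates.
  let u : Fin n → Fin d → ℝ := fun j i => (1 - min (C / vecNorm 2 (y j)) 1) * (c i - x j i)
  have e1 : release p ρ₃ σhat y c C g - mean D =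
      (fun i => 1 / (n : ℝ) * centredSum D x i) + (fun i => 1 / (n : ℝ) * ∑ j, u j i) +
        fun i => 1 / (n : ℝ) * √(2 * C ^ 2 / ρ₃) * (g i * scale p σhat i) := by
    funext i
    have hs := (scale_pos (p := p) h1 i).ne'
    have h2 : ∀ j, y j i * scale p σhat i = x j i - c i := fun j => by
      rw [hy, scaled_eq h1, div_mul_cancel₀ _ hs]
    have h3 : (∑ j, min (C / vecNorm 2 (y j)) 1 * y j i) * scale p σhat i =
        centredSum D x i + ∑ j, u j i + n * (mean D i - c i) := by
      have h4 : (n : ℝ) * (mean D i - c i) = ∑ _j : Fin n, (mean D i - c i) := by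
        rw [Finset.sum_const, Finset.card_univ, Fintype.card_fin, nsmul_eq_mul]
      rw [Finset.sum_mul, centredSum, h4, ← Finset.sum_add_distrib, ← Finset.sum_add_distrib]
      refine Finset.sum_congr rfl fun j _ => ?_
      rw [mul_assoc, h2]
      simp only [u]
      ring
    have h5 : release p ρ₃ σhat y c C g i = c i + 1 / (n : ℝ) *
        (((∑ j, min (C / vecNorm 2 (y j)) 1 * y j i) * scale p σhat i) +
          √(2 * C ^ 2 / ρ₃) * (g i * scale p σhat i)) := by
      rw [release, scale]
      ring
    simp only [Pi.sub_apply, Pi.add_apply]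
    rw [h5, h3]
    field_simp
    ring
  have hu : ∀ j, vecNorm p (u j) ≤ (if C < vecNorm 2 (y j) then (1 : ℝ) else 0) * b := by
    intro j
    by_cases hj : C < vecNorm 2 (y j)
    · rw [if_pos hj, one_mul]
      refine le_trans ?_ (hb j)
      have hpos : 0 < vecNorm 2 (y j) := hC.trans_lt hj
      have h2 : min (C / vecNorm 2 (y j)) 1 = C / vecNorm 2 (y j) :=
        min_eq_left ((div_le_one hpos).mpr hj.le)
      refine vecNorm_mono hp0 fun i => ?_
      simp only [u, h2, Pi.sub_apply]
      have h3 : C / vecNorm 2 (y j) ≤ 1 := (div_le_one hpos).mpr hj.le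
      have h4 : 0 ≤ C / vecNorm 2 (y j) := by positivity
      rw [abs_mul, abs_sub_comm (c i), abs_of_nonneg (by linarith)]
      exact mul_le_of_le_one_left (abs_nonneg _) (by linarith)
    · rw [if_neg hj, zero_mul]
      have h2 : u j = 0 := by
        funext i
        -- For a zero vector the clipping factor is `C / 0 = 0` instead of `1`, but then the sample
        -- equals the centre and nothing changes.
        rcases (vecNorm_nonneg 2 (y j)).eq_or_lt with h0 | h0
        · have h3 := eq_zero_of_vecNorm_two_eq_zero h0.symm i
          rw [hy, scaled_eq h1, div_eq_zero_iff] at h3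
          have h4 := h3.resolve_right (scale_pos h1 i).ne'
          simp only [u, Pi.zero_apply]
          rw [← neg_sub (x j i), h4, neg_zero, mul_zero]
        · have h3 : min (C / vecNorm 2 (y j)) 1 = 1 :=
            min_eq_right ((one_le_div h0).mpr (not_lt.mp hj))
          simp [u, h3]
      rw [h2, vecNorm_zero hp0]
  rw [e1]
  refine (vecNorm_add_le hp1 _ _).trans (add_le_add ((vecNorm_add_le hp1 _ _).trans
    (add_le_add ?_ ?_)) ?_)
  · rw [vecNorm_smul hp0, abs_of_pos (by positivity)]
  · rw [vecNorm_smul hp0, abs_of_pos (by positivity)]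
    gcongr
    refine (vecNorm_sum_le hp1 _ _).trans ((Finset.sum_le_sum fun j _ => hu j).trans ?_)
    rw [← Finset.sum_mul]
    gcongr
  · rw [vecNorm_smul hp0, abs_of_nonneg (by positivity)]

end

/-- The error of PLAN on data and quantile noise without atypical deviations. -/
theorem vecNorm_plan_sub_le {d n p : ℕ} (hp : 1 ≤ p) (hd : 1 ≤ d) (hn : 0 < n) {M ρ k : ℝ}
    (hM : 0 < M) (hρ : 0 < ρ) {D : Measure (Fin d → ℝ)} (hμ : ∀ i, |mean D i| ≤ M)
    {σ σhat : Fin d → ℝ} (hσ : ∀ i, 1 ≤ σ i) (hgood : IsGoodEstimate p σ σhat)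
    {x : Fin n → Fin d → ℝ} (hx : ∀ j i, |x j i| ≤ M)
    (hcount : ∀ i, ∑ j, (if 4 * σ i < |x j i - mean D i| then (1 : ℝ) else 0) ≤ n / 4)
    {t : ℝ} (ht : 1 ≤ t) (hnorm : ∀ j, vecNorm p (x j - mean D) ≤ t * vecNorm p σ)
    (hscaled : ∀ j, ∑ i, (x j i - mean D i) ^ 2 / σhat i ^ (4 / ((p : ℝ) + 2)) ≤
      t * vecNorm 2 (fun i => σ i ^ ((p : ℝ) / (p + 2))) ^ 2)
    {w : QuantileNoise d M} {τ₁ τ₂ : ℝ} (hτ₁ : τ₁ ≤ n / 8)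
    (hw₁ : ∀ i l, |√(steps M / (2 * (ρ / 3 / d))) * w.1 i l| ≤ τ₁)
    (hw₂ : ∀ l, |√(steps (lengthBound d M) / (2 * (ρ / 3))) * w.2 l| ≤ τ₂)
    (hτ₂ : 0 ≤ τ₂) (hk : τ₂ < k) (hkn : k + τ₂ < n) (g : Fin d → ℝ) :
    vecNorm p (plan p M k (ρ / 3) (ρ / 3) (ρ / 3) σhat x w g - mean D) ≤
      1 / n * vecNorm p (centredSum D x) + 1 / n * ((k + τ₂) * (6 * t * vecNorm p σ)) +
        30 * t * √(scaledVar p σ) / (n * √ρ) * vecNorm p (fun i => g i * scale p σhat i) := by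
  have hn0 : (0 : ℝ) < n := by exact_mod_cast hn
  have hp1 : (1 : ℝ) ≤ p := by exact_mod_cast hp
  have hσ0 : ∀ i, 0 < σ i := fun i => by linarith [hσ i]
  have hle : ∀ i, σ i ≤ σhat i := fun i => (hgood i).1
  have h1 : ∀ i, 1 ≤ σhat i := fun i => (hσ i).trans (hle i)
  have h10 : ∀ i, 0 < σhat i := fun i => by linarith [h1 i]
  set c := center M (ρ / 3) x w.1 with hc
  -- The final interval has half-length at most `1 ≤ σ_i`, so `4σ_i + 1 ≤ 5σ_i`.
  have hcμ : ∀ i, |c i - mean D i| ≤ 5 * σ i := fun i => by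
    have := abs_midpoint_sub_le (ρ := ρ / 3 / d) hM (fun j => x j i) (w.1 i) (hw₁ i)
      (by linarith [hσ i] : 0 ≤ 4 * σ i) (hμ i) hn hτ₁ (hcount i)
    exact this.trans (by linarith [hσ i])
  have hcM : ∀ i, |c i| ≤ M := fun i => by
    obtain ⟨-, h2, h3, h4, -⟩ := privQuantile_spec (ρ := ρ / 3 / d) hM (1 / 2) (fun j => x j i)
      (w.1 i) (hw₁ i)
    rw [hc, center, abs_le]
    constructor <;> linarith
  set y := scaled p σhat x c with hy
  have hS := one_le_scaledVar (p := p) hd hσ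
  have hS1 : 1 ≤ √(scaledVar p σ) := Real.one_le_sqrt.mpr hS
  have hlen : ∀ j, vecNorm 2 (y j) ≤ 8 * t * √(scaledVar p σ) := fun j =>
    vecNorm_scaled_le hσ0 hle hcμ x j ht (by rw [← vecNorm_two_rpow_sq hσ0]; exact hscaled j)
  have hd0 : (0 : ℝ) < d := by exact_mod_cast hd
  obtain ⟨hC0, hC1, hC2⟩ := privQuantile_upper_spec (ρ := ρ / 3) (B := lengthBound d M)
    (by unfold lengthBound; positivity) (fun j => vecNorm 2 (y j)) w.2 hw₂ hτ₂ hn hk hkn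
    (fun j => vecNorm_nonneg _ _) hlen
    (fun j => vecNorm_scaled_le_lengthBound h1 hM.le j (hx j) hcM)
  have hb : ∀ j, vecNorm p (x j - c) ≤ 6 * t * vecNorm p σ := fun j => by
    have e : x j - c = (x j - mean D) + -(c - mean D) := by
      funext i; simp
    have h2 : vecNorm p (c - mean D) ≤ 5 * vecNorm p σ := by
      rw [← abs_of_pos (by norm_num : (0 : ℝ) < 5), ← vecNorm_smul (by linarith)]
      refine vecNorm_mono (by linarith) fun i => ?_
      have h3 : 0 < 5 * σ i := by linarith [hσ i]
      rw [Pi.sub_apply, abs_of_pos h3]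
      exact hcμ i
    have h3 := vecNorm_add_le hp1 (x j - mean D) (-(c - mean D))
    rw [← e, vecNorm_neg] at h3
    have h4 := hnorm j
    have h5 := vecNorm_nonneg p σ
    nlinarith
  have key := vecNorm_release_sub_le (ρ₃ := ρ / 3) (D := D) hp hn h10 hC0 hb hC2 g
  refine key.trans (add_le_add le_rfl (mul_le_mul_of_nonneg_right ?_ (vecNorm_nonneg _ _)))
  set C := (privQuantile (ρ / 3) (lengthBound d M) ((n - k) / n)
    (fun j => vecNorm 2 (y j)) w.2).2
  -- The extra `2` is the length of the final interval, absorbed since `t √S ≥ 1`. With `√6 ≤ 3`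
  -- this leads to the constant `30`.
  have h2 : C ≤ 10 * t * √(scaledVar p σ) := by nlinarith
  have h3 : √(2 * C ^ 2 / (ρ / 3)) ≤ 3 * C / √ρ := by
    rw [Real.sqrt_le_left (by positivity), div_pow, Real.sq_sqrt hρ.le, mul_pow]
    have : 2 * C ^ 2 / (ρ / 3) = 6 * C ^ 2 / ρ := by ring
    rw [this]
    gcongr
    norm_num
  calc 1 / n * √(2 * C ^ 2 / (ρ / 3)) ≤ 1 / n * (3 * (10 * t * √(scaledVar p σ)) / √ρ) := by
        gcongr
        exact h3.trans (by gcongr)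
    _ = _ := by field_simp; norm_num

/-! ### Tails -/

theorem gaussianReal_abs_gt_le {τ : ℝ} (hτ : 0 ≤ τ) :
    gaussianReal 0 1 {w : ℝ | τ < |w|} ≤ ENNReal.ofReal (2 * Real.exp (-(τ ^ 2 / 2))) := by
  have hsg : HasSubgaussianMGF id 1 (gaussianReal 0 1) := by
    refine ⟨fun t => integrable_exp_mul_gaussianReal t, fun t => ?_⟩
    rw [mgf_gaussianReal Measure.map_id]
    simp
  have h1 := hsg.measure_ge_le hτ
  have h2 := hsg.neg.measure_ge_le hτ
  have hle : (gaussianReal 0 1).real {w : ℝ | τ < |w|} ≤ 2 * Real.exp (-(τ ^ 2 / 2)) := by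
    have hsub : {w : ℝ | τ < |w|} ⊆ {w | τ ≤ id w} ∪ {w | τ ≤ (-id) w} := by
      intro w hw
      rcases lt_abs.mp (show τ < |w| from hw) with h | h
      · exact Or.inl h.le
      · exact Or.inr h.le
    refine (measureReal_mono hsub).trans ((measureReal_union_le _ _).trans ?_)
    have e : -τ ^ 2 / (2 * ((1 : ℝ≥0) : ℝ)) = -(τ ^ 2 / 2) := by push_cast; ring
    rw [e] at h1 h2
    linarith
  rw [measureReal_def] at hle
  exact (ENNReal.le_ofReal_iff_toReal_le (measure_ne_top _ _) (by positivity)).mpr hle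

theorem one_le_log_of_four_le {N : ℝ} (hN : 4 ≤ N) : 1 ≤ Real.log N := by
  rw [Real.le_log_iff_exp_le (by linarith)]
  linarith [Real.exp_one_lt_d9]

/-- Thresholds at which the tails of well-concentrated distributions are polynomially small. -/
theorem exists_tail_le (A c : ℝ) (hA : 0 < A) (hc : 0 < c) (a : ℕ) :
    ∃ K₁ : ℝ, 2 ≤ K₁ ∧ ∀ (d : ℕ) (N : ℝ), 1 ≤ d → 4 ≤ N → (d : ℝ) ≤ N →
      tail A c a d (K₁ * Real.log N ^ (a + 1)) ≤ Real.exp (-(6 * Real.log N)) := by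
  -- `|log A|` absorbs the prefactor of the tail. `K₁` is chosen with `W (a + 4)^a (log K₁)^a ≤ c
  -- K₁`, independently of `d` and `N`.
  set W : ℝ := 6 + |Real.log A| with hW
  have hlo := (Real.isLittleO_pow_log_id_atTop (n := a)).bound
    (show 0 < c / (W * (a + 4) ^ a) by positivity)
  obtain ⟨K₁, hK, hK4⟩ := (hlo.and (Filter.eventually_ge_atTop (4 : ℝ))).exists
  have hlog1 : 1 ≤ Real.log K₁ := one_le_log_of_four_le hK4
  refine ⟨K₁, by linarith, fun d N hd hN hdN => ?_⟩
  set ℓ := Real.log N with hℓ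
  have hℓ1 : 1 ≤ ℓ := one_le_log_of_four_le hN
  have hd1 : (1 : ℝ) ≤ d := by exact_mod_cast hd
  -- The denominator in the tail costs at most `log^a N`; the exponent `a + 1` of the threshold
  -- therefore leaves one factor `log N`.
  have hbase : 1 + Real.log (d * (K₁ * ℓ ^ (a + 1))) ≤ ((a + 4) * Real.log K₁) * ℓ := by
    rw [Real.log_mul (by positivity) (by positivity), Real.log_mul (by positivity) (by positivity),
      Real.log_pow]
    have h1 : Real.log d ≤ ℓ := Real.log_le_log (by linarith) hdN
    have h2 : Real.log ℓ ≤ ℓ := (Real.log_le_sub_one_of_pos (by linarith)).trans (by linarith)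
    have h3 : ((a + 1 : ℕ) : ℝ) * Real.log ℓ ≤ (a + 1) * ℓ := by push_cast; gcongr
    have h4 : Real.log K₁ ≤ Real.log K₁ * ℓ := le_mul_of_one_le_right (by linarith) hℓ1
    have h5 : ((a : ℝ) + 3) * ℓ ≤ (a + 3) * (Real.log K₁ * ℓ) := by
      gcongr
      exact le_mul_of_one_le_left (by linarith) hlog1
    nlinarith
  have hb0 : 0 < 1 + Real.log (d * (K₁ * ℓ ^ (a + 1))) := by
    have : 0 ≤ Real.log (d * (K₁ * ℓ ^ (a + 1))) := Real.log_nonneg (by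
      have : 1 ≤ ℓ ^ (a + 1) := one_le_pow₀ hℓ1
      have : 1 ≤ K₁ * ℓ ^ (a + 1) := by nlinarith
      nlinarith)
    linarith
  have hkey : W * ℓ ≤ c * (K₁ * ℓ ^ (a + 1)) / (1 + Real.log (d * (K₁ * ℓ ^ (a + 1)))) ^ a := by
    rw [le_div_iff₀ (by positivity)]
    have h1 : (1 + Real.log (d * (K₁ * ℓ ^ (a + 1)))) ^ a ≤
        (((a + 4) * Real.log K₁) * ℓ) ^ a := by gcongr
    simp only [Real.norm_eq_abs, id] at hK
    rw [abs_of_nonneg (by positivity), abs_of_pos (by linarith), div_mul_eq_mul_div,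
      le_div_iff₀ (by positivity)] at hK
    calc W * ℓ * (1 + Real.log (d * (K₁ * ℓ ^ (a + 1)))) ^ a
        ≤ W * ℓ * (((a + 4) * Real.log K₁) * ℓ) ^ a := by gcongr
      _ = (Real.log K₁ ^ a * (W * (a + 4) ^ a)) * ℓ ^ (a + 1) := by
          rw [mul_pow, mul_pow]; ring
      _ ≤ (c * K₁) * ℓ ^ (a + 1) := by gcongr
      _ = _ := by ring
  unfold tail
  calc A * Real.exp _ ≤ A * Real.exp (-(W * ℓ)) := by gcongr
    _ = Real.exp (Real.log A - W * ℓ) := by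
        rw [sub_eq_add_neg, Real.exp_add, Real.exp_log hA]
    _ ≤ _ := by
        refine Real.exp_le_exp.mpr ?_
        have h1 := le_abs_self (Real.log A)
        have h2 : |Real.log A| ≤ |Real.log A| * ℓ := le_mul_of_one_le_right (abs_nonneg _) hℓ1
        rw [hW]
        linarith

/-- The common form of the failure estimates: of `N^(k+5)`, `N^k` pays for the number of events, one
factor gives `1/N ≤ β`, and the last four give `12 / 4⁴ < 1/20`. -/
theorem mul_exp_neg_log_le {N β X y : ℝ} (k : ℕ) (hN : 4 ≤ N) (hβ : 1 / N ≤ β)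
    (hX : X ≤ 12 * N ^ k) (hy : (k + 5 : ℕ) * Real.log N ≤ y) :
    X * Real.exp (-y) ≤ β / 20 := by
  have hN0 : 0 < N := by linarith
  have h1 : Real.exp (-y) ≤ (N ^ (k + 5))⁻¹ := by
    have : Real.exp (-((k + 5 : ℕ) * Real.log N)) = (N ^ (k + 5))⁻¹ := by
      rw [Real.exp_neg, ← Real.log_pow, Real.exp_log (by positivity)]
    rw [← this]
    exact Real.exp_le_exp.mpr (by linarith)
  calc X * Real.exp (-y) ≤ 12 * N ^ k * (N ^ (k + 5))⁻¹ := by gcongr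
    _ = 12 * (1 / N ^ 4) * (1 / N) := by rw [pow_add]; field_simp
    _ ≤ 12 * (1 / 4 ^ 4) * β := by gcongr
    _ ≤ β / 20 := by
        have : 0 < β := lt_of_lt_of_le (by positivity) hβ
        linarith

theorem steps_le {N B : ℝ} (hN : 4 ≤ N) (hB : 0 < B) (h : B ≤ N ^ 3) :
    (steps B : ℝ) ≤ 6 * Real.log N := by
  have hL := one_le_log_of_four_le hN
  have h1 : Real.logb 2 B ≤ 5 * Real.log N := by
    rw [Real.logb, div_le_iff₀ (Real.log_pos one_lt_two)]
    have h2 := Real.log_le_log hB h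
    rw [Real.log_pow] at h2
    push_cast at h2
    have h3 := Real.log_two_gt_d9
    nlinarith
  rcases le_total (Real.logb 2 B) 0 with h0 | h0
  · rw [steps, Nat.ceil_eq_zero.mpr h0]
    simp; linarith
  · have := Nat.ceil_lt_add_one h0
    rw [steps]
    linarith

/-! ### The atypical events -/

theorem measure_noise_le {m : ℕ} {N β τ : ℝ} (k : ℕ) (hN : 4 ≤ N) (hβ : 1 / N ≤ β)
    {r : ℕ} (hm : 2 * (r * m) ≤ 12 * N ^ k) (hτ0 : 0 ≤ τ)
    (hτ : (k + 5 : ℕ) * Real.log N ≤ τ ^ 2 / 2) :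
    r * (Measure.pi fun _ : Fin m => gaussianReal 0 1) {w | ∃ l, τ < |w l|} ≤
      ENNReal.ofReal (β / 20) := by
  have h1 := measure_pi_exists_le (fun _ : Fin m => gaussianReal 0 1) {w : ℝ | τ < |w|}
    (fun _ => gaussianReal_abs_gt_le hτ0)
  calc _ ≤ (r : ℝ≥0∞) * (m * ENNReal.ofReal (2 * Real.exp (-(τ ^ 2 / 2)))) := by
        gcongr
        exact h1
    _ = ENNReal.ofReal (2 * (r * m) * Real.exp (-(τ ^ 2 / 2))) := by
        rw [← ENNReal.ofReal_natCast, ← ENNReal.ofReal_natCast,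
          ← ENNReal.ofReal_mul (by positivity), ← ENNReal.ofReal_mul (by positivity)]
        congr 1
        ring
    _ ≤ _ := ENNReal.ofReal_le_ofReal
        (mul_exp_neg_log_le k hN hβ hm hτ)

theorem quantileNoise_le {d : ℕ} {M N β : ℝ} (hM : 0 < M) (hd : 1 ≤ d) (hN : 4 ≤ N)
    (hβ : 1 / N ≤ β) (hdN : (d : ℝ) ≤ N) (hMN : M ≤ N) :
    quantileNoise d M {w | (∃ i l, 4 * Real.log N < |w.1 i l|) ∨
      ∃ l, 4 * Real.log N < |w.2 l|} ≤ ENNReal.ofReal (β / 4) := by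
  have hL := one_le_log_of_four_le hN
  have hLN : Real.log N ≤ N := (Real.log_le_sub_one_of_pos (by linarith)).trans (by linarith)
  have hd1 : (1 : ℝ) ≤ d := by exact_mod_cast hd
  have hβ0 : 0 < β := lt_of_lt_of_le (by positivity) hβ
  have hT₁ : (steps M : ℝ) ≤ 6 * Real.log N := steps_le hN hM
    (hMN.trans (le_self_pow₀ (by linarith) (by norm_num)))
  have hsq : √(d : ℝ) ≤ N := (Real.sqrt_le_left (by linarith)).mpr (by nlinarith)
  have hT₂ : (steps (lengthBound d M) : ℝ) ≤ 6 * Real.log N := by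
    refine steps_le hN (by unfold lengthBound; positivity) ?_
    calc 2 * M * √(d : ℝ) ≤ N * N * N := by gcongr; linarith
      _ = N ^ 3 := by ring
  -- There are at most `6 N²` Gaussians in the median searches, and the level `4 log N` gives the
  -- exponent `8 log² N ≥ 7 log N`.
  have h1 := measure_noise_le (m := steps M) (τ := 4 * Real.log N) (r := d) 2 hN hβ
    (by calc (2 : ℝ) * (d * steps M) ≤ 2 * (N * (6 * N)) := by gcongr; linarith
          _ = 12 * N ^ 2 := by ring) (by positivity) (by push_cast; nlinarith)
  have h2 := measure_noise_le (m := steps (lengthBound d M)) (τ := 4 * Real.log N) (r := 1) 1 hN hβ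
    (by push_cast; linarith) (by positivity) (by push_cast; nlinarith)
  rw [Nat.cast_one, one_mul] at h2
  have h3 := measure_pi_exists_le
    (fun _ : Fin d => Measure.pi fun _ : Fin (steps M) => gaussianReal 0 1)
    {w | ∃ l, 4 * Real.log N < |w l|} (fun _ => le_rfl)
  have hsub : {w : QuantileNoise d M | (∃ i l, 4 * Real.log N < |w.1 i l|) ∨
      ∃ l, 4 * Real.log N < |w.2 l|} ⊆
      ({w | ∃ i, w i ∈ {w | ∃ l, 4 * Real.log N < |w l|}} ×ˢ Set.univ) ∪
      (Set.univ ×ˢ {w | ∃ l, 4 * Real.log N < |w l|}) := by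
    rintro w (⟨i, l, h⟩ | ⟨l, h⟩)
    · exact Or.inl ⟨⟨i, l, h⟩, trivial⟩
    · exact Or.inr ⟨trivial, ⟨l, h⟩⟩
  refine (measure_mono hsub).trans ((measure_union_le _ _).trans ?_)
  rw [quantileNoise, Measure.prod_prod, Measure.prod_prod, measure_univ, measure_univ, mul_one,
    one_mul]
  calc _ ≤ ENNReal.ofReal (β / 20) + ENNReal.ofReal (β / 20) := add_le_add (h3.trans h1) h2
    _ = ENNReal.ofReal (β / 20 + β / 20) :=
        (ENNReal.ofReal_add (by positivity) (by positivity)).symm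
    _ ≤ _ := ENNReal.ofReal_le_ofReal (by linarith)

theorem stdGaussianVec_le {d : ℕ} {N β : ℝ} (hN : 4 ≤ N)
    (hβ : 1 / N ≤ β) (hdN : (d : ℝ) ≤ N) :
    stdGaussianVec d {g | ∃ i, 4 * Real.log N < |g i|} ≤ ENNReal.ofReal (β / 20) := by
  have hL := one_le_log_of_four_le hN
  have h2 := measure_noise_le (m := d) (τ := 4 * Real.log N) (r := 1) 1 hN hβ
    (by push_cast; linarith) (by positivity) (by push_cast; nlinarith)
  rwa [Nat.cast_one, one_mul] at h2

/-- Few samples deviate from the mean by more than four times the scale of the coordinate. -/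
theorem measure_count_gt_le {d n r : ℕ} (hn : 0 < n) (hr : 2 ≤ r) {D : Measure (Fin d → ℝ)}
    [IsProbabilityMeasure D] {i : Fin d} {s : ℝ} (hs : 0 < s)
    (hmem : MemLp (fun x => x i) (r : ℝ≥0∞) D)
    (hmom : ∫ x, |x i - mean D i| ^ r ∂D = s ^ r) :
    (Measure.pi fun _ : Fin n => D) {x | (n : ℝ) / 4 <
      ∑ j, (if 4 * s < |x j i - mean D i| then (1 : ℝ) else 0)} ≤
      ENNReal.ofReal (Real.exp (-(9 * n / 512))) := by
  have hn0 : (0 : ℝ) < n := by exact_mod_cast hn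
  set F : (Fin d → ℝ) → ℝ := fun x => if 4 * s < |x i - mean D i| then (1 : ℝ) else 0 with hF
  have hFm : Measurable F := Measurable.ite
    (measurableSet_lt measurable_const ((measurable_pi_apply i).sub_const _).abs)
    measurable_const measurable_const
  have hF01 : ∀ x, 0 ≤ F x ∧ F x ≤ 1 := fun x => by simp only [hF]; split_ifs <;> norm_num
  have hFi : Integrable F D := integrable_of_abs_le hFm (B := 1) fun x => by
    rw [abs_of_nonneg (hF01 x).1]; exact (hF01 x).2
  -- Markov's inequality for the `r`-th moment, with `4^r ≥ 16`.
  have hFint : ∫ x, F x ∂D ≤ 1 / 16 := by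
    have hint : Integrable (fun x : Fin d → ℝ => |x i - mean D i| ^ r) D :=
      (hmem.sub (memLp_const (mean D i))).integrable_norm_pow'
    calc ∫ x, F x ∂D ≤ ∫ x, |x i - mean D i| ^ r / (4 * s) ^ r ∂D := by
          refine integral_mono hFi (hint.div_const _) fun x => ?_
          simp only [hF]
          split_ifs with h
          · rw [one_le_div (by positivity)]
            gcongr
          · positivity
      _ = 1 / 4 ^ r := by
          rw [integral_div, hmom, mul_pow]
          field_simp
      _ ≤ 1 / 4 ^ 2 := by gcongr; norm_num
      _ = 1 / 16 := by norm_num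
  set f : (Fin n → Fin d → ℝ) → ℝ := fun x => ∑ j, F (x j)
  have hfm : Measurable f := Finset.measurable_sum _ fun j _ => hFm.comp (measurable_pi_apply j)
  have hfB : ∀ x, |f x| ≤ n := fun x => by
    rw [abs_of_nonneg (Finset.sum_nonneg fun j _ => (hF01 _).1)]
    calc f x ≤ ∑ _j : Fin n, (1 : ℝ) := Finset.sum_le_sum fun j _ => (hF01 _).2
      _ = n := by simp
  have hfc : ∀ x y : Fin n → Fin d → ℝ, ∀ j, (∀ i, i ≠ j → x i = y i) → |f x - f y| ≤ 1 := by
    intro x y j h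
    simp only [f]
    rw [← Finset.sum_sub_distrib,
      Finset.sum_eq_single j (fun l _ hl => by rw [h l hl, sub_self]) (by simp), abs_le]
    have h1 := hF01 (x j)
    have h2 := hF01 (y j)
    constructor <;> linarith
  have hmean : ∫ x, f x ∂(Measure.pi fun _ : Fin n => D) ≤ n / 16 := by
    have h1 := fun j => measurePreserving_eval (fun _ : Fin n => D) j
    have h2 : ∀ j, ∫ x : Fin n → Fin d → ℝ, F (x j) ∂(Measure.pi fun _ : Fin n => D) =
        ∫ x, F x ∂D := fun j => by
      conv_rhs => rw [← (h1 j).map_eq]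
      exact (integral_map (h1 j).measurable.aemeasurable hFm.aestronglyMeasurable).symm
    have h3 : ∀ j, Integrable (fun x : Fin n → Fin d → ℝ => F (x j))
        (Measure.pi fun _ : Fin n => D) := fun j => (h1 j).integrable_comp_of_integrable hFi
    simp only [f]
    rw [integral_finsetSum _ fun j _ => h3 j]
    simp_rw [h2]
    simp only [Finset.sum_const, Finset.card_univ, Fintype.card_fin, nsmul_eq_mul]
    nlinarith
  -- From the mean `n/16` to `n/4` there remains `3n/16`, and `(3/16)² / 2 = 9/512`.
  have key := measure_lt_of_bounded_differences D zero_le_one hfm hfB hfc hmean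
    (ε := 3 * n / 16) (by positivity)
  have e1 : (n : ℝ) / 16 + 3 * n / 16 = n / 4 := by ring
  have e2 : -(3 * (n : ℝ) / 16) ^ 2 / (2 * (n * 1 ^ 2)) = -(9 * n / 512) := by
    field_simp; ring
  rw [e1, e2] at key
  exact key

/-- Data without atypical deviations, whose recentred sum is at most `E`. -/
structure IsTypical {d n : ℕ} (p : ℕ) (D : Measure (Fin d → ℝ)) (σ σhat : Fin d → ℝ) (M t E : ℝ)
    (x : Fin n → Fin d → ℝ) : Prop where
  bounded : ∀ j i, |x j i| ≤ M
  count : ∀ i, ∑ j, (if 4 * σ i < |x j i - mean D i| then (1 : ℝ) else 0) ≤ n / 4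
  norm : ∀ j, vecNorm p (x j - mean D) ≤ t * vecNorm p σ
  scaled : ∀ j, ∑ i, (x j i - mean D i) ^ 2 / σhat i ^ (4 / ((p : ℝ) + 2)) ≤
    t * vecNorm 2 (fun i => σ i ^ ((p : ℝ) / (p + 2))) ^ 2
  sum : vecNorm p (centredSum D x) ≤ E

theorem vecNorm_pos {d p : ℕ} (hd : 1 ≤ d) (hp : 1 ≤ p) {σ : Fin d → ℝ} (hσ : ∀ i, 1 ≤ σ i) :
    0 < vecNorm p σ := by
  refine (vecNorm_nonneg _ _).lt_of_ne fun h => ?_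
  have h1 := vecNorm_pow (p := p) (by omega) σ
  rw [← h, zero_pow (by omega)] at h1
  have h2 : 0 < ∑ i, |σ i| ^ p := Finset.sum_pos (fun i _ => by
    have := hσ i
    have : 0 < |σ i| := abs_pos.mpr (by linarith)
    positivity) ⟨⟨0, hd⟩, Finset.mem_univ _⟩
  linarith

/-- A union bound over five events, one of them null and the others of probability at most `β/20`.
Events counted over samples need `N ≥ n`. The deviation counts are summed over coordinates only and
use `N₀`, because the sample size is known to dominate only `log N₀`. -/
theorem measure_not_isTypical_le {d n p : ℕ} (hd : 1 ≤ d) (hp : 1 ≤ p) {M N₀ N β A c t : ℝ}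
    {a : ℕ} (hM : 0 < M) (hN₀ : 4 ≤ N₀) (hN : N₀ ≤ N) (hβ : 1 / N₀ ≤ β) (hdN : (d : ℝ) ≤ N₀)
    (hnN : (n : ℝ) ≤ N) {D : Measure (Fin d → ℝ)} [IsProbabilityMeasure D] {σ σhat : Fin d → ℝ}
    (hD : ∀ᵐ x ∂D, ∀ i, |x i| ≤ M) (hσ : ∀ i, 1 ≤ σ i) (hgood : IsGoodEstimate p σ σhat)
    (hwc : IsWellConcentrated A c a p D σ) (ht : 1 < t)
    (htail : tail A c a d t ≤ Real.exp (-(6 * Real.log N))) (hn : 512 * Real.log N₀ ≤ n) :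
    (Measure.pi fun _ : Fin n => D) {x | ¬ IsTypical p D σ σhat M t
      (3 * (√(5 * 4 ^ max p 2 * (n + 1)) * vecNorm p σ) +
        n * (d * (2 * M) * Real.exp (-(6 * Real.log N))) +
        4 * Real.log N * √n * (2 * (t * vecNorm p σ))) x} ≤ ENNReal.ofReal (β / 4) := by
  have hL := one_le_log_of_four_le hN₀
  have hN4 : 4 ≤ N := hN₀.trans hN
  have hℓ := one_le_log_of_four_le hN4
  have hn0 : (0 : ℝ) < n := by linarith
  have hn0' : 0 < n := by exact_mod_cast hn0
  have hβN : 1 / N ≤ β := (one_div_le_one_div_of_le (by linarith) hN).trans hβ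
  have hβ0 : 0 < β := lt_of_lt_of_le (by positivity) hβ
  have hσ0 : ∀ i, 0 < σ i := fun i => by linarith [hσ i]
  have hp0 : p ≠ 0 := by omega
  have hV := vecNorm_pos hd hp hσ
  set P := Measure.pi fun _ : Fin n => D
  set q : ℝ := Real.exp (-(6 * Real.log N)) with hq
  set E : ℝ := 3 * (√(5 * 4 ^ max p 2 * (n + 1)) * vecNorm p σ) + n * (d * (2 * M) * q) +
    4 * Real.log N * √n * (2 * (t * vecNorm p σ)) with hE
  have hnq : (n : ℝ≥0∞) * ENNReal.ofReal q ≤ ENNReal.ofReal (β / 20) := by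
    rw [← ENNReal.ofReal_natCast, ← ENNReal.ofReal_mul hn0.le]
    exact ENNReal.ofReal_le_ofReal
      (mul_exp_neg_log_le 1 hN4 hβN (by linarith) (by push_cast; linarith))
  have b₁ : P {x | ∃ j, x j ∈ {y : Fin d → ℝ | ∀ i, |y i| ≤ M}ᶜ} = 0 :=
    le_antisymm ((measure_pi_exists_le (fun _ : Fin n => D) _ (b := 0)
      (fun _ => (mem_ae_iff.mp hD).le)).trans (by simp)) zero_le
  have b₂ : P {x | ∃ i, (n : ℝ) / 4 <
      ∑ j, (if 4 * σ i < |x j i - mean D i| then (1 : ℝ) else 0)} ≤ ENNReal.ofReal (β / 20) := by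
    have e : {x : Fin n → Fin d → ℝ | ∃ i, (n : ℝ) / 4 <
        ∑ j, (if 4 * σ i < |x j i - mean D i| then (1 : ℝ) else 0)} = ⋃ i, {x | (n : ℝ) / 4 <
        ∑ j, (if 4 * σ i < |x j i - mean D i| then (1 : ℝ) else 0)} := by ext x; simp
    rw [e]
    refine (measure_iUnion_le _).trans ?_
    rw [tsum_fintype]
    calc _ ≤ ∑ _i : Fin d, ENNReal.ofReal (Real.exp (-(9 * n / 512))) :=
          Finset.sum_le_sum fun i _ => measure_count_gt_le hn0' (le_max_right p 2) (hσ0 i)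
            (hwc.memLp i) (hwc.moment i)
      _ = ENNReal.ofReal (d * Real.exp (-(9 * n / 512))) := by
          rw [ENNReal.ofReal_mul (Nat.cast_nonneg d), ENNReal.ofReal_natCast]
          simp
      _ ≤ _ := ENNReal.ofReal_le_ofReal (mul_exp_neg_log_le 1 hN₀ hβ (by linarith)
          (by push_cast; linarith))
  have hbad : D {x | t * vecNorm p σ < vecNorm p (x - mean D)} ≤ ENNReal.ofReal q := by
    refine (measure_mono fun x hx => ?_).trans
      ((hwc.tail_norm t ht).trans (ENNReal.ofReal_le_ofReal htail))
    have h1 : t * vecNorm p σ < vecNorm p (x - mean D) := hx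
    -- The tail hypothesis concerns `p`-th powers; `t^p ≥ t` makes the threshold `t` for the norm
    -- itself sufficient.
    have h2 : (t * vecNorm p σ) ^ p < vecNorm p (x - mean D) ^ p :=
      pow_lt_pow_left₀ h1 (by positivity) hp0
    rw [vecNorm_pow hp0, mul_pow] at h2
    refine lt_of_le_of_lt ?_ h2
    gcongr
    exact le_self_pow₀ ht.le hp0
  have b₃ := (measure_pi_exists_le (fun _ : Fin n => D) _ (fun _ => hbad)).trans hnq
  have b₄ := (measure_pi_exists_le (fun _ : Fin n => D) _ (fun _ =>
    (hwc.tail_scaled σhat hgood t ht).trans (ENNReal.ofReal_le_ofReal htail))).trans hnq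
  have b₅ : P {x | E < vecNorm p (centredSum D x)} ≤ ENNReal.ofReal (β / 20) := by
    have h := measure_vecNorm_centredSum_gt_le (n := n) hd hp hM.le
      (by positivity : 0 ≤ t * vecNorm p σ) (Real.exp_pos _).le hD hσ0 hwc.memLp hwc.moment hbad
      (ε := 4 * Real.log N * √n * (2 * (t * vecNorm p σ))) (by positivity)
    refine h.trans ?_
    -- The deviation is `4 log N · √n` times the bounded-difference constant `2 t ‖σ‖_p`.
    have e : -(4 * Real.log N * √n * (2 * (t * vecNorm p σ))) ^ 2 /
        (2 * (n * (2 * (t * vecNorm p σ)) ^ 2)) = -(8 * Real.log N ^ 2) := by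
      rw [mul_pow, mul_pow, Real.sq_sqrt hn0.le]
      field_simp
      norm_num
    rw [e]
    have h8 : Real.exp (-(8 * Real.log N ^ 2)) ≤ q := Real.exp_le_exp.mpr (by nlinarith)
    calc (n : ℝ≥0∞) * ENNReal.ofReal q + ENNReal.ofReal (Real.exp (-(8 * Real.log N ^ 2)))
        ≤ n * ENNReal.ofReal q + ENNReal.ofReal q := by gcongr
      _ = ENNReal.ofReal ((n + 1) * q) := by
          rw [add_mul, one_mul, ENNReal.ofReal_add (by positivity) (by positivity),
            ENNReal.ofReal_mul hn0.le, ENNReal.ofReal_natCast]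
      _ ≤ _ := ENNReal.ofReal_le_ofReal (mul_exp_neg_log_le 1 hN4 hβN (by linarith)
          (by push_cast; linarith))
  refine (measure_mono (t := ({x | ∃ j, x j ∈ {y : Fin d → ℝ | ∀ i, |y i| ≤ M}ᶜ} ∪
    {x | ∃ i, (n : ℝ) / 4 < ∑ j, (if 4 * σ i < |x j i - mean D i| then (1 : ℝ) else 0)}) ∪
    ({x | ∃ j, x j ∈ {x : Fin d → ℝ | t * vecNorm p σ < vecNorm p (x - mean D)}} ∪
    {x | ∃ j, x j ∈ {x : Fin d → ℝ | t * vecNorm 2 (fun i => σ i ^ ((p : ℝ) / (p + 2))) ^ 2 <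
      ∑ i, (x i - mean D i) ^ 2 / σhat i ^ (4 / ((p : ℝ) + 2))}}) ∪
    {x | E < vecNorm p (centredSum D x)}) ?_).trans ?_
  · intro x hx
    by_contra hc
    simp only [Set.mem_union, not_or] at hc
    obtain ⟨⟨⟨h1, h2⟩, h3, h4⟩, h5⟩ := hc
    refine hx ⟨fun j => ?_, fun i => ?_, fun j => ?_, fun j => ?_, ?_⟩
    · by_contra h; exact h1 ⟨j, h⟩
    · by_contra h; exact h2 ⟨i, not_le.mp h⟩
    · by_contra h; exact h3 ⟨j, not_le.mp h⟩
    · by_contra h; exact h4 ⟨j, not_le.mp h⟩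
    · exact not_lt.mp h5
  · refine (measure_union_le _ _).trans ((add_le_add ((measure_union_le _ _).trans
      (add_le_add ((measure_union_le _ _).trans (add_le_add b₁.le b₂))
        ((measure_union_le _ _).trans (add_le_add b₃ b₄)))) b₅).trans ?_)
    rw [zero_add, ← ENNReal.ofReal_add (by positivity) (by positivity),
      ← ENNReal.ofReal_add (by positivity) (by positivity),
      ← ENNReal.ofReal_add (by positivity) (by positivity)]
    exact ENNReal.ofReal_le_ofReal (by linarith)

/-! ### Error on typical data and the final utility bound -/

/-- The noise of the searches is small compared with the sample size. -/
theorem sqrt_steps_mul_le {B ρ L : ℝ} (hρ : 0 < ρ) (hL : 1 ≤ L) (hT : (steps B : ℝ) ≤ 6 * L)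
    {r : ℝ} (hr : 0 < r) {w : ℝ} (hw : |w| ≤ 4 * L) :
    |√(steps B / (2 * (ρ / 3 / r))) * w| ≤ 12 * L ^ 2 * √(r / ρ) := by
  have h1 : √(steps B / (2 * (ρ / 3 / r))) ≤ 3 * L * √(r / ρ) := by
    rw [Real.sqrt_le_left (by positivity), mul_pow, Real.sq_sqrt (by positivity)]
    calc (steps B : ℝ) / (2 * (ρ / 3 / r)) ≤ 6 * L / (2 * (ρ / 3 / r)) := by gcongr
      _ = 9 * L * (r / ρ) := by field_simp; norm_num
      _ ≤ (3 * L) ^ 2 * (r / ρ) := by gcongr; nlinarith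
  rw [abs_mul, abs_of_nonneg (Real.sqrt_nonneg _)]
  calc _ ≤ 3 * L * √(r / ρ) * (4 * L) := by gcongr
    _ = _ := by ring

/-- The error of PLAN on typical data, up to the final noise. -/
theorem vecNorm_plan_sub_le_of_isTypical {d n p a : ℕ} (hp : 1 ≤ p) (hd : 1 ≤ d) {κ : ℝ}
    (hκ : 0 ≤ κ) {M ρ N₀ N K₁ : ℝ} (hM : 0 < M) (hρ : 0 < ρ) (hN₀ : 4 ≤ N₀) (hN : N₀ ≤ N)
    (hdN : (d : ℝ) ≤ N₀) (hMN : M ≤ N₀)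
    {D : Measure (Fin d → ℝ)} (hμ : ∀ i, |mean D i| ≤ M)
    {σ σhat : Fin d → ℝ} (hσ : ∀ i, 1 ≤ σ i) (hgood : IsGoodEstimate p σ σhat) (hK₁ : 2 ≤ K₁)
    (hn₁ : 512 + (14 + 2 * κ) ^ 2 ≤ n)
    (hn₂ : 96 * Real.log N₀ ^ 2 * √(d / ρ) ≤ n) (hn₃ : 145 * Real.log N₀ ^ 4 * (1 / ρ) ≤ n)
    {x : Fin n → Fin d → ℝ}
    (hx : IsTypical p D σ σhat M (K₁ * Real.log N ^ (a + 1))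
      (3 * (√(5 * 4 ^ max p 2 * (n + 1)) * vecNorm p σ) +
        n * (d * (2 * M) * Real.exp (-(6 * Real.log N))) +
        4 * Real.log N * √n * (2 * (K₁ * Real.log N ^ (a + 1) * vecNorm p σ))) x)
    {w : QuantileNoise d M} (hw₁ : ∀ i l, |w.1 i l| ≤ 4 * Real.log N₀)
    (hw₂ : ∀ l, |w.2 l| ≤ 4 * Real.log N₀) (g : Fin d → ℝ) :
    vecNorm p (plan p M (√n + κ * √(1 / (ρ / 3))) (ρ / 3) (ρ / 3) (ρ / 3) σhat x w g - mean D) ≤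
      1 + K₁ * (3 * √(10 * 4 ^ max p 2) + 8 + 6 * (13 + 2 * κ)) * Real.log N ^ (a + 2) *
        (vecNorm p σ / √n) +
      30 * (K₁ * Real.log N ^ (a + 1)) * √(scaledVar p σ) / (n * √ρ) *
        vecNorm p (fun i => g i * scale p σhat i) := by
  have hL := one_le_log_of_four_le hN₀
  have hN4 : 4 ≤ N := hN₀.trans hN
  have hℓ := one_le_log_of_four_le hN4
  set L := Real.log N₀ with hLdef
  set ℓ := Real.log N with hℓdef
  have hn0 : (0 : ℝ) < n := by linarith [sq_nonneg (14 + 2 * κ)]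
  have hn0' : 0 < n := by exact_mod_cast hn0
  have hd1 : (1 : ℝ) ≤ d := by exact_mod_cast hd
  have hsn : 0 < √(n : ℝ) := Real.sqrt_pos.mpr hn0
  have hsq : √(n : ℝ) * √n = n := Real.mul_self_sqrt hn0.le
  have hsn' : 14 + 2 * κ ≤ √n := Real.le_sqrt_of_sq_le (by linarith)
  -- Uses `145 > 12²`. The noise of the length search thus stays strictly below `√n ≤ k`.
  have hρn : 12 * L ^ 2 * √(1 / ρ) < √n := by
    refine Real.lt_sqrt_of_sq_lt ?_
    rw [mul_pow, Real.sq_sqrt (by positivity)]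
    have : (0 : ℝ) < L ^ 4 * (1 / ρ) := by positivity
    nlinarith
  have hρ1 : √(1 / ρ) ≤ √n := by
    have h1 : 1 ≤ L ^ 2 := one_le_pow₀ hL
    have := Real.sqrt_nonneg (1 / ρ)
    nlinarith
  have hk3 : √(1 / (ρ / 3)) ≤ 2 * √(1 / ρ) := by
    rw [Real.sqrt_le_left (by positivity), mul_pow, Real.sq_sqrt (by positivity)]
    have : 1 / (ρ / 3) = 3 * (1 / ρ) := by field_simp
    rw [this]
    gcongr
    norm_num
  have hkκ : κ * √(1 / (ρ / 3)) ≤ 2 * κ * √n := by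
    calc κ * √(1 / (ρ / 3)) ≤ κ * (2 * √n) := by gcongr; linarith
      _ = _ := by ring
  have hkκ0 : 0 ≤ κ * √(1 / (ρ / 3)) := by positivity
  -- The number of clipped samples is `O(√n)`, the order at which clipping costs no more than the
  -- sampling error up to logarithms.
  have hkτ : √n + κ * √(1 / (ρ / 3)) + 12 * L ^ 2 * √(1 / ρ) ≤ (13 + 2 * κ) * √n := by
    linarith
  set t := K₁ * ℓ ^ (a + 1) with ht
  have hpow : 1 ≤ ℓ ^ (a + 1) := one_le_pow₀ hℓ
  have ht1 : 1 ≤ t := one_le_mul_of_one_le_of_one_le (by linarith) hpow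
  have hT₁ : (steps M : ℝ) ≤ 6 * L := steps_le hN₀ hM
    (hMN.trans (le_self_pow₀ (by linarith) (by norm_num)))
  have hsqd : √(d : ℝ) ≤ N₀ := (Real.sqrt_le_left (by linarith)).mpr (by nlinarith)
  have hT₂ : (steps (lengthBound d M) : ℝ) ≤ 6 * L := by
    refine steps_le hN₀ (by unfold lengthBound; positivity) ?_
    calc 2 * M * √(d : ℝ) ≤ N₀ * N₀ * N₀ := by gcongr; linarith
      _ = N₀ ^ 3 := by ring
  -- The constant `96 = 8 · 12` in the sample size makes the noise of the median searches at most
  -- `n/8`.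
  have key := vecNorm_plan_sub_le (k := √n + κ * √(1 / (ρ / 3))) (τ₁ := 12 * L ^ 2 * √(d / ρ))
    (τ₂ := 12 * L ^ 2 * √(1 / ρ)) hp hd hn0' hM hρ hμ hσ hgood hx.bounded hx.count ht1 hx.norm
    hx.scaled (by linarith)
    (fun i l => sqrt_steps_mul_le hρ hL hT₁ (by linarith) (hw₁ i l))
    (fun l => by
      have := sqrt_steps_mul_le hρ hL hT₂ one_pos (hw₂ l)
      rwa [div_one] at this)
    (by positivity) (by linarith)
    (by have := mul_le_mul_of_nonneg_right hsn' hsn.le; linarith) g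
  refine key.trans ?_
  gcongr ?_ + _
  have hV : 0 < vecNorm p σ := vecNorm_pos hd hp hσ
  -- Since `2dM ≤ N³`, the bias from truncation is at most `1` per sample; this is the additive `1`
  -- of the bound.
  have hdM : d * (2 * M) * Real.exp (-(6 * ℓ)) ≤ 1 := by
    have h1 : Real.exp (-(6 * ℓ)) = (N ^ 6)⁻¹ := by
      rw [Real.exp_neg, show 6 * ℓ = ((6 : ℕ) : ℝ) * ℓ by norm_num, ← Real.log_pow,
        Real.exp_log (by positivity)]
    rw [h1, ← div_eq_mul_inv, div_le_one (by positivity)]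
    calc d * (2 * M) ≤ N * (N * N) := by
          gcongr
          · linarith
          · linarith
          · linarith
      _ = N ^ 3 := by ring
      _ ≤ N ^ 6 := pow_le_pow_right₀ (by linarith) (by norm_num)
  have hs1 : √(5 * 4 ^ max p 2 * (n + 1)) ≤ √(10 * 4 ^ max p 2) * √n := by
    rw [← Real.sqrt_mul (by positivity)]
    apply Real.sqrt_le_sqrt
    have : (1 : ℝ) ≤ n := by linarith [sq_nonneg (14 + 2 * κ)]
    calc 5 * 4 ^ max p 2 * ((n : ℝ) + 1) ≤ 5 * 4 ^ max p 2 * (n + n) := by gcongr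
      _ = 10 * 4 ^ max p 2 * n := by ring
  have hdiv : 1 / (n : ℝ) * √n = 1 / √n := by
    rw [one_div_mul_eq_div, div_eq_div_iff hn0.ne' hsn.ne', one_mul, hsq]
  have htℓ : t * ℓ = K₁ * ℓ ^ (a + 2) := by rw [ht]; ring
  have hsum := hx.sum
  clear_value t
  clear key hx
  have h1ℓ : 1 ≤ t * ℓ := one_le_mul_of_one_le_of_one_le ht1 hℓ
  have htle : t ≤ t * ℓ := le_mul_of_one_le_right (by linarith) hℓ
  set R := √(10 * 4 ^ max p 2)
  have hR0 : 0 ≤ R := Real.sqrt_nonneg _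
  have hn1 : 1 / (n : ℝ) * n = 1 := one_div_mul_cancel hn0.ne'
  set V := vecNorm p σ
  have hsum' : vecNorm p (centredSum D x) ≤
      3 * (R * √n * V) + n * 1 + 4 * ℓ * √n * (2 * (t * V)) := by
    refine hsum.trans ?_
    gcongr
  calc 1 / n * vecNorm p (centredSum D x) +
        1 / n * ((√n + κ * √(1 / (ρ / 3)) + 12 * L ^ 2 * √(1 / ρ)) * (6 * t * V))
      ≤ 1 / n * (3 * (R * √n * V) + n * 1 + 4 * ℓ * √n * (2 * (t * V))) +
        1 / n * ((13 + 2 * κ) * √n * (6 * t * V)) := by gcongr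
    _ = 1 + (1 / n * √n) * V * (3 * R + 8 * (t * ℓ) + (13 + 2 * κ) * 6 * t) := by
        linear_combination hn1
    _ ≤ 1 + (1 / n * √n) * V *
        (3 * R * (t * ℓ) + 8 * (t * ℓ) + (13 + 2 * κ) * 6 * (t * ℓ)) := by
        refine add_le_add le_rfl (mul_le_mul_of_nonneg_left ?_ (by positivity))
        have h1 : 3 * R ≤ 3 * R * (t * ℓ) := le_mul_of_one_le_right (by positivity) h1ℓ
        have h2 : (13 + 2 * κ) * 6 * t ≤ (13 + 2 * κ) * 6 * (t * ℓ) := by gcongr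
        linarith
    _ = _ := by
        rw [hdiv, htℓ]
        ring

/-- Only subadditivity is used, so neither set has to be measurable. -/
theorem one_sub_le_measure {Ω : Type*} [MeasurableSpace Ω] {P : Measure Ω} [IsProbabilityMeasure P]
    {S B : Set Ω} {b : ℝ≥0∞} (h : ∀ ω, ω ∉ B → ω ∈ S) (hB : P B ≤ b) : 1 - b ≤ P S := by
  rw [tsub_le_iff_right]
  calc 1 = P Set.univ := measure_univ.symm
    _ ≤ P (S ∪ B) := measure_mono fun ω _ => by
        by_cases hω : ω ∈ B
        · exact Or.inr hω
        · exact Or.inl (h ω hω)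
    _ ≤ P S + P B := measure_union_le _ _
    _ ≤ _ := by gcongr

/-- The expected norm of a Gaussian vector with independent entries. -/
theorem lintegral_vecNorm_gaussian_le {d p : ℕ} (hp : 1 ≤ p) {v : Fin d → ℝ} {V : ℝ} (hV : 0 < V)
    (hv : vecNorm p v ≤ V) :
    ∫⁻ g, ENNReal.ofReal (vecNorm p (fun i => g i * v i)) ∂(stdGaussianVec d) ≤
      ENNReal.ofReal (V * (1 + ∫ w, |w| ^ p ∂(gaussianReal 0 1))) := by
  have hp0 : p ≠ 0 := by omega
  have hm : Integrable (fun w : ℝ => |w| ^ p) (gaussianReal 0 1) :=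
    (memLp_id_gaussianReal' (p : ℝ≥0∞) (ENNReal.natCast_ne_top p)).integrable_norm_pow'
  have hmp := fun i => measurePreserving_eval (fun _ : Fin d => gaussianReal 0 1) i
  have hi : ∀ i, Integrable (fun g : Fin d → ℝ => |g i| ^ p) (stdGaussianVec d) := fun i =>
    (hmp i).integrable_comp_of_integrable hm
  have hiv : ∀ i, ∫ g : Fin d → ℝ, |g i| ^ p ∂(stdGaussianVec d) =
      ∫ w, |w| ^ p ∂(gaussianReal 0 1) := fun i => by
    conv_rhs => rw [← (hmp i).map_eq]
    exact (integral_map (hmp i).measurable.aemeasurable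
      (by fun_prop : Measurable fun w : ℝ => |w| ^ p).aestronglyMeasurable).symm
  have hs : Integrable (fun g : Fin d → ℝ => ∑ i, |g i| ^ p * |v i| ^ p) (stdGaussianVec d) :=
    integrable_finsetSum _ fun i _ => (hi i).mul_const _
  have hb : Integrable (fun g : Fin d → ℝ => V * (1 + (∑ i, |g i| ^ p * |v i| ^ p) / V ^ p))
      (stdGaussianVec d) := ((integrable_const 1).add (hs.div_const _)).const_mul V
  calc ∫⁻ g, ENNReal.ofReal (vecNorm p (fun i => g i * v i)) ∂(stdGaussianVec d)
      ≤ ∫⁻ g, ENNReal.ofReal (V * (1 + (∑ i, |g i| ^ p * |v i| ^ p) / V ^ p))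
          ∂(stdGaussianVec d) := by
        refine lintegral_mono fun g => ENNReal.ofReal_le_ofReal ?_
        have h2 := pow_le_one_add_pow
          (div_nonneg (vecNorm_nonneg p fun i => g i * v i) hV.le) (k := 1) (l := p) hp
        rw [pow_one, div_pow, vecNorm_pow hp0, div_le_iff₀ hV] at h2
        simp_rw [abs_mul, mul_pow] at h2
        linarith
    _ = ENNReal.ofReal (∫ g, V * (1 + (∑ i, |g i| ^ p * |v i| ^ p) / V ^ p)
          ∂(stdGaussianVec d)) :=
        (ofReal_integral_eq_lintegral_ofReal hb
          (Filter.Eventually.of_forall fun g => by positivity)).symm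
    _ ≤ _ := by
        refine ENNReal.ofReal_le_ofReal ?_
        rw [integral_const_mul, integral_add (integrable_const _) (hs.div_const _), integral_div,
          integral_finsetSum _ fun i _ => (hi i).mul_const _, integral_const, probReal_univ,
          one_smul]
        simp_rw [integral_mul_const, hiv]
        have hm0 : 0 ≤ ∫ w, |w| ^ p ∂(gaussianReal 0 1) := integral_nonneg fun w => by positivity
        rw [← Finset.mul_sum, ← vecNorm_pow hp0, mul_div_assoc]
        gcongr
        refine mul_le_of_le_one_right hm0 ((div_le_one (by positivity)).mpr ?_)
        exact pow_le_pow_left₀ (vecNorm_nonneg _ _) hv p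

theorem vecNorm_mul_le {d : ℕ} {p : ℝ} (hp : 0 < p) {g v : Fin d → ℝ} {b : ℝ} (hb : 0 ≤ b)
    (h : ∀ i, |g i| ≤ b) : vecNorm p (fun i => g i * v i) ≤ b * vecNorm p v := by
  rw [← abs_of_nonneg hb, ← vecNorm_smul hp]
  refine vecNorm_mono hp fun i => ?_
  rw [abs_mul, abs_mul, abs_of_nonneg hb]
  gcongr
  exact h i

theorem add_mul_pow_le {K Q Q' ℓ u v : ℝ} {a : ℕ} (hℓ : 1 ≤ ℓ) (hK : 1 ≤ K) (hQ : Q ≤ K)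
    (hQ' : Q' ≤ K) (hu : 0 ≤ u) (hv : 0 ≤ v) :
    1 + Q * ℓ ^ (a + 2) * u + Q' * ℓ ^ (a + 2) * v ≤ K * ℓ ^ (a + 4) * (1 + u + v) := by
  have h1 : ℓ ^ (a + 2) ≤ ℓ ^ (a + 4) := pow_le_pow_right₀ hℓ (by omega)
  have h2 : 1 ≤ ℓ ^ (a + 4) := one_le_pow₀ hℓ
  have h3 : 0 ≤ ℓ ^ (a + 2) := by positivity
  calc 1 + Q * ℓ ^ (a + 2) * u + Q' * ℓ ^ (a + 2) * v
      ≤ K * ℓ ^ (a + 4) + K * ℓ ^ (a + 4) * u + K * ℓ ^ (a + 4) * v := by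
        gcongr
        exact one_le_mul_of_one_le_of_one_le hK h2
    _ = _ := by ring

/-- One bound, valid for every final noise `g` outside bad sets of data and search noise, serves
both claims: the first bounds `g` coordinate-wise with high probability, the second integrates over
`g`. -/
theorem plan_accuracy {p : ℕ} (hp : 1 ≤ p) {κ : ℝ} (hκ : 0 ≤ κ) {A c : ℝ} (a : ℕ) (hA : 0 < A)
    (hc : 0 < c) :
    ∃ (K : ℝ) (m : ℕ), 0 < K ∧
      ∀ (d n : ℕ) (_ : 1 ≤ d) (M ρ β : ℝ) (_ : 0 < M) (_ : 0 < ρ) (_ : 0 < β) (_ : β < 1)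
        (D : Measure (Fin d → ℝ)) (_ : IsProbabilityMeasure D)
        (σ σhat : Fin d → ℝ),
        (∀ᵐ x ∂D, ∀ i, |x i| ≤ M) →
        (∀ i, 1 ≤ σ i) →
        IsGoodEstimate p σ σhat →
        IsWellConcentrated A c a p D σ →
        K * Real.log (2 + d + M + 1 / β) ^ m * max 1 (max (√(d / ρ)) (1 / ρ)) ≤ n →
        1 - ENNReal.ofReal β ≤
          ((Measure.pi fun _ : Fin n => D).prod ((quantileNoise d M).prod (stdGaussianVec d)))
            {ω | vecNorm p (plan p M (√n + κ * √(1 / (ρ / 3))) (ρ / 3) (ρ / 3) (ρ / 3) σhat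
                ω.1 ω.2.1 ω.2.2 - mean D) ≤
              K * Real.log (2 + d + n + M + 1 / β) ^ m * rate p n ρ σ} ∧
        1 - ENNReal.ofReal β ≤
          ((Measure.pi fun _ : Fin n => D).prod (quantileNoise d M))
            {ω | ∫⁻ g, ENNReal.ofReal (vecNorm p (plan p M (√n + κ * √(1 / (ρ / 3)))
                (ρ / 3) (ρ / 3) (ρ / 3) σhat ω.1 ω.2 g - mean D)) ∂(stdGaussianVec d) ≤
              ENNReal.ofReal (K * Real.log (2 + d + n + M + 1 / β) ^ m * rate p n ρ σ)} := by
  obtain ⟨K₁, hK₁, htail⟩ := exists_tail_le A c hA hc a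
  set m₁ : ℝ := ∫ w, |w| ^ p ∂(gaussianReal 0 1) with hm₁
  have hm₁0 : 0 ≤ m₁ := integral_nonneg fun w => by positivity
  set Q : ℝ := K₁ * (3 * √(10 * 4 ^ max p 2) + 8 + 6 * (13 + 2 * κ)) with hQ
  have hQ0 : 0 ≤ Q := by positivity
  -- The sum of all constants that occur, so that each of them is at most `K`. The power `a + 4`
  -- covers both `log⁴` in the sample size and `log^(a+2)` in the error.
  set K : ℝ := 512 + (14 + 2 * κ) ^ 2 + Q + 240 * K₁ + 60 * (1 + m₁) * K₁ with hK
  have hK512 : 512 + (14 + 2 * κ) ^ 2 ≤ K := by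
    have : 0 ≤ Q + 240 * K₁ + 60 * (1 + m₁) * K₁ := by positivity
    linarith
  have hK1 : 512 ≤ K := by linarith [sq_nonneg (14 + 2 * κ)]
  have hQK : Q ≤ K := by
    have : 0 ≤ 512 + (14 + 2 * κ) ^ 2 + 240 * K₁ + 60 * (1 + m₁) * K₁ := by positivity
    linarith
  have hK240 : 240 * K₁ ≤ K := by
    have : 0 ≤ 512 + (14 + 2 * κ) ^ 2 + Q + 60 * (1 + m₁) * K₁ := by positivity
    linarith
  have hK60 : 60 * (1 + m₁) * K₁ ≤ K := by
    have : 0 ≤ 512 + (14 + 2 * κ) ^ 2 + Q + 240 * K₁ := by positivity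
    linarith
  clear_value K
  refine ⟨K, a + 4, by linarith, ?_⟩
  intro d n hd M ρ β hM hρ hβ hβ1 D hDp σ σhat hD hσ hgood hwc hn
  have hd1 : (1 : ℝ) ≤ d := by exact_mod_cast hd
  have hβ' : 1 < 1 / β := by rw [lt_div_iff₀ hβ]; linarith
  have hn00 : (0 : ℝ) ≤ n := Nat.cast_nonneg n
  set N₀ : ℝ := 2 + d + M + 1 / β with hN₀
  set N : ℝ := 2 + d + n + M + 1 / β with hN
  have hN₀4 : 4 ≤ N₀ := by linarith
  have hN₀N : N₀ ≤ N := by linarith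
  have hN4 : 4 ≤ N := by linarith
  have hβN : 1 / N₀ ≤ β := by
    rw [div_le_iff₀ (by linarith)]
    calc 1 = β * (1 / β) := by field_simp
      _ ≤ β * N₀ := by gcongr; linarith
  have hβN' : 1 / N ≤ β := (one_div_le_one_div_of_le (by linarith) hN₀N).trans hβN
  have hdN : (d : ℝ) ≤ N₀ := by linarith
  have hMN : M ≤ N₀ := by linarith
  have hnN : (n : ℝ) ≤ N := by linarith
  clear_value N₀ N
  have hL := one_le_log_of_four_le hN₀4
  have hℓ := one_le_log_of_four_le hN4
  set L := Real.log N₀ with hLdef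
  have hLpow : ∀ k ≤ 4, L ^ k ≤ L ^ (a + 4) := fun k hk => pow_le_pow_right₀ hL (by omega)
  have hreq : ∀ (k : ℕ) (C r : ℝ), k ≤ 4 → C ≤ K → 0 ≤ r →
      r ≤ max 1 (max (√(d / ρ)) (1 / ρ)) → C * L ^ k * r ≤ n := by
    intro k C r hk hC hr0 hr
    refine le_trans ?_ hn
    have := hLpow k hk
    gcongr
  have hn₁ : 512 + (14 + 2 * κ) ^ 2 ≤ (n : ℝ) := by
    have := hreq 0 (512 + (14 + 2 * κ) ^ 2) 1 (by omega) hK512 zero_le_one (le_max_left _ _)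
    simpa using this
  have hn₁' : 512 * L ≤ n := by
    have := hreq 1 512 1 (by omega) hK1 zero_le_one (le_max_left _ _)
    simpa using this
  have hn₂ : 96 * L ^ 2 * √(d / ρ) ≤ n := hreq 2 96 _ (by omega) (by linarith)
    (Real.sqrt_nonneg _) ((le_max_left _ _).trans (le_max_right _ _))
  have hn₃ : 145 * L ^ 4 * (1 / ρ) ≤ n := hreq 4 145 _ (by omega) (by linarith)
    (by positivity) ((le_max_right _ _).trans (le_max_right _ _))
  have hn0 : (0 : ℝ) < n := by linarith
  have hσ0 : ∀ i, 0 < σ i := fun i => by linarith [hσ i]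
  have hpow : 1 ≤ Real.log N ^ (a + 1) := one_le_pow₀ hℓ
  have ht : 1 < K₁ * Real.log N ^ (a + 1) := by nlinarith
  have hB₁ := measure_not_isTypical_le hd hp hM hN₀4 hN₀N hβN hdN hnN hD hσ hgood hwc ht
    (htail d N hd hN4 (hdN.trans hN₀N)) hn₁'
  have hB₂ := quantileNoise_le hM hd hN₀4 hβN hdN hMN
  have hB₃ := stdGaussianVec_le hN4 hβN' (hdN.trans hN₀N)
  set E := 3 * (√(5 * 4 ^ max p 2 * (n + 1)) * vecNorm p σ) +
        n * (d * (2 * M) * Real.exp (-(6 * Real.log N))) +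
        4 * Real.log N * √n * (2 * (K₁ * Real.log N ^ (a + 1) * vecNorm p σ)) with hE
  set B₁ := {x : Fin n → Fin d → ℝ | ¬ IsTypical p D σ σhat M (K₁ * Real.log N ^ (a + 1)) E x}
  -- Search noise is cut off at `log N₀` because it has to be small compared with `n`; the final
  -- noise enters only the error, where `log N` is allowed.
  set B₂ := {w : QuantileNoise d M | (∃ i l, 4 * L < |w.1 i l|) ∨ ∃ l, 4 * L < |w.2 l|}
  set B₃ := {g : Fin d → ℝ | ∃ i, 4 * Real.log N < |g i|}
  set u := vecNorm p σ / √n with hu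
  set S := scaledVar p σ with hS
  have hS1 : 1 ≤ S := one_le_scaledVar hd hσ
  set v := vecNorm (2 * (p : ℝ) / (p + 2)) σ / (n * √ρ) with hv
  have hu0 : 0 ≤ u := div_nonneg (vecNorm_nonneg _ _) (Real.sqrt_nonneg _)
  have hv0 : 0 ≤ v := div_nonneg (vecNorm_nonneg _ _) (by positivity)
  have hvS : √S * S ^ (1 / (p : ℝ)) / (n * √ρ) = v := by
    rw [hv, hS, scaledVar_rpow hp hσ0]
  have hrate : rate p n ρ σ = 1 + u + v := rfl
  set F : ℝ := 30 * (K₁ * Real.log N ^ (a + 1)) * √S / (n * √ρ) with hF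
  have hF0 : 0 ≤ F := by positivity
  have hscale : vecNorm p (scale p σhat) ≤ 2 * S ^ (1 / (p : ℝ)) :=
    vecNorm_scale_le hp hd hσ hgood
  have hmain : ∀ x ∉ B₁, ∀ w ∉ B₂, ∀ g, vecNorm p (plan p M (√n + κ * √(1 / (ρ / 3)))
      (ρ / 3) (ρ / 3) (ρ / 3) σhat x w g - mean D) ≤
      1 + Q * Real.log N ^ (a + 2) * u + F * vecNorm p (fun i => g i * scale p σhat i) := by
    intro x hx w hw g
    have hw1 : ∀ i l, |w.1 i l| ≤ 4 * L := fun i l => by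
      by_contra h; exact hw (Or.inl ⟨i, l, not_le.mp h⟩)
    have hw2 : ∀ l, |w.2 l| ≤ 4 * L := fun l => by
      by_contra h; exact hw (Or.inr ⟨l, not_le.mp h⟩)
    exact vecNorm_plan_sub_le_of_isTypical hp hd hκ hM hρ hN₀4 hN₀N hdN hMN (abs_mean_le hD) hσ
      hgood hK₁ hn₁ hn₂ hn₃ (not_not.mp hx) hw1 hw2 g
  constructor
  · refine one_sub_le_measure (B := (B₁ ×ˢ Set.univ ∪ Set.univ ×ˢ (B₂ ×ˢ Set.univ)) ∪
      Set.univ ×ˢ (Set.univ ×ˢ B₃)) ?_ ?_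
    · rintro ⟨x, w, g⟩ hω
      simp only [Set.mem_union, Set.mem_prod, Set.mem_univ, and_true, true_and, not_or] at hω
      obtain ⟨⟨hx, hw⟩, hg⟩ := hω
      have hg' : ∀ i, |g i| ≤ 4 * Real.log N := fun i => by
        by_contra h; exact hg ⟨i, not_le.mp h⟩
      refine (hmain x hx w hw g).trans ?_
      rw [hrate]
      -- Here `240 = 30 · 4 · 2`, from `F`, the level of the noise and the norm of the scaling
      -- factors.
      have h1 : F * vecNorm p (fun i => g i * scale p σhat i) ≤
          240 * K₁ * Real.log N ^ (a + 2) * v := by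
        calc F * vecNorm p (fun i => g i * scale p σhat i)
            ≤ F * (4 * Real.log N * (2 * S ^ (1 / (p : ℝ)))) := by
              gcongr
              exact (vecNorm_mul_le (by exact_mod_cast hp) (by positivity) hg').trans (by gcongr)
          _ = _ := by
              rw [← hvS, hF]
              ring
      exact (add_le_add le_rfl h1).trans (add_mul_pow_le hℓ (by linarith) hQK hK240 hu0 hv0)
    · refine (measure_union_le _ _).trans ((add_le_add (measure_union_le _ _) le_rfl).trans ?_)
      simp only [Measure.prod_prod, measure_univ, mul_one, one_mul]
      calc _ ≤ ENNReal.ofReal (β / 4) + ENNReal.ofReal (β / 4) + ENNReal.ofReal (β / 20) := by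
            gcongr
        _ = ENNReal.ofReal (β / 4 + β / 4 + β / 20) := by
            rw [ENNReal.ofReal_add (by positivity) (by positivity),
              ENNReal.ofReal_add (by positivity) (by positivity)]
        _ ≤ _ := ENNReal.ofReal_le_ofReal (by linarith)
  -- The final noise needs no exceptional set here, since its expected norm is bounded by its `p`-th
  -- moment.
  · refine one_sub_le_measure (B := B₁ ×ˢ Set.univ ∪ Set.univ ×ˢ B₂) ?_ ?_
    · rintro ⟨x, w⟩ hω
      simp only [Set.mem_union, Set.mem_prod, Set.mem_univ, and_true, true_and, not_or] at hω
      obtain ⟨hx, hw⟩ := hω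
      have hU0 : 0 ≤ 1 + Q * Real.log N ^ (a + 2) * u := by positivity
      have hnoise := lintegral_vecNorm_gaussian_le hp
        (by positivity : 0 < 2 * S ^ (1 / (p : ℝ))) hscale
      have hmeas : Measurable fun g : Fin d → ℝ =>
          ENNReal.ofReal (vecNorm p (fun i => g i * scale p σhat i)) :=
        (measurable_vecNorm _ (measurable_pi_lambda _ fun i =>
          (measurable_pi_apply i).mul_const _)).ennreal_ofReal
      calc ∫⁻ g, ENNReal.ofReal (vecNorm p (plan p M (√n + κ * √(1 / (ρ / 3)))
              (ρ / 3) (ρ / 3) (ρ / 3) σhat x w g - mean D)) ∂(stdGaussianVec d)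
          ≤ ∫⁻ g, (ENNReal.ofReal (1 + Q * Real.log N ^ (a + 2) * u) + ENNReal.ofReal F *
              ENNReal.ofReal (vecNorm p (fun i => g i * scale p σhat i))) ∂(stdGaussianVec d) := by
            refine lintegral_mono fun g => ?_
            rw [← ENNReal.ofReal_mul hF0, ← ENNReal.ofReal_add hU0
              (mul_nonneg hF0 (vecNorm_nonneg _ _))]
            exact ENNReal.ofReal_le_ofReal (hmain x hx w hw g)
        _ ≤ ENNReal.ofReal (1 + Q * Real.log N ^ (a + 2) * u) + ENNReal.ofReal F *
              ENNReal.ofReal (2 * S ^ (1 / (p : ℝ)) * (1 + m₁)) := by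
            rw [lintegral_add_left measurable_const, lintegral_const, measure_univ, mul_one,
              lintegral_const_mul _ hmeas]
            gcongr
        _ = ENNReal.ofReal (1 + Q * Real.log N ^ (a + 2) * u +
              F * (2 * S ^ (1 / (p : ℝ)) * (1 + m₁))) := by
            rw [← ENNReal.ofReal_mul hF0, ← ENNReal.ofReal_add hU0 (by positivity)]
        _ ≤ _ := by
            refine ENNReal.ofReal_le_ofReal ?_
            rw [hrate]
            have h1 : F * (2 * S ^ (1 / (p : ℝ)) * (1 + m₁)) ≤
                60 * (1 + m₁) * K₁ * Real.log N ^ (a + 2) * v := by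
              calc F * (2 * S ^ (1 / (p : ℝ)) * (1 + m₁))
                  = 60 * (1 + m₁) * K₁ * Real.log N ^ (a + 1) * v := by
                    rw [← hvS, hF]; ring
                _ ≤ _ := by
                    gcongr
                    norm_num
            exact (add_le_add le_rfl h1).trans
              (add_mul_pow_le hℓ (by linarith) hQK hK60 hu0 hv0)
    · refine (measure_union_le _ _).trans ?_
      rw [Measure.prod_prod, Measure.prod_prod, measure_univ, measure_univ, mul_one, one_mul]
      calc _ ≤ ENNReal.ofReal (β / 4) + ENNReal.ofReal (β / 4) := add_le_add hB₁ hB₂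
        _ = ENNReal.ofReal (β / 4 + β / 4) :=
            (ENNReal.ofReal_add (by positivity) (by positivity)).symm
        _ ≤ _ := ENNReal.ofReal_le_ofReal (by linarith)

end Plan

end

theorem theorem4p4 (p : ℕ) (hp : 1 ≤ p) (κ : ℝ) (hκ : 0 ≤ κ) :
    -- privacy, for arbitrary datasets
    (∀ (d n : ℕ) (_ : 1 ≤ d) (M ρ : ℝ) (_ : 0 < M) (_ : 0 < ρ)
        (σhat : Fin d → ℝ) (_ : ∀ i, 0 < σhat i),
      Plan.IsZCDP ρ
        (Plan.planLaw (n := n) p M (Real.sqrt n + κ * Real.sqrt (1 / (ρ / 3)))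
          (ρ / 3) (ρ / 3) (ρ / 3) σhat)) ∧
    -- utility, for independent samples of a well-concentrated distribution
    (∀ (A c : ℝ) (a : ℕ), 0 < A → 0 < c →
      ∃ (K : ℝ) (m : ℕ), 0 < K ∧
        ∀ (d n : ℕ) (_ : 1 ≤ d) (M ρ β : ℝ) (_ : 0 < M) (_ : 0 < ρ) (_ : 0 < β) (_ : β < 1)
          (D : Measure (Fin d → ℝ)) (_ : IsProbabilityMeasure D)
          (σ σhat : Fin d → ℝ),
          (∀ᵐ x ∂D, ∀ i, |x i| ≤ M) →
          (∀ i, 1 ≤ σ i) →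
          Plan.IsGoodEstimate p σ σhat →
          Plan.IsWellConcentrated A c a p D σ →
          K * Real.log (2 + d + M + 1 / β) ^ m * max 1 (max (Real.sqrt (d / ρ)) (1 / ρ)) ≤ n →
          -- the error, over the samples and all the randomness of the mechanism
          1 - ENNReal.ofReal β ≤
            ((Measure.pi fun _ : Fin n => D).prod
              ((Plan.quantileNoise d M).prod (Plan.stdGaussianVec d)))
              {ω | Plan.vecNorm p
                  (Plan.plan p M (Real.sqrt n + κ * Real.sqrt (1 / (ρ / 3)))
                    (ρ / 3) (ρ / 3) (ρ / 3) σhat ω.1 ω.2.1 ω.2.2 - Plan.mean D) ≤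
                K * Real.log (2 + d + n + M + 1 / β) ^ m * Plan.rate p n ρ σ} ∧
          -- the expected error over the final Gaussian noise, with high probability over
          -- the samples and the randomness of the quantile searches
          1 - ENNReal.ofReal β ≤
            ((Measure.pi fun _ : Fin n => D).prod (Plan.quantileNoise d M))
              {ω | ∫⁻ g, ENNReal.ofReal (Plan.vecNorm p
                  (Plan.plan p M (Real.sqrt n + κ * Real.sqrt (1 / (ρ / 3)))
                    (ρ / 3) (ρ / 3) (ρ / 3) σhat ω.1 ω.2 g - Plan.mean D))
                  ∂(Plan.stdGaussianVec d) ≤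
                ENNReal.ofReal
                  (K * Real.log (2 + d + n + M + 1 / β) ^ m * Plan.rate p n ρ σ)}) := by
  exact ⟨fun d n hd M ρ _ hρ σhat _ => Plan.isZCDP_planLaw hd p M _ hρ σhat,
    fun A c a hA hc => Plan.plan_accuracy hp hκ a hA hc⟩
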